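/- Let $p=(p_1,\dots,p_N)$ be a sequence of $N$ points in $\mathbb{R}^d$. A $k$-ary relation $E$ on $p$ is a set of ordered $k$-tuples $(p_{i_1},\dots,p_{i_k})$ with $i_1<\dots<i_k$ (tuples being identified by their indices). It is called semi-algebraic of complexity at most $t$ if there are polynomials $f_1,\dots,f_t\in\mathbb{R}[x_1,\dots,x_{dk}]$ of total degree at most $t$ and a Boolean function $\Phi$ of $t$ variables such that, for all $i_1<\dots<i_k$, $$(p_{i_1},\dots,p_{i_k})\in E\iff \Phi\bigl(f_1(p_{i_1},\dots,p_{i_k})\ge 0,\ \dots,\ f_t(p_{i_1},\dots,p_{i_k})\ge 0\bigr)=1 .$$ Let $R_k^{d,t}(s,n)$ denote the minimum integer $N\ge 0$ such that for every sequence of $N$ points in $\mathbb{R}^d$ and every $k$-ary semi-algebraic relation $E$ on it of complexity at most $t$, the sequence has $s$ members such that every $k$-tuple induced by them is in $E$, or $n$ members such that no $k$-tuple induced by them is in $E$. For all integers $s,t\ge 0$ there is a constant $c>0$, depending only on $s$ and $t$, such that for every integer $n\ge 4$ the number $R_4^{1,t}(s,n)$ exists (i.e. some such $N$ exists) and $$R_4^{1,t}(s,n)\le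 2^{2^{(\log n)^{c}}},$$ where $\log$ is the natural logarithm. -/

import Mathlib

/-- A `k`-ary relation `E` on a sequence `p` of `N` points of `ℝ^d` is a set of ordered `k`-tuples
`(p_{i_1}, …, p_{i_k})` with `i_1 < ⋯ < i_k`; such a tuple is given by its strictly increasing
index tuple `e : Fin k ↪o Fin N`.

`E` is *semi-algebraic of complexity at most `t`* if there are `t` real polynomials of (total)
degree at most `t` in the `k * d` coordinates of `k` points of `ℝ^d`, and a Boolean function `Φ`
of `t` truth values, such that a tuple lies in `E` iff `Φ (f_1 ≥ 0, …, f_t ≥ 0)` holds at it.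
(Fewer than `t` polynomials are covered: pad with zero polynomials.) -/
def SemialgebraicRelation {d k N : ℕ} (t : ℕ) (p : Fin N → Fin d → ℝ)
    (E : Set (Fin k ↪o Fin N)) : Prop :=
  ∃ (f : Fin t → MvPolynomial (Fin k × Fin d) ℝ) (Φ : (Fin t → Prop) → Prop),
    (∀ j, (f j).totalDegree ≤ t) ∧
    ∀ e : Fin k ↪o Fin N,
      e ∈ E ↔ Φ (fun j => 0 ≤ MvPolynomial.eval (fun x : Fin k × Fin d => p (e x.1) x.2) (f j))

/-- The Ramsey property of the number `N`: for every sequence of `N` points of `ℝ^d` and every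
`k`-ary semi-algebraic relation `E` on it of complexity at most `t`, there are `s` members of the
sequence all of whose `k`-tuples are in `E`, or `n` members none of whose `k`-tuples is in `E`. -/
def SemialgebraicRamseyProperty (d t k s n N : ℕ) : Prop :=
  ∀ (p : Fin N → Fin d → ℝ) (E : Set (Fin k ↪o Fin N)), SemialgebraicRelation t p E →
    (∃ S : Finset (Fin N), S.card = s ∧
      ∀ e : Fin k ↪o Fin N, (∀ a, e a ∈ S) → e ∈ E) ∨
    (∃ S : Finset (Fin N), S.card = n ∧
      ∀ e : Fin k ↪o Fin N, (∀ a, e a ∈ S) → e ∉ E)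

/-- The off-diagonal semi-algebraic Ramsey number `R_k^{d,t}(s,n)`: the least `N` with the Ramsey
property (a genuine minimum as soon as some `N` has the property). -/
noncomputable def semialgebraicRamsey (d t k s n : ℕ) : ℕ :=
  sInf {N : ℕ | SemialgebraicRamseyProperty d t k s n N}

/-! The arity is lowered from four to three at the cost of one exponential, and the ternary Ramsey
number on the line is shown to be quasi-polynomial in `n` for fixed `s`.

Arity: greedy Erdős–Rado selection (`Finset.exists_end_homogeneous`) in `2 ^ (M ^ 3 + M)` points
yields `M` points on which membership of a quadruple survives replacing its last point by one fixed
point `w`. With `w` frozen, a ternary semialgebraic relation remains in which the coordinate of `w`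
is one more coefficient. So `M = 2 ^ ((log n) ^ O(1))` gives the claimed double exponential.

Ternary case (`exists_clique_or_independent`), by induction on `s`: if no clique of size `s + 1`
exists, then no vertex `b` has a large set before it all of whose pairs form a triple with `b`,
since by induction such a set contains an `s`-clique, which `b` extends. `Semialg.exists_free_pair`
then provides subsets `A'`, `B'`, smaller only by a factor polynomial in `log |A|` and in the clique
size, with no triple having two vertices in `A'` and its last in `B'`. Applying this and its mirror
image to the two halves of a set and recursing `L` times inside the halves gives an independent set
of size `2 ^ L`.

Free pairs: for fixed `x`, `b` the truth of `E x y b` alternates boundedly often in `y > x`, so `E`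
is a bounded union of strips `U ∧ ¬ W` between sets upward closed in `y`. The monotonicity theorem
makes the thresholds monotone in `x` and in `b` on subsets of positive proportion. If the two
thresholds of a strip move in opposite directions as `b` grows, a single parameter has the widest
strip. If they move together, `B` is cut into `r` quantiles, and a chain-doubling argument
(`exists_large_drop`) finds a quantile on which the strip is sparse.

The tame geometry rests on quantifier elimination (`exists_finite_signMatch`, `Semialg.ex`), proved
with sign diagrams. All its bounds are uniform in the coefficients, so they depend only on `t` and
on `Φ`, which has finitely many values. -/

open Polynomial

/-! ### Matching the root patterns of two families of univariate polynomials -/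

/-- A correspondence between two copies of the real line that matches the signs of two families of
polynomials and respects the order relative to the roots of the first family. -/
structure RootMatch {ι : Type*} (P Q : ι → ℝ[X]) (ρ : ℝ → ℝ → Prop) : Prop where
  total : ∀ y, ∃ y', ρ y y'
  surj : ∀ y', ∃ y, ρ y y'
  sign_eq : ∀ {y y'}, ρ y y' → ∀ i, SignType.sign ((P i).eval y) = SignType.sign ((Q i).eval y')
  lt_iff : ∀ {y y' u u'}, ρ y y' → ρ u u' → (∃ i, (P i).IsRoot y) →
    (y < u ↔ y' < u') ∧ (u < y ↔ u' < y')

theorem Polynomial.isRoot_iff_of_sign_eq {p q : ℝ[X]} {y y' : ℝ}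
    (h : SignType.sign (p.eval y) = SignType.sign (q.eval y')) : p.IsRoot y ↔ q.IsRoot y' := by
  rw [IsRoot.def, IsRoot.def, ← sign_eq_zero_iff, h, sign_eq_zero_iff]

namespace RootMatch
variable {ι : Type*} {P Q : ι → ℝ[X]} {ρ : ℝ → ℝ → Prop}

theorem root_iff (M : RootMatch P Q ρ) {y y' : ℝ} (h : ρ y y') :
    (∃ i, (P i).IsRoot y) ↔ ∃ i, (Q i).IsRoot y' :=
  exists_congr fun i => isRoot_iff_of_sign_eq (M.sign_eq h i)

theorem flip (M : RootMatch P Q ρ) : RootMatch Q P (fun a b => ρ b a) where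
  total := M.surj
  surj := M.total
  sign_eq h i := (M.sign_eq h i).symm
  lt_iff h h' hr := by
    have := M.lt_iff h h' ((M.root_iff h).2 hr)
    exact ⟨this.1.symm, this.2.symm⟩

end RootMatch

/-- Two points lie in the same position relative to the matched roots of two families. -/
def CellMatch {ι : Type*} (P : ι → ℝ[X]) (ρ : ℝ → ℝ → Prop) (y y' : ℝ) : Prop :=
  ∀ z z', ρ z z' → (∃ i, (P i).IsRoot z) → (y < z ↔ y' < z') ∧ (z < y ↔ z' < y')

/-- No member of the family has a root between `a` and `b` (inclusive). -/
def RootFree {ι : Type*} (P : ι → ℝ[X]) (a b : ℝ) : Prop :=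
  ∀ w ∈ Set.uIcc a b, ¬ ∃ i, (P i).IsRoot w

theorem Polynomial.sign_eval_eq_of_no_root (p : ℝ[X]) {a b : ℝ}
    (h : ∀ w ∈ Set.uIcc a b, ¬ p.IsRoot w) :
    SignType.sign (p.eval a) = SignType.sign (p.eval b) := by
  have hc : ContinuousOn (fun x => p.eval x) (Set.uIcc a b) := p.continuous.continuousOn
  have hiv := intermediate_value_uIcc hc
  have h0 : (0 : ℝ) ∉ Set.uIcc (p.eval a) (p.eval b) := by
    intro h0
    obtain ⟨w, hw, hw0⟩ := hiv h0
    exact h w hw hw0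
  rw [Set.mem_uIcc] at h0
  push Not at h0
  rcases lt_trichotomy (p.eval a) 0 with ha | ha | ha
  · rw [sign_neg ha, sign_neg (h0.1 ha.le)]
  · exact absurd ha (h a Set.left_mem_uIcc)
  · have : 0 < p.eval b := by
      by_contra hb
      push Not at hb
      exact absurd (h0.2 hb) (not_lt.2 ha.le)
    rw [sign_pos ha, sign_pos this]

theorem RootFree.sign_eq {ι : Type*} {P : ι → ℝ[X]} {a b : ℝ} (h : RootFree P a b) {p : ℝ[X]}
    (hp : ∀ w, p.IsRoot w → ∃ i, (P i).IsRoot w) :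
    SignType.sign (p.eval a) = SignType.sign (p.eval b) :=
  p.sign_eval_eq_of_no_root fun w hw hr => h w hw (hp w hr)

theorem RootFree.symm {ι : Type*} {P : ι → ℝ[X]} {a b : ℝ} (h : RootFree P a b) :
    RootFree P b a := by
  intro w hw
  rw [Set.uIcc_comm] at hw
  exact h w hw

theorem RootFree.mono {ι : Type*} {P : ι → ℝ[X]} {a b c : ℝ} (h : RootFree P a b)
    (hc : c ∈ Set.uIcc a b) : RootFree P a c :=
  fun w hw => h w (Set.uIcc_subset_uIcc_left hc hw)

theorem Polynomial.strictMonoOn_of_derivative_pos (p : ℝ[X]) {a b : ℝ}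
    (h : ∀ w ∈ Set.Ioo a b, 0 < p.derivative.eval w) :
    StrictMonoOn (fun x => p.eval x) (Set.Icc a b) := by
  refine strictMonoOn_of_deriv_pos (convex_Icc a b) p.continuous.continuousOn ?_
  intro x hx
  rw [interior_Icc] at hx
  rw [Polynomial.deriv]
  exact h x hx

theorem Polynomial.strictAntiOn_of_derivative_neg (p : ℝ[X]) {a b : ℝ}
    (h : ∀ w ∈ Set.Ioo a b, p.derivative.eval w < 0) :
    StrictAntiOn (fun x => p.eval x) (Set.Icc a b) := by
  refine strictAntiOn_of_deriv_neg (convex_Icc a b) p.continuous.continuousOn ?_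
  intro x hx
  rw [interior_Icc] at hx
  rw [Polynomial.deriv]
  exact h x hx

/-- On a cell free of critical points, the sign of a polynomial beyond a root is governed by the
sign of its derivative. -/
theorem RootFree.sign_right {ι : Type*} {P : ι → ℝ[X]} {a b : ℝ} (h : RootFree P a b)
    (hab : a < b) {p : ℝ[X]} (hp : ∀ w, p.derivative.IsRoot w → ∃ i, (P i).IsRoot w) :
    (p.eval a = 0 → SignType.sign (p.eval b) = SignType.sign (p.derivative.eval a)) ∧
    (p.eval b = 0 → SignType.sign (p.eval a) = - SignType.sign (p.derivative.eval a)) := by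
  have hs : ∀ w ∈ Set.Icc a b,
      SignType.sign (p.derivative.eval a) = SignType.sign (p.derivative.eval w) := by
    intro w hw
    exact (h.mono (by rwa [Set.uIcc_of_le hab.le])).sign_eq hp
  rcases lt_trichotomy (p.derivative.eval a) 0 with hd | hd | hd
  · have := p.strictAntiOn_of_derivative_neg (a := a) (b := b) fun w hw => by
      have := hs w ⟨hw.1.le, hw.2.le⟩
      rw [sign_neg hd] at this
      exact sign_eq_neg_one_iff.1 this.symm
    have := this ⟨le_rfl, hab.le⟩ ⟨hab.le, le_rfl⟩ hab
    simp only at this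
    constructor
    · intro h0
      rw [sign_neg hd, sign_neg (by linarith)]
    · intro h0
      rw [sign_neg hd, sign_pos (by linarith)]
      decide
  · exact absurd (hp a hd) (h a Set.left_mem_uIcc)
  · have := p.strictMonoOn_of_derivative_pos (a := a) (b := b) fun w hw => by
      have := hs w ⟨hw.1.le, hw.2.le⟩
      rw [sign_pos hd] at this
      exact sign_eq_one_iff.1 this.symm
    have := this ⟨le_rfl, hab.le⟩ ⟨hab.le, le_rfl⟩ hab
    simp only at this
    constructor
    · intro h0
      rw [sign_pos hd, sign_pos (by linarith)]
    · intro h0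
      rw [sign_pos hd, sign_neg (by linarith)]

/-- The data needed to extend a root matching by one more pair of polynomials. -/
structure RootMatchExtension {ι : Type*} (P Q : ι → ℝ[X]) (ρ : ℝ → ℝ → Prop) (p q : ℝ[X]) : Prop
    extends RootMatch P Q ρ where
  finite_left : {z | ∃ i, (P i).IsRoot z}.Finite
  finite_right : {z | ∃ i, (Q i).IsRoot z}.Finite
  der : ∀ {y y'}, ρ y y' →
    SignType.sign (p.derivative.eval y) = SignType.sign (q.derivative.eval y')
  der_left : ∀ w, p.derivative.IsRoot w → ∃ i, (P i).IsRoot w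
  der_right : ∀ w, q.derivative.IsRoot w → ∃ i, (Q i).IsRoot w
  sign_root : ∀ {y y'}, ρ y y' → (∃ i, (P i).IsRoot y) →
    SignType.sign (p.eval y) = SignType.sign (q.eval y')
  degree_left : 0 < p.degree
  degree_right : 0 < q.degree

namespace RootMatchExtension
variable {ι : Type*} {P Q : ι → ℝ[X]} {ρ : ℝ → ℝ → Prop} {p q : ℝ[X]}

theorem flip (M : RootMatchExtension P Q ρ p q) :
    RootMatchExtension Q P (fun a b => ρ b a) q p where
  toRootMatch := M.toRootMatch.flip
  finite_left := M.finite_right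
  finite_right := M.finite_left
  der h := (M.der h).symm
  der_left := M.der_right
  der_right := M.der_left
  sign_root h hr := (M.sign_root h ((M.root_iff h).2 hr)).symm
  degree_left := M.degree_right
  degree_right := M.degree_left

theorem neg (M : RootMatchExtension P Q ρ p q) : RootMatchExtension P Q ρ (-p) (-q) where
  toRootMatch := M.toRootMatch
  finite_left := M.finite_left
  finite_right := M.finite_right
  der h := by simpa [Left.sign_neg] using M.der h
  der_left w hw := M.der_left w (by simpa using hw)
  der_right w hw := M.der_right w (by simpa using hw)
  sign_root h hr := by simpa [Left.sign_neg] using M.sign_root h hr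
  degree_left := by simpa using M.degree_left
  degree_right := by simpa using M.degree_right

end RootMatchExtension

namespace RootMatch
variable {ι : Type*} {P Q : ι → ℝ[X]} {ρ : ℝ → ℝ → Prop}

theorem cellMatch (M : RootMatch P Q ρ) {y y' : ℝ} (h : ρ y y') : CellMatch P ρ y y' := by
  intro z z' hz hr
  have := M.lt_iff hz h hr
  exact ⟨this.2, this.1⟩

theorem cellMatch_flip (M : RootMatch P Q ρ) {y y' : ℝ} :
    CellMatch Q (fun a b => ρ b a) y' y ↔ CellMatch P ρ y y' := by
  constructor
  · intro h z z' hz hr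
    have := h z' z hz ((M.root_iff hz).1 hr)
    exact ⟨this.1.symm, this.2.symm⟩
  · intro h z' z hz hr
    have := h z z' hz ((M.root_iff hz).2 hr)
    exact ⟨this.1.symm, this.2.symm⟩

theorem cellMatch_move_right (M : RootMatch P Q ρ) {y u' y' : ℝ} (h : CellMatch P ρ y u')
    (hf : RootFree Q u' y') : CellMatch P ρ y y' := by
  intro z z' hz hr
  have h1 := h z z' hz hr
  have h2 : z' ∉ Set.uIcc u' y' := fun hm => hf z' hm ((M.root_iff hz).1 hr)
  rw [Set.mem_uIcc] at h2
  push Not at h2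
  rw [h1.1, h1.2]
  constructor <;> constructor <;> intro h3 <;> by_contra h4 <;> push Not at h4 <;>
    [have := h2.1 h3.le; have := h2.2 h3.le; have := h2.2 h4; have := h2.1 h4] <;> grind

theorem cellMatch_move_left (M : RootMatch P Q ρ) {y u y' : ℝ} (h : CellMatch P ρ u y')
    (hf : RootFree P u y) : CellMatch P ρ y y' := by
  rw [← M.cellMatch_flip] at h ⊢
  exact M.flip.cellMatch_move_right h hf

theorem _root_.CellMatch.convex {y a b c : ℝ} (ha : CellMatch P ρ y a) (hb : CellMatch P ρ y b)
    (hc : c ∈ Set.uIcc a b) : CellMatch P ρ y c := by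
  intro z z' hz hr
  have h1 := ha z z' hz hr
  have h2 := hb z z' hz hr
  rw [Set.mem_uIcc] at hc
  grind

/-- Matched cells which are not roots contain no root between two of their points. -/
theorem rootFree_of_cellMatch (M : RootMatch P Q ρ) {y a b : ℝ} (hy : ¬ ∃ i, (P i).IsRoot y)
    (ha : CellMatch P ρ y a) (hb : CellMatch P ρ y b) : RootFree Q a b := by
  intro w hw hr
  obtain ⟨z, hz⟩ := M.surj w
  have hzr := (M.root_iff hz).2 hr
  have h1 := ha z w hz hzr
  have h2 := hb z w hz hzr
  have : z ≠ y := by rintro rfl; exact hy hzr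
  rw [Set.mem_uIcc] at hw
  grind

theorem _root_.CellMatch.eq_of_root {y y' : ℝ} (h : CellMatch P ρ y y')
    (hy : ∃ i, (P i).IsRoot y) {z' : ℝ} (hz : ρ y z') : y' = z' := by
  have := h y z' hz hy
  grind

theorem sign_of_cellMatch (M : RootMatch P Q ρ) {y y' : ℝ} (h : CellMatch P ρ y y') (i : ι) :
    SignType.sign ((P i).eval y) = SignType.sign ((Q i).eval y') := by
  obtain ⟨u', hu⟩ := M.total y
  rw [M.sign_eq hu i]
  by_cases hy : ∃ i, (P i).IsRoot y
  · rw [h.eq_of_root hy hu]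
  · exact (M.rootFree_of_cellMatch hy (M.cellMatch hu) h).sign_eq fun w hw => ⟨i, hw⟩

end RootMatch

namespace RootMatchExtension
variable {ι : Type*} {P Q : ι → ℝ[X]} {ρ : ℝ → ℝ → Prop} {p q : ℝ[X]}

/-- As `p` increases to the right of `y` throughout the cell, it is positive at the next root `z`.
Hence `q` is positive at the partner of `z`, and by continuity just to the left of it, inside the
matched cell. If there is no next root, `q` increases on an unbounded cell and `|q|` tends to
infinity. -/
theorem exists_pos_of_derivative_pos (M : RootMatchExtension P Q ρ p q) {y u' : ℝ}
    (hy : ¬ ∃ i, (P i).IsRoot y) (hu : ρ y u') (hp : 0 < p.eval y)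
    (hd : 0 < p.derivative.eval y) : ∃ y', CellMatch P ρ y y' ∧ 0 < q.eval y' := by
  have hu' : ¬ ∃ i, (Q i).IsRoot u' := fun h => hy ((M.root_iff hu).2 h)
  by_cases hz : ∃ z, (∃ i, (P i).IsRoot z) ∧ y < z
  · obtain ⟨z, ⟨hzr, hyz⟩, hmin⟩ := Set.exists_min_image {z | (∃ i, (P i).IsRoot z) ∧ y < z} id
      (M.finite_left.subset fun z hz => hz.1) hz
    have hpz : 0 < p.eval z := by
      have := p.strictMonoOn_of_derivative_pos (a := y) (b := z) fun w hw => by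
        have hf : RootFree P y w := by
          intro v hv hr
          rw [Set.uIcc_of_le hw.1.le] at hv
          rcases hv.1.eq_or_lt with h | h
          · exact hy (h ▸ hr)
          · have := hmin v ⟨hr, h⟩
            exact absurd (hv.2.trans_lt hw.2) (not_lt.2 this)
        have := hf.sign_eq M.der_left
        rw [sign_pos hd] at this
        exact sign_eq_one_iff.1 this.symm
      exact hp.trans (this ⟨le_rfl, hyz.le⟩ ⟨hyz.le, le_rfl⟩ hyz)
    obtain ⟨z', hz'⟩ := M.total z
    have hqz : 0 < q.eval z' := by
      have := M.sign_root hz' hzr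
      rw [sign_pos hpz] at this
      exact sign_eq_one_iff.1 this.symm
    have huz : u' < z' := ((M.lt_iff hz' hu hzr).2).1 hyz
    have hev : ∀ᶠ x in nhdsWithin z' (Set.Iio z'), 0 < q.eval x :=
      nhdsWithin_le_nhds (q.continuous.continuousAt.eventually (lt_mem_nhds hqz))
    obtain ⟨y', hy'q, hy'⟩ := (hev.and (Ioo_mem_nhdsLT huz)).exists
    refine ⟨y', M.cellMatch_move_right (M.cellMatch hu) ?_, hy'q⟩
    intro w' hw' hr
    rw [Set.uIcc_of_le hy'.1.le] at hw'
    obtain ⟨w, hw⟩ := M.surj w'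
    have hwr := (M.root_iff hw).2 hr
    have h1 := M.lt_iff hw hu hwr
    have h2 := M.lt_iff hw hz' hwr
    have h3 : w < z := h2.1.2 (hw'.2.trans_lt hy'.2)
    have h4 : y < w := by
      rcases lt_trichotomy y w with h | h | h
      · exact h
      · exact absurd (h ▸ hwr) hy
      · exact absurd (h1.1.1 h) (not_lt.2 hw'.1)
    exact absurd h3 (not_lt.2 (hmin w ⟨hwr, h4⟩))
  · push Not at hz
    have hfree : ∀ v, u' ≤ v → RootFree Q u' v := by
      intro v hv w' hw' hr
      rw [Set.uIcc_of_le hv] at hw'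
      obtain ⟨w, hw⟩ := M.surj w'
      have hwr := (M.root_iff hw).2 hr
      have h1 := M.lt_iff hw hu hwr
      have h2 := hz w hwr
      rcases h2.eq_or_lt with h | h
      · exact hy (h ▸ hwr)
      · exact absurd (h1.1.1 h) (not_lt.2 hw'.1)
    have hqd : ∀ v, u' ≤ v → 0 < q.derivative.eval v := by
      intro v hv
      have h1 := (hfree v hv).sign_eq M.der_right
      rw [← M.der hu, sign_pos hd] at h1
      exact sign_eq_one_iff.1 h1.symm
    have hmono : ∀ v, u' ≤ v → q.eval u' ≤ q.eval v := by
      intro v hv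
      have := (q.strictMonoOn_of_derivative_pos (a := u') (b := v)
        fun w hw => hqd w hw.1.le).monotoneOn
      exact this ⟨le_rfl, hv⟩ ⟨hv, le_rfl⟩ hv
    obtain ⟨v, hv, hv'⟩ := ((q.abs_tendsto_atTop M.degree_right).eventually_gt_atTop
      |q.eval u'|).and (Filter.eventually_ge_atTop u') |>.exists
    refine ⟨v, M.cellMatch_move_right (M.cellMatch hu) (hfree v hv'), ?_⟩
    by_contra hneg
    push Not at hneg
    have h1 := hmono v hv'
    rw [abs_of_nonpos hneg, abs_of_nonpos (h1.trans hneg)] at hv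
    linarith

theorem exists_pos_of_derivative_neg (M : RootMatchExtension P Q ρ p q) {y u' : ℝ}
    (hy : ¬ ∃ i, (P i).IsRoot y) (hu : ρ y u') (hp : 0 < p.eval y)
    (hd : p.derivative.eval y < 0) : ∃ y', CellMatch P ρ y y' ∧ 0 < q.eval y' := by
  have hu' : ¬ ∃ i, (Q i).IsRoot u' := fun h => hy ((M.root_iff hu).2 h)
  by_cases hz : ∃ z, (∃ i, (P i).IsRoot z) ∧ z < y
  · obtain ⟨z, ⟨hzr, hyz⟩, hmin⟩ := Set.exists_max_image {z | (∃ i, (P i).IsRoot z) ∧ z < y} id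
      (M.finite_left.subset fun z hz => hz.1) hz
    have hpz : 0 < p.eval z := by
      have := p.strictAntiOn_of_derivative_neg (a := z) (b := y) fun w hw => by
        have hf : RootFree P y w := by
          intro v hv hr
          rw [Set.uIcc_of_ge hw.2.le] at hv
          rcases hv.2.eq_or_lt with h | h
          · exact hy (h ▸ hr)
          · have := hmin v ⟨hr, h⟩
            exact absurd (hw.1.trans_le hv.1) (not_lt.2 this)
        have := hf.sign_eq M.der_left
        rw [sign_neg hd] at this
        exact sign_eq_neg_one_iff.1 this.symm
      exact hp.trans (this ⟨le_rfl, hyz.le⟩ ⟨hyz.le, le_rfl⟩ hyz)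
    obtain ⟨z', hz'⟩ := M.total z
    have hqz : 0 < q.eval z' := by
      have := M.sign_root hz' hzr
      rw [sign_pos hpz] at this
      exact sign_eq_one_iff.1 this.symm
    have huz : z' < u' := ((M.lt_iff hz' hu hzr).1).1 hyz
    have hev : ∀ᶠ x in nhdsWithin z' (Set.Ioi z'), 0 < q.eval x :=
      nhdsWithin_le_nhds (q.continuous.continuousAt.eventually (lt_mem_nhds hqz))
    obtain ⟨y', hy'q, hy'⟩ := (hev.and (Ioo_mem_nhdsGT huz)).exists
    refine ⟨y', M.cellMatch_move_right (M.cellMatch hu) ?_, hy'q⟩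
    intro w' hw' hr
    rw [Set.uIcc_of_ge hy'.2.le] at hw'
    obtain ⟨w, hw⟩ := M.surj w'
    have hwr := (M.root_iff hw).2 hr
    have h1 := M.lt_iff hw hu hwr
    have h2 := M.lt_iff hw hz' hwr
    have h3 : z < w := h2.2.2 (hy'.1.trans_le hw'.1)
    have h4 : w < y := by
      rcases lt_trichotomy y w with h | h | h
      · exact absurd (h1.2.1 h) (not_lt.2 hw'.2)
      · exact absurd (h ▸ hwr) hy
      · exact h
    exact absurd h3 (not_lt.2 (hmin w ⟨hwr, h4⟩))
  · push Not at hz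
    have hfree : ∀ v, v ≤ u' → RootFree Q u' v := by
      intro v hv w' hw' hr
      rw [Set.uIcc_of_ge hv] at hw'
      obtain ⟨w, hw⟩ := M.surj w'
      have hwr := (M.root_iff hw).2 hr
      have h1 := M.lt_iff hw hu hwr
      have h2 := hz w hwr
      rcases h2.eq_or_lt with h | h
      · exact hy (h ▸ hwr)
      · exact absurd (h1.2.1 h) (not_lt.2 hw'.2)
    have hqd : ∀ v, v ≤ u' → q.derivative.eval v < 0 := by
      intro v hv
      have h1 := (hfree v hv).sign_eq M.der_right
      rw [← M.der hu, sign_neg hd] at h1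
      exact sign_eq_neg_one_iff.1 h1.symm
    have hmono : ∀ v, v ≤ u' → q.eval u' ≤ q.eval v := by
      intro v hv
      have := (q.strictAntiOn_of_derivative_neg (a := v) (b := u')
        fun w hw => hqd w hw.2.le).antitoneOn
      exact this ⟨le_rfl, hv⟩ ⟨hv, le_rfl⟩ hv
    obtain ⟨v, hv, hv'⟩ := ((q.abs_tendsto_atBot M.degree_right).eventually_gt_atTop
      |q.eval u'|).and (Filter.eventually_le_atBot u') |>.exists
    refine ⟨v, M.cellMatch_move_right (M.cellMatch hu) (hfree v hv'), ?_⟩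
    by_contra hneg
    push Not at hneg
    have h1 := hmono v hv'
    rw [abs_of_nonpos hneg, abs_of_nonpos (h1.trans hneg)] at hv
    linarith

theorem exists_pos (M : RootMatchExtension P Q ρ p q) {y : ℝ}
    (hy : ¬ ∃ i, (P i).IsRoot y) (hp : 0 < p.eval y) :
    ∃ y', CellMatch P ρ y y' ∧ 0 < q.eval y' := by
  obtain ⟨u', hu⟩ := M.total y
  rcases lt_trichotomy (p.derivative.eval y) 0 with hd | hd | hd
  · exact M.exists_pos_of_derivative_neg hy hu hp hd
  · exact absurd (M.der_left y hd) hy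
  · exact M.exists_pos_of_derivative_pos hy hu hp hd

theorem exists_neg (M : RootMatchExtension P Q ρ p q) {y : ℝ}
    (hy : ¬ ∃ i, (P i).IsRoot y) (hp : p.eval y < 0) :
    ∃ y', CellMatch P ρ y y' ∧ q.eval y' < 0 := by
  simpa using M.neg.exists_pos hy (by simpa using hp)

/-- Around a point that is not a root there is an open neighbourhood free of roots. -/
theorem exists_rootFree (M : RootMatchExtension P Q ρ p q) {y : ℝ}
    (hy : ¬ ∃ i, (P i).IsRoot y) :
    ∃ a b, a < y ∧ y < b ∧ RootFree P y a ∧ RootFree P y b := by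
  have ho : {z | ∃ i, (P i).IsRoot z}ᶜ ∈ nhds y :=
    M.finite_left.isClosed.isOpen_compl.mem_nhds hy
  obtain ⟨ε, hε, hball⟩ := Metric.mem_nhds_iff.1 ho
  refine ⟨y - ε / 2, y + ε / 2, by linarith, by linarith, ?_, ?_⟩
  · intro w hw
    rw [Set.uIcc_of_ge (by linarith)] at hw
    exact hball (by rw [Metric.mem_ball, Real.dist_eq, abs_lt]; constructor <;> linarith [hw.1, hw.2])
  · intro w hw
    rw [Set.uIcc_of_le (by linarith)] at hw
    exact hball (by rw [Metric.mem_ball, Real.dist_eq, abs_lt]; constructor <;> linarith [hw.1, hw.2])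

/-- The only delicate case is a zero of `p` inside a cell. There `p` is strictly monotone, so it
takes both signs in the cell. Hence `q` takes both signs in the matched cell, and the intermediate
value theorem gives a zero. -/
theorem exists_match (M : RootMatchExtension P Q ρ p q) (y : ℝ) :
    ∃ y', CellMatch P ρ y y' ∧ SignType.sign (p.eval y) = SignType.sign (q.eval y') := by
  by_cases hy : ∃ i, (P i).IsRoot y
  · obtain ⟨u', hu⟩ := M.total y
    exact ⟨u', M.cellMatch hu, M.sign_root hu hy⟩
  rcases lt_trichotomy (p.eval y) 0 with hp | hp | hp
  · obtain ⟨y', h1, h2⟩ := M.exists_neg hy hp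
    exact ⟨y', h1, by rw [sign_neg hp, sign_neg h2]⟩
  · obtain ⟨a, b, hay, hyb, ha, hb⟩ := M.exists_rootFree hy
    have hsa := (ha.symm.sign_right hay M.der_left).2 hp
    have hsb := (hb.sign_right hyb M.der_left).1 hp
    have hsd := ha.sign_eq M.der_left
    have hna : ¬ ∃ i, (P i).IsRoot a := ha a Set.right_mem_uIcc
    have hnb : ¬ ∃ i, (P i).IsRoot b := hb b Set.right_mem_uIcc
    have key : ∃ c d, CellMatch P ρ y c ∧ CellMatch P ρ y d ∧ 0 < q.eval c ∧ q.eval d < 0 := by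
      rcases lt_trichotomy (p.derivative.eval y) 0 with hd | hd | hd
      · rw [← hsd, sign_neg hd] at hsa
        rw [sign_neg hd] at hsb
        obtain ⟨c, hc, hc'⟩ := M.exists_pos hna (sign_eq_one_iff.1 (by rw [hsa]; decide))
        obtain ⟨d, hd, hd'⟩ := M.exists_neg hnb (sign_eq_neg_one_iff.1 (by rw [hsb]))
        exact ⟨c, d, M.cellMatch_move_left hc ha.symm, M.cellMatch_move_left hd hb.symm, hc', hd'⟩
      · exact absurd (M.der_left y hd) hy
      · rw [← hsd, sign_pos hd] at hsa
        rw [sign_pos hd] at hsb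
        obtain ⟨c, hc, hc'⟩ := M.exists_pos hnb (sign_eq_one_iff.1 (by rw [hsb]))
        obtain ⟨d, hd, hd'⟩ := M.exists_neg hna (sign_eq_neg_one_iff.1 (by rw [hsa]))
        exact ⟨c, d, M.cellMatch_move_left hc hb.symm, M.cellMatch_move_left hd ha.symm, hc', hd'⟩
    obtain ⟨c, d, hc, hd, hqc, hqd⟩ := key
    obtain ⟨y', hy', hq⟩ := intermediate_value_uIcc (f := fun x => q.eval x)
      (a := d) (b := c) q.continuous.continuousOn
      (Set.mem_uIcc.2 (Or.inl ⟨hqd.le, hqc.le⟩))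
    exact ⟨y', hd.convex hc hy', by rw [hp]; simp only at hq; rw [hq]⟩
  · obtain ⟨y', h1, h2⟩ := M.exists_pos hy hp
    exact ⟨y', h1, by rw [sign_pos hp, sign_pos h2]⟩

/-- If a root of the family separates the points, it already decides the order. Otherwise `p` is
strictly monotone between `y` and `u`, so the sign of `p` at `u` compared with that of its
derivative tells on which side of the zero `y` the point `u` lies; the same holds for `q`. -/
theorem lt_iff_of_match (M : RootMatchExtension P Q ρ p q) {y y' u u' : ℝ}
    (hy : CellMatch P ρ y y') (hu : CellMatch P ρ u u')
    (hs : SignType.sign (p.eval u) = SignType.sign (q.eval u'))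
    (hp : p.eval y = 0) (hq : q.eval y' = 0) : y < u ↔ y' < u' := by
  by_cases hyr : ∃ i, (P i).IsRoot y
  · obtain ⟨z', hz⟩ := M.total y
    have h1 := hy.eq_of_root hyr hz
    subst h1
    exact (hu y y' hz hyr).2
  by_cases hsep : ∃ z, (∃ i, (P i).IsRoot z) ∧ z ∈ Set.uIcc y u
  · obtain ⟨z, hzr, hz⟩ := hsep
    obtain ⟨z', hz'⟩ := M.total z
    have h1 := hy z z' hz' hzr
    have h2 := hu z z' hz' hzr
    have h3 : y ≠ z := by rintro rfl; exact hyr hzr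
    rw [Set.mem_uIcc] at hz
    grind
  · have hf : RootFree P y u := fun w hw hr => hsep ⟨w, hr, hw⟩
    have hf' : RootFree Q y' u' :=
      M.rootFree_of_cellMatch hyr hy (M.cellMatch_move_left hu hf.symm)
    obtain ⟨v', hv⟩ := M.total y
    have hd : SignType.sign (p.derivative.eval y) = SignType.sign (q.derivative.eval y') := by
      rw [M.der hv]
      exact (M.rootFree_of_cellMatch hyr (M.cellMatch hv) hy).sign_eq M.der_right
    have hd0 : SignType.sign (p.derivative.eval y) ≠ 0 := by
      rw [Ne, sign_eq_zero_iff]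
      exact fun h => hyr (M.der_left y h)
    have e1 : SignType.sign (p.eval u) = SignType.sign (p.derivative.eval y) ↔ y < u := by
      rcases lt_trichotomy y u with h | h | h
      · exact iff_of_true ((hf.sign_right h M.der_left).1 hp) h
      · subst h
        rw [hp, sign_zero]
        exact iff_of_false (fun h => hd0 h.symm) (lt_irrefl _)
      · rw [(hf.symm.sign_right h M.der_left).2 hp, ← hf.sign_eq M.der_left]
        refine iff_of_false (fun h => hd0 ?_) h.not_gt
        generalize SignType.sign (p.derivative.eval y) = s at h
        revert h; revert s; decide
    have e2 : SignType.sign (q.eval u') = SignType.sign (q.derivative.eval y') ↔ y' < u' := by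
      rw [hd] at hd0
      rcases lt_trichotomy y' u' with h | h | h
      · exact iff_of_true ((hf'.sign_right h M.der_right).1 hq) h
      · subst h
        rw [hq, sign_zero]
        exact iff_of_false (fun h => hd0 h.symm) (lt_irrefl _)
      · rw [(hf'.symm.sign_right h M.der_right).2 hq, ← hf'.sign_eq M.der_right]
        refine iff_of_false (fun h => hd0 ?_) h.not_gt
        generalize SignType.sign (q.derivative.eval y') = s at h
        revert h; revert s; decide
    rw [← e1, ← e2, hs, hd]

theorem gt_iff_of_match (M : RootMatchExtension P Q ρ p q) {y y' u u' : ℝ}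
    (hy : CellMatch P ρ y y') (hu : CellMatch P ρ u u')
    (hs : SignType.sign (p.eval u) = SignType.sign (q.eval u'))
    (hp : p.eval y = 0) (hq : q.eval y' = 0) : u < y ↔ u' < y' := by
  by_cases hyr : ∃ i, (P i).IsRoot y
  · obtain ⟨z', hz⟩ := M.total y
    have h1 := hy.eq_of_root hyr hz
    subst h1
    exact (hu y y' hz hyr).1
  by_cases hsep : ∃ z, (∃ i, (P i).IsRoot z) ∧ z ∈ Set.uIcc y u
  · obtain ⟨z, hzr, hz⟩ := hsep
    obtain ⟨z', hz'⟩ := M.total z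
    have h1 := hy z z' hz' hzr
    have h2 := hu z z' hz' hzr
    have h3 : y ≠ z := by rintro rfl; exact hyr hzr
    rw [Set.mem_uIcc] at hz
    grind
  · have hf : RootFree P y u := fun w hw hr => hsep ⟨w, hr, hw⟩
    have hf' : RootFree Q y' u' :=
      M.rootFree_of_cellMatch hyr hy (M.cellMatch_move_left hu hf.symm)
    have hlt := M.lt_iff_of_match hy hu hs hp hq
    -- By the strict version already proved, only the case of equality remains. A strictly monotone
    -- polynomial has at most one zero in a cell.
    have heq : y = u ↔ y' = u' := by
      constructor
      · intro h
        subst h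
        by_contra hne
        rw [hp, sign_zero, eq_comm, sign_eq_zero_iff] at hs
        rcases lt_or_gt_of_ne hne with h | h
        · have := (hf'.sign_right h M.der_right).1 hq
          rw [hs, sign_zero, eq_comm, sign_eq_zero_iff] at this
          exact hf' y' Set.left_mem_uIcc (M.der_right _ this)
        · have := (hf'.symm.sign_right h M.der_right).1 hs
          rw [hq, sign_zero, eq_comm, sign_eq_zero_iff] at this
          exact hf' u' Set.right_mem_uIcc (M.der_right _ this)
      · intro h
        subst h
        by_contra hne
        rw [hq, sign_zero, sign_eq_zero_iff] at hs
        rcases lt_or_gt_of_ne hne with h | h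
        · have := (hf.sign_right h M.der_left).1 hp
          rw [hs, sign_zero, eq_comm, sign_eq_zero_iff] at this
          exact hf y Set.left_mem_uIcc (M.der_left _ this)
        · have := (hf.symm.sign_right h M.der_left).1 hs
          rw [hp, sign_zero, eq_comm, sign_eq_zero_iff] at this
          exact hf u Set.right_mem_uIcc (M.der_left _ this)
    grind

theorem rootMatch (M : RootMatchExtension P Q ρ p q) :
    RootMatch (fun i : Option ι => i.elim p P) (fun i : Option ι => i.elim q Q)
      (fun y y' => CellMatch P ρ y y' ∧
        SignType.sign (p.eval y) = SignType.sign (q.eval y')) where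
  total := M.exists_match
  surj y' := by
    obtain ⟨y, h1, h2⟩ := M.flip.exists_match y'
    exact ⟨y, M.cellMatch_flip.1 h1, h2.symm⟩
  sign_eq := by
    rintro y y' ⟨h1, h2⟩ (_ | i)
    · exact h2
    · exact M.sign_of_cellMatch h1 i
  lt_iff := by
    rintro y y' u u' ⟨hy, hys⟩ ⟨hu, hus⟩ ⟨_ | i, hi⟩
    · have hi : p.eval y = 0 := hi
      have hq : q.eval y' = 0 := by rwa [hi, sign_zero, eq_comm, sign_eq_zero_iff] at hys
      exact ⟨M.lt_iff_of_match hy hu hus hi hq, M.gt_iff_of_match hy hu hus hi hq⟩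
    · obtain ⟨z', hz⟩ := M.total y
      have h1 := hy.eq_of_root ⟨i, hi⟩ hz
      subst h1
      have := hu y y' hz ⟨i, hi⟩
      exact ⟨this.2, this.1⟩

end RootMatchExtension

/-! ### Sign diagrams of polynomials with specialized coefficients -/

/-- A correspondence between two copies of the line that matches the signs of a finite collection of
polynomials under two specializations of their coefficients. -/
structure SignMatch {R : Type*} [CommRing R] (φ ψ : R →+* ℝ) (L : Multiset R[X])
    (ρ : ℝ → ℝ → Prop) : Prop where
  total : ∀ y, ∃ y', ρ y y'
  surj : ∀ y', ∃ y, ρ y y'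
  sign_eq : ∀ {y y'}, ρ y y' → ∀ p ∈ L,
    SignType.sign ((p.map φ).eval y) = SignType.sign ((p.map ψ).eval y')
  lt_iff : ∀ {y y' u u'}, ρ y y' → ρ u u' → (∃ p ∈ L, p.map φ ≠ 0 ∧ (p.map φ).eval y = 0) →
    (y < u ↔ y' < u') ∧ (u < y ↔ u' < y')

namespace Polynomial
variable {R : Type*} [CommRing R]

/-- One step of sign-preserving pseudo-division of `p` by `q`. -/
noncomputable def pseudoStep (p q : R[X]) : R[X] :=
  C (q.leadingCoeff ^ 2) * p -
    C (q.leadingCoeff * p.leadingCoeff) * (X ^ (p.natDegree - q.natDegree) * q)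

theorem degree_pseudoStep_lt {p q : R[X]} (hp : p ≠ 0) (h : q.degree ≤ p.degree) :
    (pseudoStep p q).degree < p.degree := by
  have h' := natDegree_le_natDegree h
  rw [degree_eq_natDegree hp, degree_lt_iff_coeff_zero]
  intro m hm
  rw [pseudoStep, coeff_sub, coeff_C_mul, coeff_C_mul, coeff_X_pow_mul', if_pos (by omega)]
  rcases hm.eq_or_lt with rfl | hm
  · rw [show p.natDegree - (p.natDegree - q.natDegree) = q.natDegree by omega,
      coeff_natDegree, coeff_natDegree]
    ring
  · rw [coeff_eq_zero_of_natDegree_lt hm, coeff_eq_zero_of_natDegree_lt (p := q) (by omega)]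
    ring

/-- This combination plays the role of the remainder of `p` modulo its derivative. The multiplier is
the positive integer `p.natDegree`, so no leading coefficient has to be inverted. -/
theorem degree_natDegree_smul_sub_lt {p : R[X]} (hp : p ≠ 0) :
    (C (p.natDegree : R) * p - X * derivative p).degree < p.degree := by
  rw [degree_eq_natDegree hp, degree_lt_iff_coeff_zero]
  intro m hm
  rw [coeff_sub, coeff_C_mul]
  rcases hm.eq_or_lt with rfl | hm
  · cases h : p.natDegree with
    | zero => simp
    | succ k => rw [coeff_X_mul, coeff_derivative]; push_cast; ring
  · cases m with
    | zero => omega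
    | succ k =>
      rw [coeff_X_mul, coeff_derivative, coeff_eq_zero_of_natDegree_lt hm]
      ring

/-- The leading coefficient enters `pseudoStep` squared, so the sign of `p` at a zero of `q` is kept
whatever the sign of that coefficient. -/
theorem sign_eval_pseudoStep (φ : R →+* ℝ) {p q : R[X]} {y : ℝ} (hq : φ q.leadingCoeff ≠ 0)
    (hy : (q.map φ).eval y = 0) :
    SignType.sign (((pseudoStep p q).map φ).eval y) = SignType.sign ((p.map φ).eval y) := by
  have : ((pseudoStep p q).map φ).eval y = φ q.leadingCoeff ^ 2 * (p.map φ).eval y := by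
    simp [pseudoStep, Polynomial.map_sub, Polynomial.map_mul, hy]
  rw [this, sign_mul, sign_pos (by positivity), one_mul]

theorem sign_eval_natDegree_smul_sub (φ : R →+* ℝ) {p : R[X]} {y : ℝ} (hp : 0 < p.natDegree)
    (hy : (p.derivative.map φ).eval y = 0) :
    SignType.sign (((C (p.natDegree : R) * p - X * derivative p).map φ).eval y) =
      SignType.sign ((p.map φ).eval y) := by
  have : ((C (p.natDegree : R) * p - X * derivative p).map φ).eval y =
      p.natDegree * (p.map φ).eval y := by
    simp only [Polynomial.map_sub, Polynomial.map_mul, map_X, eval_sub, eval_mul,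
      eval_X, hy, mul_zero, sub_zero, map_natCast, Polynomial.map_natCast, eval_natCast]
  rw [this, sign_mul, sign_pos (by exact_mod_cast hp), one_mul]

theorem map_eraseLead_of_leadingCoeff (φ : R →+* ℝ) {p : R[X]} (h : φ p.leadingCoeff = 0) :
    p.eraseLead.map φ = p.map φ := by
  rw [← self_sub_monomial_natDegree_leadingCoeff, Polynomial.map_sub, map_monomial, h,
    map_zero, sub_zero]

end Polynomial

namespace SignMatch
variable {R : Type*} [CommRing R] {φ ψ : R →+* ℝ} {L : Multiset R[X]} {ρ : ℝ → ℝ → Prop}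

theorem of_eraseLead [DecidableEq R[X]] {p : R[X]} (hφ : φ p.leadingCoeff = 0)
    (hψ : ψ p.leadingCoeff = 0) (M : SignMatch φ ψ (p.eraseLead ::ₘ L.erase p) ρ) :
    SignMatch φ ψ L ρ where
  total := M.total
  surj := M.surj
  sign_eq {y y'} h q hq := by
    by_cases hqp : q = p
    · subst hqp
      have := M.sign_eq h q.eraseLead (Multiset.mem_cons_self _ _)
      rwa [map_eraseLead_of_leadingCoeff φ hφ, map_eraseLead_of_leadingCoeff ψ hψ] at this
    · exact M.sign_eq h q (Multiset.mem_cons_of_mem ((Multiset.mem_erase_of_ne hqp).2 hq))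
  lt_iff h h' := by
    rintro ⟨q, hq, hq0, hqy⟩
    refine M.lt_iff h h' ?_
    by_cases hqp : q = p
    · subst hqp
      exact ⟨q.eraseLead, Multiset.mem_cons_self _ _, by
        rwa [map_eraseLead_of_leadingCoeff φ hφ], by
        rwa [map_eraseLead_of_leadingCoeff φ hφ]⟩
    · exact ⟨q, Multiset.mem_cons_of_mem ((Multiset.mem_erase_of_ne hqp).2 hq), hq0, hqy⟩

/-- A sign matching for the derivative, the other members of the collection and the pseudo-remainders
extends to a polynomial of largest degree. -/
theorem extend [DecidableEq R[X]] {p : R[X]} (hdeg : 0 < p.degree)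
    (hφ : ∀ q ∈ p ::ₘ L, q ≠ 0 → φ q.leadingCoeff ≠ 0)
    (hψ : ∀ q ∈ p ::ₘ L, q ≠ 0 → ψ q.leadingCoeff ≠ 0)
    (M : SignMatch φ ψ (L + derivative p ::ₘ
      (C (p.natDegree : R) * p - X * derivative p) ::ₘ L.map (pseudoStep p)) ρ) :
    ∃ ρ', SignMatch φ ψ (p ::ₘ L) ρ' := by
  have hp0 : p ≠ 0 := by rintro rfl; simp at hdeg
  have hnat : 0 < p.natDegree := natDegree_pos_iff_degree_pos.2 hdeg
  have hmapdeg : ∀ χ : R →+* ℝ, χ p.leadingCoeff ≠ 0 → 0 < (p.map χ).degree := by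
    intro χ hχ
    rwa [degree_map_eq_of_leadingCoeff_ne_zero χ hχ]
  have hmapder : ∀ χ : R →+* ℝ, χ p.leadingCoeff ≠ 0 → (derivative p).map χ ≠ 0 := by
    intro χ hχ h0
    rw [← derivative_map] at h0
    have := derivative_eq_zero.1 h0
    have h1 := natDegree_pos_iff_degree_pos.2 (hmapdeg χ hχ)
    omega
  have hφp := hφ p (Multiset.mem_cons_self _ _) hp0
  have hψp := hψ p (Multiset.mem_cons_self _ _) hp0
  -- The family whose roots are matched consists of the nonzero members of `L` and the derivative.
  -- The remainders are left out: they only supply the signs of `p` at these roots, in `sign_root`.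
  let ι := {q : R[X] // (q ∈ L ∧ q ≠ 0) ∨ q = derivative p}
  have hfin : Finite ι := by
    refine Set.Finite.to_subtype (s := {q : R[X] | (q ∈ L ∧ q ≠ 0) ∨ q = derivative p}) ?_
    refine ((L.toFinset.finite_toSet).union (Set.finite_singleton (derivative p))).subset ?_
    rintro q (⟨hq, -⟩ | hq)
    · exact Or.inl (by simpa using hq)
    · exact Or.inr hq
  have hne : ∀ χ : R →+* ℝ, (∀ q ∈ p ::ₘ L, q ≠ 0 → χ q.leadingCoeff ≠ 0) →
      ∀ i : ι, i.1.map χ ≠ 0 := by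
    rintro χ hχ ⟨q, ⟨hq, hq0⟩ | hq⟩
    · intro h0
      have h1 := hχ q (Multiset.mem_cons_of_mem hq) hq0
      have := coeff_map χ q.natDegree (p := q)
      rw [h0, coeff_zero] at this
      exact h1 this.symm
    · simp only [hq]
      exact hmapder χ (hχ p (Multiset.mem_cons_self _ _) hp0)
  have hfinroot : ∀ χ : R →+* ℝ, (∀ q ∈ p ::ₘ L, q ≠ 0 → χ q.leadingCoeff ≠ 0) →
      {z | ∃ i : ι, (i.1.map χ).IsRoot z}.Finite := by
    intro χ hχ
    have : {z | ∃ i : ι, (i.1.map χ).IsRoot z} = ⋃ i : ι, {z | (i.1.map χ).IsRoot z} := by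
      ext z; simp
    rw [this]
    exact Set.finite_iUnion fun i => finite_setOfPred_isRoot (hne χ hχ i)
  have hmem : ∀ i : ι, i.1 ∈ L + derivative p ::ₘ
      (C (p.natDegree : R) * p - X * derivative p) ::ₘ L.map (pseudoStep p) := by
    rintro ⟨q, ⟨hq, -⟩ | hq⟩
    · exact Multiset.mem_add.2 (Or.inl hq)
    · exact Multiset.mem_add.2 (Or.inr (Multiset.mem_cons.2 (Or.inl hq)))
  let d : ι := ⟨derivative p, Or.inr rfl⟩
  have E : RootMatchExtension (fun i : ι => i.1.map φ) (fun i : ι => i.1.map ψ) ρ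
      (p.map φ) (p.map ψ) := {
    total := M.total
    surj := M.surj
    sign_eq := fun h i => M.sign_eq h _ (hmem i)
    lt_iff := by
      rintro y y' u u' h h' ⟨i, hi⟩
      exact M.lt_iff h h' ⟨i.1, hmem i, hne φ hφ i, hi⟩
    finite_left := hfinroot φ hφ
    finite_right := hfinroot ψ hψ
    der := fun h => by
      rw [derivative_map, derivative_map]
      exact M.sign_eq h _ (hmem d)
    der_left := fun w hw => ⟨d, by rwa [derivative_map] at hw⟩
    der_right := fun w hw => ⟨d, by rwa [derivative_map] at hw⟩
    sign_root := by
      rintro y y' h ⟨⟨q, hq⟩, hi⟩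
      have hi' : (q.map ψ).eval y' = 0 :=
        (isRoot_iff_of_sign_eq (M.sign_eq h _ (hmem ⟨q, hq⟩))).1 hi
      have hi : (q.map φ).eval y = 0 := hi
      rcases hq with ⟨hq, hq0⟩ | rfl
      · rw [← sign_eval_pseudoStep φ (hφ q (Multiset.mem_cons_of_mem hq) hq0) hi,
          ← sign_eval_pseudoStep ψ (hψ q (Multiset.mem_cons_of_mem hq) hq0) hi']
        refine M.sign_eq h _ (Multiset.mem_add.2 (Or.inr ?_))
        exact Multiset.mem_cons_of_mem (Multiset.mem_cons_of_mem (Multiset.mem_map_of_mem _ hq))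
      · rw [← sign_eval_natDegree_smul_sub φ hnat hi, ← sign_eval_natDegree_smul_sub ψ hnat hi']
        refine M.sign_eq h _ (Multiset.mem_add.2 (Or.inr ?_))
        exact Multiset.mem_cons_of_mem (Multiset.mem_cons_self _ _)
    degree_left := hmapdeg φ hφp
    degree_right := hmapdeg ψ hψp }
  have F := E.rootMatch
  refine ⟨_, F.total, F.surj, ?_, ?_⟩
  · intro y y' h q hq
    rcases Multiset.mem_cons.1 hq with rfl | hq
    · exact F.sign_eq h none
    · by_cases hq0 : q = 0
      · simp [hq0]
      · exact F.sign_eq h (some ⟨q, Or.inl ⟨hq, hq0⟩⟩)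
  · rintro y y' u u' h h' ⟨q, hq, hq0, hqy⟩
    refine F.lt_iff h h' ?_
    rcases Multiset.mem_cons.1 hq with rfl | hq
    · exact ⟨none, hqy⟩
    · refine ⟨some ⟨q, Or.inl ⟨hq, ?_⟩⟩, hqy⟩
      rintro rfl
      simp at hq0

end SignMatch

/-- Signs of finitely many parameters determine the sign diagram of a finite collection of
univariate polynomials. -/
theorem exists_finite_signMatch {R : Type*} [CommRing R] (L : Multiset R[X]) :
    ∃ T : Set R, T.Finite ∧ ∀ φ ψ : R →+* ℝ,
      (∀ r ∈ T, SignType.sign (φ r) = SignType.sign (ψ r)) → ∃ ρ, SignMatch φ ψ L ρ := by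
  classical
  -- Induction on the multiset of degrees in the Dershowitz–Manna order: one polynomial may be
  -- replaced by any number of polynomials of smaller degree.
  have wf : WellFounded (InvImage Multiset.IsDershowitzMannaLT
    (fun L : Multiset R[X] => L.map degree)) := InvImage.wf _ Multiset.wellFounded_isDershowitzMannaLT
  induction L using wf.induction with
  | _ L ih =>
  have hlead : ∀ p : R[X], ∃ T : Set R, T.Finite ∧ (p ∈ L → p ≠ 0 → ∀ φ ψ : R →+* ℝ,
      (∀ r ∈ T, SignType.sign (φ r) = SignType.sign (ψ r)) →
        ∃ ρ, SignMatch φ ψ (p.eraseLead ::ₘ L.erase p) ρ) := by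
    intro p
    by_cases hp : p ∈ L ∧ p ≠ 0
    · obtain ⟨T, hT, h⟩ := ih (p.eraseLead ::ₘ L.erase p) (by
        refine ⟨(L.erase p).map degree, {p.eraseLead.degree}, {p.degree}, by simp, ?_, ?_, ?_⟩
        · rw [add_comm, Multiset.singleton_add, ← Multiset.map_cons]
        · rw [add_comm, Multiset.singleton_add, ← Multiset.map_cons, Multiset.cons_erase hp.1]
        · simpa using degree_eraseLead_lt hp.2)
      exact ⟨T, hT, fun _ _ => h⟩
    · exact ⟨∅, Set.finite_empty, fun h1 h2 => absurd ⟨h1, h2⟩ hp⟩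
  choose Tl hTl hl using hlead
  by_cases hconst : ∀ p ∈ L, p.degree ≤ 0
  · refine ⟨(fun p => coeff p 0) '' {p | p ∈ L}, ?_, fun φ ψ h => ⟨Eq, ?_⟩⟩
    · refine Set.Finite.image _ ((L.toFinset.finite_toSet).subset fun p hp => by simpa using hp)
    · refine ⟨fun y => ⟨y, rfl⟩, fun y => ⟨y, rfl⟩, ?_, ?_⟩
      · rintro y _ rfl p hp
        rw [eq_C_of_degree_le_zero (hconst p hp)]
        simpa using h _ ⟨p, hp, rfl⟩
      · rintro y _ u _ rfl rfl -
        exact ⟨Iff.rfl, Iff.rfl⟩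
  push Not at hconst
  obtain ⟨p₀, hp₀, hp₀d⟩ := hconst
  -- A member of largest degree is removed, so that `pseudoStep p q` has smaller degree than `p` for
  -- every other `q`.
  obtain ⟨p, hpL, hpmax⟩ := Finset.exists_max_image L.toFinset degree
    ⟨p₀, Multiset.mem_toFinset.2 hp₀⟩
  rw [Multiset.mem_toFinset] at hpL
  have hdeg : 0 < p.degree := hp₀d.trans_le (hpmax p₀ (Multiset.mem_toFinset.2 hp₀))
  have hp0 : p ≠ 0 := by rintro rfl; simp at hdeg
  obtain ⟨T, hT, h⟩ := ih ((L.erase p) + derivative p ::ₘ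
      (C (p.natDegree : R) * p - X * derivative p) ::ₘ (L.erase p).map (pseudoStep p)) (by
    refine ⟨(L.erase p).map degree, (derivative p ::ₘ
      (C (p.natDegree : R) * p - X * derivative p) ::ₘ (L.erase p).map (pseudoStep p)).map degree,
      {p.degree}, by simp, ?_, ?_, ?_⟩
    · simp only [Multiset.map_add]
    · rw [add_comm, Multiset.singleton_add, ← Multiset.map_cons, Multiset.cons_erase hpL]
    · intro e he
      refine ⟨p.degree, by simp, ?_⟩
      simp only [Multiset.map_cons, Multiset.mem_cons, Multiset.mem_map] at he
      rcases he with rfl | rfl | ⟨_, ⟨q, hq, rfl⟩, rfl⟩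
      · exact degree_derivative_lt hp0
      · exact degree_natDegree_smul_sub_lt hp0
      · exact degree_pseudoStep_lt hp0
          (hpmax q (Multiset.mem_toFinset.2 (Multiset.mem_of_mem_erase hq))))
  have hLfin : {q | q ∈ L}.Finite :=
    (L.toFinset.finite_toSet).subset fun p hp => by simpa using hp
  refine ⟨T ∪ (⋃ q ∈ {q | q ∈ L}, Tl q) ∪ leadingCoeff '' {q | q ∈ L}, ?_, ?_⟩
  · exact (hT.union (hLfin.biUnion fun q _ => hTl q)).union (hLfin.image _)
  · intro φ ψ hs
    -- The signs of the leading coefficients are among the prescribed data. If one vanishes, it does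
    -- so under both specializations and its leading term can be dropped; otherwise all degrees are
    -- preserved and `extend` applies.
    by_cases hz : ∃ q ∈ L, q ≠ 0 ∧ φ q.leadingCoeff = 0
    · obtain ⟨q, hq, hq0, hqz⟩ := hz
      obtain ⟨ρ, hρ⟩ := hl q hq hq0 φ ψ fun r hr =>
        hs r (Or.inl (Or.inr (Set.mem_biUnion (s := {q | q ∈ L}) hq hr)))
      have h1 := hs q.leadingCoeff (Or.inr ⟨q, hq, rfl⟩)
      rw [hqz, sign_zero, eq_comm, sign_eq_zero_iff] at h1
      exact ⟨ρ, hρ.of_eraseLead hqz h1⟩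
    · push Not at hz
      obtain ⟨ρ, hρ⟩ := h φ ψ fun r hr => hs r (Or.inl (Or.inl hr))
      rw [← Multiset.cons_erase hpL] at hz hs ⊢
      refine hρ.extend hdeg hz fun q hq hq0 h0 => hz q hq hq0 ?_
      have h1 := hs q.leadingCoeff (Or.inr ⟨q, hq, rfl⟩)
      rwa [h0, sign_zero, sign_eq_zero_iff] at h1

/-! ### Semialgebraic predicates and quantifier elimination -/

/-- A predicate on real sequences determined by the signs of finitely many polynomials. -/
def Semialg (P : (ℕ → ℝ) → Prop) : Prop :=
  ∃ T : Finset (MvPolynomial ℕ ℝ), ∀ v w : ℕ → ℝ,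
    (∀ p ∈ T, SignType.sign (MvPolynomial.eval v p) = SignType.sign (MvPolynomial.eval w p)) →
      (P v ↔ P w)

/-- Prepend a real number to a real sequence. -/
def consSeq (y : ℝ) (v : ℕ → ℝ) : ℕ → ℝ := fun i => Nat.casesOn i y v

@[simp] theorem consSeq_zero (y : ℝ) (v : ℕ → ℝ) : consSeq y v 0 = y := rfl
@[simp] theorem consSeq_succ (y : ℝ) (v : ℕ → ℝ) (i : ℕ) : consSeq y v (i + 1) = v i := rfl

/-- Regard the zeroth variable as the variable of a univariate polynomial. -/
noncomputable def splitFirst : MvPolynomial ℕ ℝ →+* (MvPolynomial ℕ ℝ)[X] :=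
  MvPolynomial.eval₂Hom (C.comp MvPolynomial.C) fun i => Nat.casesOn i X fun j => C (MvPolynomial.X j)

theorem eval_splitFirst (p : MvPolynomial ℕ ℝ) (y : ℝ) (v : ℕ → ℝ) :
    ((splitFirst p).map (MvPolynomial.eval v)).eval y = MvPolynomial.eval (consSeq y v) p := by
  have : ((evalRingHom y).comp ((mapRingHom (MvPolynomial.eval v)).comp splitFirst)) =
      MvPolynomial.eval (consSeq y v) := by
    apply MvPolynomial.ringHom_ext
    · intro r; simp [splitFirst]
    · rintro (_ | i) <;> simp [splitFirst]
  exact RingHom.congr_fun this p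

namespace Semialg

theorem not {P : (ℕ → ℝ) → Prop} (h : Semialg P) : Semialg fun v => ¬ P v := by
  obtain ⟨T, hT⟩ := h
  exact ⟨T, fun v w hvw => not_congr (hT v w hvw)⟩

theorem and {P Q : (ℕ → ℝ) → Prop} (hP : Semialg P) (hQ : Semialg Q) :
    Semialg fun v => P v ∧ Q v := by
  classical
  obtain ⟨T, hT⟩ := hP
  obtain ⟨S, hS⟩ := hQ
  exact ⟨T ∪ S, fun v w h => and_congr (hT v w fun p hp => h p (Finset.mem_union_left _ hp))
    (hS v w fun p hp => h p (Finset.mem_union_right _ hp))⟩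

theorem congr {P Q : (ℕ → ℝ) → Prop} (hP : Semialg P) (h : ∀ v, P v ↔ Q v) : Semialg Q := by
  rwa [show Q = P from funext fun v => propext (h v).symm]

theorem imp {P Q : (ℕ → ℝ) → Prop} (hP : Semialg P) (hQ : Semialg Q) :
    Semialg fun v => P v → Q v :=
  (hP.and hQ.not).not.congr fun v => by tauto

theorem iff {P Q : (ℕ → ℝ) → Prop} (hP : Semialg P) (hQ : Semialg Q) :
    Semialg fun v => P v ↔ Q v :=
  ((hP.imp hQ).and (hQ.imp hP)).congr fun v => by tauto

theorem const (p : Prop) : Semialg fun _ => p := ⟨∅, fun _ _ _ => Iff.rfl⟩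

/-- Tarski–Seidenberg: signs of finitely many polynomials in the remaining variables fix the sign
diagram in the quantified one, and a sign matching carries witnesses over in both directions.
Variable `0` is the quantified one and the parameters are shifted by one. -/
theorem ex {P : ℝ → (ℕ → ℝ) → Prop} (h : Semialg fun v => P (v 0) fun i => v (i + 1)) :
    Semialg fun v => ∃ y, P y v := by
  classical
  obtain ⟨T, hT⟩ := h
  obtain ⟨S, hS, hm⟩ := exists_finite_signMatch (T.val.map splitFirst)
  refine ⟨hS.toFinset, fun v w hvw => ?_⟩
  obtain ⟨ρ, M⟩ := hm (MvPolynomial.eval v) (MvPolynomial.eval w)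
    fun r hr => hvw r (hS.mem_toFinset.2 hr)
  have key : ∀ y y', ρ y y' → (P y v ↔ P y' w) := by
    intro y y' h
    refine hT (consSeq y v) (consSeq y' w) fun p hp => ?_
    rw [← eval_splitFirst, ← eval_splitFirst]
    exact M.sign_eq h _ (Multiset.mem_map_of_mem _ hp)
  constructor
  · rintro ⟨y, hy⟩
    obtain ⟨y', h⟩ := M.total y
    exact ⟨y', (key y y' h).1 hy⟩
  · rintro ⟨y', hy⟩
    obtain ⟨y, h⟩ := M.surj y'
    exact ⟨y, (key y y' h).2 hy⟩

theorem all {P : ℝ → (ℕ → ℝ) → Prop} (h : Semialg fun v => P (v 0) fun i => v (i + 1)) :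
    Semialg fun v => ∀ y, P y v :=
  (Semialg.ex (P := fun y v => ¬ P y v) h.not).not.congr fun v => by simp

theorem subst {P : (ℕ → ℝ) → Prop} (h : Semialg P) (σ : ℕ → MvPolynomial ℕ ℝ) :
    Semialg fun v => P fun i => MvPolynomial.eval v (σ i) := by
  classical
  obtain ⟨T, hT⟩ := h
  refine ⟨T.image (MvPolynomial.bind₁ σ), fun v w hvw => hT _ _ fun p hp => ?_⟩
  have := hvw _ (Finset.mem_image_of_mem _ hp)
  have key : ∀ u : ℕ → ℝ, MvPolynomial.eval u (MvPolynomial.bind₁ σ p) =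
      MvPolynomial.eval (fun i => MvPolynomial.eval u (σ i)) p := fun u =>
    MvPolynomial.eval₂Hom_bind₁ (RingHom.id ℝ) u σ p
  rwa [key, key] at this

theorem rename {P : (ℕ → ℝ) → Prop} (h : Semialg P) (σ : ℕ → ℕ) :
    Semialg fun v => P fun i => v (σ i) := by
  simpa using h.subst fun i => MvPolynomial.X (σ i)

theorem lt (a b : ℕ) : Semialg fun v => v a < v b := by
  classical
  refine ⟨{MvPolynomial.X b - MvPolynomial.X a}, fun v w h => ?_⟩
  have := h _ (Finset.mem_singleton_self _)
  simp only [map_sub, MvPolynomial.eval_X] at this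
  show v a < v b ↔ w a < w b
  rw [← sub_pos, ← sign_eq_one_iff, this, sign_eq_one_iff, sub_pos]

theorem le (a b : ℕ) : Semialg fun v => v a ≤ v b := (lt b a).not.congr fun v => by simp

/-- A semialgebraic predicate changes its truth value boundedly often along a line. -/
theorem exists_cuts {P : ℝ → (ℕ → ℝ) → Prop} (h : Semialg fun v => P (v 0) fun i => v (i + 1)) :
    ∃ D : ℕ, ∀ v, ∃ Z : Finset ℝ, Z.card ≤ D ∧
      ∀ a b, (∀ z ∈ Z, z ∉ Set.uIcc a b) → (P a v ↔ P b v) := by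
  classical
  obtain ⟨T, hT⟩ := h
  -- The cuts are the roots in the zeroth variable. Their number is bounded by degrees alone, hence
  -- uniformly in the parameters `v`.
  refine ⟨∑ p ∈ T, (splitFirst p).natDegree, fun v => ⟨T.biUnion fun p =>
    ((splitFirst p).map (MvPolynomial.eval v)).roots.toFinset, ?_, ?_⟩⟩
  · refine Finset.card_biUnion_le.trans (Finset.sum_le_sum fun p _ => ?_)
    exact (Multiset.toFinset_card_le _).trans ((card_roots' _).trans natDegree_map_le)
  · intro a b hab
    refine hT (consSeq a v) (consSeq b v) fun p hp => ?_
    rw [← eval_splitFirst, ← eval_splitFirst]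
    by_cases h0 : (splitFirst p).map (MvPolynomial.eval v) = 0
    · simp [h0]
    · refine sign_eval_eq_of_no_root _ fun w hw hr => hab w ?_ hw
      exact Finset.mem_biUnion.2 ⟨p, hp, by simpa [h0] using hr⟩

end Semialg

/-- Each quantifier occupies position `0` and pushes the older variables up. This lemma and
`Semialg.at_three` read a relation off at arbitrary positions, with its parameters starting at
position `k`. -/
theorem Semialg.at_two {S : (ℕ → ℝ) → ℝ → ℝ → Prop}
    (h : Semialg fun w => S (fun i => w (i + 2)) (w 0) (w 1)) (a b k : ℕ) :
    Semialg fun v => S (fun i => v (i + k)) (v a) (v b) :=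
  h.rename fun | 0 => a | 1 => b | i + 2 => i + k

theorem Semialg.at_three {S : (ℕ → ℝ) → ℝ → ℝ → ℝ → Prop}
    (h : Semialg fun w => S (fun i => w (i + 3)) (w 0) (w 1) (w 2)) (a b c k : ℕ) :
    Semialg fun v => S (fun i => v (i + k)) (v a) (v b) (v c) :=
  h.rename fun | 0 => a | 1 => b | 2 => c | i + 3 => i + k

/-! ### Local behaviour and the monotonicity theorem -/

theorem Finset.exists_gap_right (Z : Finset ℝ) (x : ℝ) :
    ∃ e, x < e ∧ ∀ z ∈ Z, z ∉ Set.Ioo x e := by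
  by_cases h : (Z.filter (x < ·)).Nonempty
  · refine ⟨(Z.filter (x < ·)).min' h, (Finset.mem_filter.1 (Finset.min'_mem _ h)).2, ?_⟩
    intro z hz hm
    exact absurd hm.2 (not_lt.2 (Finset.min'_le _ _ (Finset.mem_filter.2 ⟨hz, hm.1⟩)))
  · exact ⟨x + 1, by linarith, fun z hz hm => h ⟨z, Finset.mem_filter.2 ⟨hz, hm.1⟩⟩⟩

theorem Finset.exists_gap_left (Z : Finset ℝ) (x : ℝ) :
    ∃ e, e < x ∧ ∀ z ∈ Z, z ∉ Set.Ioo e x := by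
  by_cases h : (Z.filter (· < x)).Nonempty
  · refine ⟨(Z.filter (· < x)).max' h, (Finset.mem_filter.1 (Finset.max'_mem _ h)).2, ?_⟩
    intro z hz hm
    exact absurd hm.1 (not_lt.2 (Finset.le_max' _ _ (Finset.mem_filter.2 ⟨hz, hm.2⟩)))
  · exact ⟨x - 1, by linarith, fun z hz hm => h ⟨z, Finset.mem_filter.2 ⟨hz, hm.2⟩⟩⟩

theorem uIcc_subset_Ioo_of_mem {a b u w : ℝ} (hu : u ∈ Set.Ioo a b) (hw : w ∈ Set.Ioo a b) :
    Set.uIcc u w ⊆ Set.Ioo a b := by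
  intro t ht
  rw [Set.mem_uIcc] at ht
  rcases ht with ht | ht
  · exact ⟨hu.1.trans_le ht.1, ht.2.trans_lt hw.2⟩
  · exact ⟨hw.1.trans_le ht.1, ht.2.trans_lt hu.2⟩

/-- A predicate with finitely many cuts is eventually constant to the right of every point. -/
theorem eventually_right_or {Q : ℝ → Prop} {Z : Finset ℝ}
    (h : ∀ a b, (∀ z ∈ Z, z ∉ Set.uIcc a b) → (Q a ↔ Q b)) (x : ℝ)
    (hn : ¬ ∃ e, x < e ∧ ∀ u, x < u → u < e → Q u) : ∃ e, x < e ∧ ∀ u, x < u → u < e → ¬ Q u := by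
  obtain ⟨e, hxe, he⟩ := Z.exists_gap_right x
  refine ⟨e, hxe, fun u hu hue hQ => hn ⟨e, hxe, fun w hw hwe => ?_⟩⟩
  exact (h u w fun z hz hm => he z hz (uIcc_subset_Ioo_of_mem ⟨hu, hue⟩ ⟨hw, hwe⟩ hm)).1 hQ

/-- A predicate with finitely many cuts is eventually constant to the left of every point. -/
theorem eventually_left_or {Q : ℝ → Prop} {Z : Finset ℝ}
    (h : ∀ a b, (∀ z ∈ Z, z ∉ Set.uIcc a b) → (Q a ↔ Q b)) (x : ℝ)
    (hn : ¬ ∃ e, e < x ∧ ∀ u, e < u → u < x → Q u) : ∃ e, e < x ∧ ∀ u, e < u → u < x → ¬ Q u := by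
  obtain ⟨e, hxe, he⟩ := Z.exists_gap_left x
  refine ⟨e, hxe, fun u hu hue hQ => hn ⟨e, hxe, fun w hw hwe => ?_⟩⟩
  exact (h u w fun z hz hm => he z hz (uIcc_subset_Ioo_of_mem ⟨hu, hue⟩ ⟨hw, hwe⟩ hm)).1 hQ

/-- A total preorder on the line which locally increases at every point of an interval increases. -/
theorem monotone_of_locally_monotone {r : ℝ → ℝ → Prop} (hrefl : ∀ x, r x x)
    (htrans : ∀ x y z, r x y → r y z → r x z) {x₀ x₁ : ℝ}
    (hright : ∀ x, x₀ ≤ x → x ≤ x₁ → ∃ e, x < e ∧ ∀ u, x < u → u < e → r x u)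
    (hleft : ∀ x, x₀ ≤ x → x ≤ x₁ → ∃ e, e < x ∧ ∀ u, e < u → u < x → r u x)
    {x x' : ℝ} (h0 : x₀ ≤ x) (hxx : x ≤ x') (h1 : x' ≤ x₁) : r x x' := by
  set G : Set ℝ := {u | x ≤ u ∧ u ≤ x' ∧ ∀ w, x ≤ w → w ≤ u → r x w} with hG
  have hxG : x ∈ G := ⟨le_rfl, hxx, fun w h1 h2 => le_antisymm h1 h2 ▸ hrefl _⟩
  have hbdd : BddAbove G := ⟨x', fun u hu => hu.2.1⟩
  have hxz : x ≤ sSup G := le_csSup hbdd hxG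
  have hzx : sSup G ≤ x' := csSup_le ⟨x, hxG⟩ fun u hu => hu.2.1
  have hlt : ∀ w, x ≤ w → w < sSup G → r x w := by
    intro w hw hwz
    obtain ⟨u, hu, hwu⟩ := exists_lt_of_lt_csSup ⟨x, hxG⟩ hwz
    exact hu.2.2 w hw hwu.le
  have hz : r x (sSup G) := by
    rcases hxz.eq_or_lt with h | h
    · rw [← h]; exact hrefl x
    · obtain ⟨e, he, hr⟩ := hleft (sSup G) (h0.trans hxz) (hzx.trans h1)
      obtain ⟨u, hu, huz⟩ := exists_between (max_lt he h)
      exact htrans x u _ (hlt u ((le_max_right _ _).trans hu.le) huz)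
        (hr u ((le_max_left _ _).trans_lt hu) huz)
  rcases hzx.eq_or_lt with h | h
  · rwa [h] at hz
  · obtain ⟨e, he, hr⟩ := hright (sSup G) (h0.trans hxz) (hzx.trans h1)
    obtain ⟨u, hu, hue⟩ := exists_between (lt_min he h)
    have huG : u ∈ G := by
      refine ⟨hxz.trans hu.le, (hue.trans_le (min_le_right _ _)).le, fun w hw hwu => ?_⟩
      rcases lt_trichotomy w (sSup G) with hc | hc | hc
      · exact hlt w hw hc
      · rwa [hc]
      · exact htrans x _ w hz (hr w hc (hwu.trans_lt (hue.trans_le (min_le_left _ _))))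
    exact absurd (le_csSup hbdd huG) (not_le.2 hu)

/-- A total relation has no interval consisting of strict local extrema. -/
theorem not_all_strict_extrema {r : ℝ → ℝ → Prop} (htotal : ∀ x y, r x y ∨ r y x) {x₀ x₁ : ℝ}
    (hlt : x₀ < x₁)
    (hright : ∀ x, x₀ ≤ x → x ≤ x₁ → ∃ e, x < e ∧ ∀ u, x < u → u < e → ¬ r x u)
    (hleft : ∀ x, x₀ ≤ x → x ≤ x₁ → ∃ e, e < x ∧ ∀ u, e < u → u < x → ¬ r x u) : False := by
  -- Each point gets a rational interval on which it is a strict extremum. By totality two points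
  -- cannot share an interval, so the real interval would be countable.
  have hq : ∀ x, ∃ p : ℚ × ℚ, x₀ ≤ x → x ≤ x₁ →
      (p.1 : ℝ) < x ∧ x < p.2 ∧ ∀ u, (p.1 : ℝ) < u → u < p.2 → u ≠ x → ¬ r x u := by
    intro x
    by_cases hx : x₀ ≤ x ∧ x ≤ x₁
    · obtain ⟨e, he, hr⟩ := hright x hx.1 hx.2
      obtain ⟨d, hd, hl⟩ := hleft x hx.1 hx.2
      obtain ⟨a, ha, ha'⟩ := exists_rat_btwn hd
      obtain ⟨b, hb, hb'⟩ := exists_rat_btwn he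
      refine ⟨(a, b), fun _ _ => ⟨ha', hb, fun u hu hu' hne => ?_⟩⟩
      rcases lt_or_gt_of_ne hne with h | h
      · exact hl u (ha.trans hu) h
      · exact hr u h (lt_trans hu' hb')
    · exact ⟨(0, 0), fun h1 h2 => absurd ⟨h1, h2⟩ hx⟩
  choose f hf using hq
  have hinj : Set.InjOn f (Set.Ioo x₀ x₁) := by
    intro x hx y hy hxy
    by_contra hne
    obtain ⟨h1, h2, h3⟩ := hf x hx.1.le hx.2.le
    obtain ⟨h4, h5, h6⟩ := hf y hy.1.le hy.2.le
    rcases htotal x y with h | h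
    · exact h3 y (hxy ▸ h4) (hxy ▸ h5) (Ne.symm hne) h
    · exact h6 x (hxy ▸ h1) (hxy ▸ h2) hne h
  have hc : (Set.Ioo x₀ x₁).Countable :=
    Set.MapsTo.countable_of_injOn (Set.mapsTo_univ f _) hinj Set.countable_univ
  have := hc.measure_zero MeasureTheory.volume
  rw [Real.volume_Ioo, ENNReal.ofReal_eq_zero] at this
  linarith

/-- The monotonicity theorem for a semialgebraic family of total preorders on the line. -/
theorem Semialg.exists_monotone_cuts {S : (ℕ → ℝ) → ℝ → ℝ → Prop}
    (hS : Semialg fun w => S (fun i => w (i + 2)) (w 0) (w 1))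
    (htotal : ∀ v x y, S v x y ∨ S v y x) (htrans : ∀ v x y z, S v x y → S v y z → S v x z) :
    ∃ D : ℕ, ∀ v, ∃ Z : Finset ℝ, Z.card ≤ D ∧ ∀ x₀ x₁, x₀ ≤ x₁ → (∀ z ∈ Z, z ∉ Set.Icc x₀ x₁) →
      (∀ x x', x₀ ≤ x → x ≤ x' → x' ≤ x₁ → S v x x') ∨
      (∀ x x', x₀ ≤ x → x ≤ x' → x' ≤ x₁ → S v x' x) := by
  classical
  have hrefl : ∀ v x, S v x x := fun v x => (htotal v x x).elim id id
  -- The four one-sided comparisons of `x` with its neighbours are semialgebraic in `x`. Their cuts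
  -- together form `Z`, so each has constant truth value on an interval avoiding `Z`.
  have s1 : Semialg fun w => ∃ e, w 0 < e ∧ ∀ u, w 0 < u → u < e → S (fun i => w (i + 1)) u (w 0) := by
    refine Semialg.ex ?_
    refine (Semialg.lt 1 0).and ?_
    refine Semialg.all ?_
    exact (Semialg.lt 2 0).imp ((Semialg.lt 0 1).imp (hS.at_two 0 2 3))
  have s2 : Semialg fun w => ∃ e, w 0 < e ∧ ∀ u, w 0 < u → u < e → S (fun i => w (i + 1)) (w 0) u := by
    refine Semialg.ex ?_
    refine (Semialg.lt 1 0).and ?_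
    refine Semialg.all ?_
    exact (Semialg.lt 2 0).imp ((Semialg.lt 0 1).imp (hS.at_two 2 0 3))
  have s3 : Semialg fun w => ∃ e, e < w 0 ∧ ∀ u, e < u → u < w 0 → S (fun i => w (i + 1)) u (w 0) := by
    refine Semialg.ex ?_
    refine (Semialg.lt 0 1).and ?_
    refine Semialg.all ?_
    exact (Semialg.lt 1 0).imp ((Semialg.lt 0 2).imp (hS.at_two 0 2 3))
  have s4 : Semialg fun w => ∃ e, e < w 0 ∧ ∀ u, e < u → u < w 0 → S (fun i => w (i + 1)) (w 0) u := by
    refine Semialg.ex ?_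
    refine (Semialg.lt 0 1).and ?_
    refine Semialg.all ?_
    exact (Semialg.lt 1 0).imp ((Semialg.lt 0 2).imp (hS.at_two 2 0 3))
  obtain ⟨D1, h1⟩ := Semialg.exists_cuts
    (P := fun x v => ∃ e, x < e ∧ ∀ u, x < u → u < e → S v u x) s1
  obtain ⟨D2, h2⟩ := Semialg.exists_cuts
    (P := fun x v => ∃ e, x < e ∧ ∀ u, x < u → u < e → S v x u) s2
  obtain ⟨D3, h3⟩ := Semialg.exists_cuts
    (P := fun x v => ∃ e, e < x ∧ ∀ u, e < u → u < x → S v u x) s3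
  obtain ⟨D4, h4⟩ := Semialg.exists_cuts
    (P := fun x v => ∃ e, e < x ∧ ∀ u, e < u → u < x → S v x u) s4
  obtain ⟨_, c1⟩ := Semialg.exists_cuts (P := fun u w => S (fun i => w (i + 1)) u (w 0))
    (hS.at_two 0 1 2)
  obtain ⟨_, c2⟩ := Semialg.exists_cuts (P := fun u w => S (fun i => w (i + 1)) (w 0) u)
    (hS.at_two 1 0 2)
  refine ⟨D1 + D2 + D3 + D4, fun v => ?_⟩
  obtain ⟨Z1, hZ1, h1⟩ := h1 v
  obtain ⟨Z2, hZ2, h2⟩ := h2 v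
  obtain ⟨Z3, hZ3, h3⟩ := h3 v
  obtain ⟨Z4, hZ4, h4⟩ := h4 v
  refine ⟨Z1 ∪ Z2 ∪ Z3 ∪ Z4, ?_, ?_⟩
  · have e1 := Finset.card_union_le (Z1 ∪ Z2 ∪ Z3) Z4
    have e2 := Finset.card_union_le (Z1 ∪ Z2) Z3
    have e3 := Finset.card_union_le Z1 Z2
    omega
  intro x₀ x₁ hx hfree
  have hsub : ∀ x, x₀ ≤ x → x ≤ x₁ → ∀ z ∈ Z1 ∪ Z2 ∪ Z3 ∪ Z4, z ∉ Set.uIcc x₀ x := by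
    intro x hx0 hx1 z hz hm
    rw [Set.uIcc_of_le hx0] at hm
    exact hfree z hz ⟨hm.1, hm.2.trans hx1⟩
  have k1 := fun x hx0 hx1 => h1 x₀ x fun z hz => hsub x hx0 hx1 z (by simp [hz])
  have k2 := fun x hx0 hx1 => h2 x₀ x fun z hz => hsub x hx0 hx1 z (by simp [hz])
  have k3 := fun x hx0 hx1 => h3 x₀ x fun z hz => hsub x hx0 hx1 z (by simp [hz])
  have k4 := fun x hx0 hx1 => h4 x₀ x fun z hz => hsub x hx0 hx1 z (by simp [hz])
  rcases hx.eq_or_lt with rfl | hlt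
  · left
    intro x x' hx0 hxx hx1
    obtain rfl : x = x' := by linarith
    exact hrefl v x
  have n1 : ∀ x, ¬ (∃ e, x < e ∧ ∀ u, x < u → u < e → S v u x) →
      ∃ e, x < e ∧ ∀ u, x < u → u < e → ¬ S v u x := by
    intro x hn
    obtain ⟨Z, -, hZ⟩ := c1 (consSeq x v)
    exact eventually_right_or hZ x hn
  have n2 : ∀ x, ¬ (∃ e, x < e ∧ ∀ u, x < u → u < e → S v x u) →
      ∃ e, x < e ∧ ∀ u, x < u → u < e → ¬ S v x u := by
    intro x hn
    obtain ⟨Z, -, hZ⟩ := c2 (consSeq x v)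
    exact eventually_right_or hZ x hn
  have n3 : ∀ x, ¬ (∃ e, e < x ∧ ∀ u, e < u → u < x → S v u x) →
      ∃ e, e < x ∧ ∀ u, e < u → u < x → ¬ S v u x := by
    intro x hn
    obtain ⟨Z, -, hZ⟩ := c1 (consSeq x v)
    exact eventually_left_or hZ x hn
  have n4 : ∀ x, ¬ (∃ e, e < x ∧ ∀ u, e < u → u < x → S v x u) →
      ∃ e, e < x ∧ ∀ u, e < u → u < x → ¬ S v x u := by
    intro x hn
    obtain ⟨Z, -, hZ⟩ := c2 (consSeq x v)
    exact eventually_left_or hZ x hn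
  -- Two compatible one-sided comparisons give monotonicity. In the other cases either both
  -- comparisons fail on one side, against totality, or every point is a strict local extremum.
  by_cases hb : ∃ e, x₀ < e ∧ ∀ u, x₀ < u → u < e → S v x₀ u
  · by_cases ha' : ∃ e, e < x₀ ∧ ∀ u, e < u → u < x₀ → S v u x₀
    · left
      intro x x' hx0 hxx hx1
      exact monotone_of_locally_monotone (hrefl v) (htrans v)
        (fun x h h' => (k2 x h h').1 hb) (fun x h h' => (k3 x h h').1 ha') hx0 hxx hx1
    · by_cases ha : ∃ e, x₀ < e ∧ ∀ u, x₀ < u → u < e → S v u x₀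
      · by_cases hb' : ∃ e, e < x₀ ∧ ∀ u, e < u → u < x₀ → S v x₀ u
        · right
          intro x x' hx0 hxx hx1
          exact monotone_of_locally_monotone (r := fun x y => S v y x) (hrefl v)
            (fun x y z h h' => htrans v z y x h' h)
            (fun x h h' => (k1 x h h').1 ha) (fun x h h' => (k4 x h h').1 hb') hx0 hxx hx1
        · exfalso
          obtain ⟨e, he, hn⟩ := n3 x₀ ha'
          obtain ⟨d, hd, hm⟩ := n4 x₀ hb'
          obtain ⟨u, hu, hux⟩ := exists_between (max_lt he hd)
          exact (htotal v u x₀).elim (hn u ((le_max_left _ _).trans_lt hu) hux)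
            (hm u ((le_max_right _ _).trans_lt hu) hux)
      · exfalso
        refine not_all_strict_extrema (r := fun x y => S v y x) (fun x y => htotal v y x) hlt
          (fun x h h' => n1 x fun hc => ha ((k1 x h h').2 hc))
          (fun x h h' => n3 x fun hc => ha' ((k3 x h h').2 hc))
  · by_cases hb' : ∃ e, e < x₀ ∧ ∀ u, e < u → u < x₀ → S v x₀ u
    · by_cases ha : ∃ e, x₀ < e ∧ ∀ u, x₀ < u → u < e → S v u x₀
      · right
        intro x x' hx0 hxx hx1
        exact monotone_of_locally_monotone (r := fun x y => S v y x) (hrefl v)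
          (fun x y z h h' => htrans v z y x h' h)
          (fun x h h' => (k1 x h h').1 ha) (fun x h h' => (k4 x h h').1 hb') hx0 hxx hx1
      · exfalso
        obtain ⟨e, he, hn⟩ := n1 x₀ ha
        obtain ⟨d, hd, hm⟩ := n2 x₀ hb
        obtain ⟨u, hu, hux⟩ := exists_between (lt_min he hd)
        exact (htotal v u x₀).elim (hn u hu (hux.trans_le (min_le_left _ _)))
          (hm u hu (hux.trans_le (min_le_right _ _)))
    · exfalso
      exact not_all_strict_extrema (htotal v) hlt
        (fun x h h' => n2 x fun hc => hb ((k2 x h h').2 hc))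
        (fun x h h' => n4 x fun hc => hb' ((k4 x h h').2 hc))

/-! ### Alternation counts and piecewise monotone thresholds -/

/-- A point `u > x` ending a chain `x < u₀ < ⋯ < u_j = u` along which `Q` alternates, starting with
`Q u₀` true. -/
def AltEnd (Q : ℝ → Prop) (x : ℝ) : ℕ → ℝ → Prop
  | 0, u => x < u ∧ Q u
  | j + 1, u => x < u ∧ (Q u ↔ Even (j + 1)) ∧ ∃ u', u' < u ∧ AltEnd Q x j u'

/-- The predicate `Q` alternates at least `j` times between `x` and `y`. -/
def AltReach (Q : ℝ → Prop) (x : ℝ) (j : ℕ) (y : ℝ) : Prop := ∃ u, u ≤ y ∧ AltEnd Q x j u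

section Alternation
variable {Q : ℝ → Prop} {x : ℝ}

theorem AltEnd.lt {j : ℕ} {u : ℝ} (h : AltEnd Q x j u) : x < u := by
  cases j <;> exact h.1

theorem AltEnd.iff_even {j : ℕ} {u : ℝ} (h : AltEnd Q x j u) : Q u ↔ Even j := by
  cases j with
  | zero => simpa using h.2
  | succ j => exact h.2.1

theorem AltReach.mono {j : ℕ} {y y' : ℝ} (h : AltReach Q x j y) (hy : y ≤ y') :
    AltReach Q x j y' :=
  let ⟨u, hu, h⟩ := h; ⟨u, hu.trans hy, h⟩

theorem AltReach.lt {j : ℕ} {y : ℝ} (h : AltReach Q x j y) : x < y :=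
  let ⟨_, hu, h⟩ := h; h.lt.trans_le hu

/-- Every alternation meets a cut, but a cut that is itself a chain point can serve two successive
alternations. Counting cuts both below and up to `u` gives a quantity that grows at each step. -/
theorem AltEnd.le_card {Z : Finset ℝ} (hZ : ∀ a b, (∀ z ∈ Z, z ∉ Set.uIcc a b) → (Q a ↔ Q b))
    {j : ℕ} {u : ℝ} (h : AltEnd Q x j u) :
    j ≤ (Z.filter (· < u)).card + (Z.filter (· ≤ u)).card := by
  induction j generalizing u with
  | zero => exact Nat.zero_le _
  | succ j ih =>
    have hu := h.iff_even
    obtain ⟨-, -, u', hlt, h'⟩ := h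
    have hu' := h'.iff_even
    have hz : ∃ z ∈ Z, z ∈ Set.uIcc u' u := by
      by_contra hc
      push Not at hc
      have := hZ u' u hc
      rw [hu, hu', Nat.even_add_one] at this
      tauto
    obtain ⟨z, hz, hm⟩ := hz
    rw [Set.uIcc_of_le hlt.le] at hm
    have i1 : (Z.filter (· < u')).card ≤ (Z.filter (· < u)).card :=
      Finset.card_le_card fun w hw => by
        rw [Finset.mem_filter] at hw ⊢
        exact ⟨hw.1, hw.2.trans hlt⟩
    have i2 : (Z.filter (· ≤ u')).card ≤ (Z.filter (· ≤ u)).card :=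
      Finset.card_le_card fun w hw => by
        rw [Finset.mem_filter] at hw ⊢
        exact ⟨hw.1, hw.2.trans hlt.le⟩
    have i3 : (Z.filter (· < u')).card < (Z.filter (· < u)).card ∨
        (Z.filter (· ≤ u')).card < (Z.filter (· ≤ u)).card := by
      rcases hm.1.eq_or_lt with h1 | h1
      · left
        refine Finset.card_lt_card ⟨fun w hw => ?_, fun hs => ?_⟩
        · rw [Finset.mem_filter] at hw ⊢
          exact ⟨hw.1, hw.2.trans hlt⟩
        · have := hs (Finset.mem_filter.2 ⟨hz, h1 ▸ hlt⟩)
          exact absurd (Finset.mem_filter.1 this).2 (not_lt.2 hm.1)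
      · right
        refine Finset.card_lt_card ⟨fun w hw => ?_, fun hs => ?_⟩
        · rw [Finset.mem_filter] at hw ⊢
          exact ⟨hw.1, hw.2.trans hlt.le⟩
        · have := hs (Finset.mem_filter.2 ⟨hz, hm.2⟩)
          exact absurd (Finset.mem_filter.1 this).2 (not_le.2 h1)
    have := ih h'
    omega

theorem AltReach.le_card {Z : Finset ℝ} (hZ : ∀ a b, (∀ z ∈ Z, z ∉ Set.uIcc a b) → (Q a ↔ Q b))
    {j : ℕ} {y : ℝ} (h : AltReach Q x j y) : j ≤ 2 * Z.card := by
  obtain ⟨u, -, hu⟩ := h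
  have h1 := hu.le_card hZ
  have h2 := Finset.card_filter_le Z (· < u)
  have h3 := Finset.card_filter_le Z (· ≤ u)
  omega

/-- A predicate with finitely many cuts is a union of differences of consecutive up-sets. -/
theorem iff_exists_altReach {J : ℕ} {y : ℝ} (hxy : x < y) (hJ : ∀ j, AltReach Q x j y → j ≤ J) :
    Q y ↔ ∃ j ≤ J, Even j ∧ AltReach Q x j y ∧ ¬ AltReach Q x (j + 1) y := by
  classical
  constructor
  · intro hy
    have h0 : AltReach Q x 0 y := ⟨y, le_rfl, hxy, hy⟩
    have hspec := Nat.findGreatest_spec (P := fun j => AltReach Q x j y) (Nat.zero_le J) h0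
    set j := Nat.findGreatest (fun j => AltReach Q x j y) J with hj
    have hjJ : j ≤ J := Nat.findGreatest_le J
    have hmax : ¬ AltReach Q x (j + 1) y := fun h => by
      have := Nat.le_findGreatest (P := fun j => AltReach Q x j y) (hJ _ h) h
      omega
    refine ⟨j, hjJ, ?_, hspec, hmax⟩
    by_contra hodd
    obtain ⟨u, hu, he⟩ := hspec
    have h1 := he.iff_even
    refine hmax ⟨y, le_rfl, hxy, iff_of_true hy ?_, u, ?_, he⟩
    · rwa [Nat.even_add_one]
    · rcases hu.eq_or_lt with rfl | h
      · exact absurd (h1.1 hy) hodd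
      · exact h
  · rintro ⟨j, -, hj, ⟨u, hu, he⟩, hmax⟩
    by_contra hy
    have h1 := he.iff_even.2 hj
    refine hmax ⟨y, le_rfl, hxy, iff_of_false hy ?_, u, ?_, he⟩
    · rw [Nat.even_add_one]
      exact not_not.2 hj
    · rcases hu.eq_or_lt with rfl | h
      · exact absurd h1 hy
      · exact h

end Alternation

theorem Semialg.altEnd {E : (ℕ → ℝ) → ℝ → ℝ → ℝ → Prop}
    (hE : Semialg fun w => E (fun i => w (i + 3)) (w 0) (w 1) (w 2)) (j : ℕ) :
    Semialg fun w => AltEnd (fun y => E (fun i => w (i + 3)) (w 0) y (w 2)) (w 0) j (w 1) := by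
  induction j with
  | zero => exact (Semialg.lt 0 1).and hE
  | succ j ih =>
    refine (Semialg.lt 0 1).and ((hE.iff (Semialg.const _)).and (Semialg.ex ?_))
    exact (Semialg.lt 0 2).and (ih.rename fun | 0 => 1 | 1 => 0 | 2 => 3 | i + 3 => i + 4)

theorem Semialg.altReach {E : (ℕ → ℝ) → ℝ → ℝ → ℝ → Prop}
    (hE : Semialg fun w => E (fun i => w (i + 3)) (w 0) (w 1) (w 2)) (j : ℕ) :
    Semialg fun w => AltReach (fun y => E (fun i => w (i + 3)) (w 0) y (w 2)) (w 0) j (w 1) := by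
  refine Semialg.ex ?_
  exact (Semialg.le 0 2).and
    ((hE.altEnd j).rename fun | 0 => 1 | 1 => 0 | 2 => 3 | i + 3 => i + 4)

/-- Up-sets of the line are nested, so inclusion of up-sets is a total preorder. It stands in for
comparing thresholds, whether or not they are finite or attained. -/
theorem upSet_total {U V : ℝ → Prop} (hU : ∀ y y', y ≤ y' → U y → U y')
    (hV : ∀ y y', y ≤ y' → V y → V y') : (∀ y, U y → V y) ∨ (∀ y, V y → U y) := by
  by_contra h
  push Not at h
  obtain ⟨⟨a, ha, ha'⟩, b, hb, hb'⟩ := h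
  rcases le_total a b with hab | hab
  · exact hb' (hU a b hab ha)
  · exact ha' (hV b a hab hb)

/-- The threshold of a semialgebraic relation which is upward closed in its second argument is
piecewise monotone in the first argument. -/
theorem Semialg.exists_threshold_cuts_first {W : (ℕ → ℝ) → ℝ → ℝ → ℝ → Prop}
    (hW : Semialg fun w => W (fun i => w (i + 3)) (w 0) (w 1) (w 2))
    (hup : ∀ v x y y' b, y ≤ y' → W v x y b → W v x y' b) :
    ∃ D : ℕ, ∀ v b, ∃ Z : Finset ℝ, Z.card ≤ D ∧
      ∀ x₀ x₁, x₀ ≤ x₁ → (∀ z ∈ Z, z ∉ Set.Icc x₀ x₁) →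
        (∀ x x', x₀ ≤ x → x ≤ x' → x' ≤ x₁ → ∀ y, W v x y b → W v x' y b) ∨
        (∀ x x', x₀ ≤ x → x ≤ x' → x' ≤ x₁ → ∀ y, W v x' y b → W v x y b) := by
  obtain ⟨D, hD⟩ := Semialg.exists_monotone_cuts
    (S := fun w x x' => ∀ y, W (fun i => w (i + 1)) x y (w 0) → W (fun i => w (i + 1)) x' y (w 0))
    (Semialg.all ((hW.at_three 1 0 3 4).imp (hW.at_three 2 0 3 4)))
    (fun w x x' => upSet_total (fun y y' h => hup _ _ _ _ _ h) (fun y y' h => hup _ _ _ _ _ h))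
    (fun w x y z h h' u hu => h' u (h u hu))
  exact ⟨D, fun v b => hD (consSeq b v)⟩

/-- The threshold of a semialgebraic relation which is upward closed in its second argument is
piecewise monotone in the third argument. -/
theorem Semialg.exists_threshold_cuts_third {W : (ℕ → ℝ) → ℝ → ℝ → ℝ → Prop}
    (hW : Semialg fun w => W (fun i => w (i + 3)) (w 0) (w 1) (w 2))
    (hup : ∀ v x y y' b, y ≤ y' → W v x y b → W v x y' b) :
    ∃ D : ℕ, ∀ v x, ∃ Z : Finset ℝ, Z.card ≤ D ∧
      ∀ b₀ b₁, b₀ ≤ b₁ → (∀ z ∈ Z, z ∉ Set.Icc b₀ b₁) →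
        (∀ b b', b₀ ≤ b → b ≤ b' → b' ≤ b₁ → ∀ y, W v x y b → W v x y b') ∨
        (∀ b b', b₀ ≤ b → b ≤ b' → b' ≤ b₁ → ∀ y, W v x y b' → W v x y b) := by
  obtain ⟨D, hD⟩ := Semialg.exists_monotone_cuts
    (S := fun w b b' => ∀ y, W (fun i => w (i + 1)) (w 0) y b → W (fun i => w (i + 1)) (w 0) y b')
    (Semialg.all ((hW.at_three 3 0 1 4).imp (hW.at_three 3 0 2 4)))
    (fun w x x' => upSet_total (fun y y' h => hup _ _ _ _ _ h) (fun y y' h => hup _ _ _ _ _ h))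
    (fun w x y z h h' u hu => h' u (h u hu))
  exact ⟨D, fun v b => hD (consSeq b v)⟩

/-! ### Passing to large blocks on which relations are monotone -/

theorem Finset.exists_card_le_mul_card_fiber {α κ : Type*} [Fintype κ] [Nonempty κ] [DecidableEq κ]
    (s : Finset α) (f : α → κ) :
    ∃ k, s.card ≤ Fintype.card κ * (s.filter (f · = k)).card := by
  obtain ⟨k, -, hk⟩ := Finset.exists_max_image Finset.univ
    (fun k => (s.filter (f · = k)).card) Finset.univ_nonempty
  refine ⟨k, ?_⟩
  have := Finset.card_le_mul_card_image_of_maps_to (s := s) (t := Finset.univ) (f := f)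
    (fun a _ => Finset.mem_univ _) _ fun b hb => hk b hb
  rwa [mul_comm] at this

/-- A finite set of reals contains `D + 1` large consecutive blocks, one of which avoids any given
`D` points. -/
theorem Finset.exists_blocks (A : Finset ℝ) (hA : A.Nonempty) (D : ℕ) :
    ∃ I : Fin (D + 1) → Finset ℝ, (∀ i, I i ⊆ A ∧ A.card ≤ 2 * (D + 1) * (I i).card) ∧
      ∀ Z : Finset ℝ, Z.card ≤ D → ∃ i, ∀ a ∈ I i, ∀ a' ∈ I i, a < a' → ∀ z ∈ Z, z ∉ Set.Icc a a' := by
  classical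
  set q := A.card / (D + 1) with hq
  have hqle : (D + 1) * q ≤ A.card := Nat.mul_div_le _ _
  have hlt : A.card < (D + 1) * (q + 1) := by
    rw [mul_comm]; exact Nat.lt_mul_of_div_lt (Nat.lt_succ_self _) (Nat.succ_pos _)
  -- When `A` has at most `D` points, all blocks are one and the same singleton, for which the
  -- avoidance condition is vacuous.
  rcases Nat.eq_zero_or_pos q with h0 | hpos
  · obtain ⟨a, ha⟩ := hA
    refine ⟨fun _ => {a}, fun i => ⟨by simpa using ha, ?_⟩, fun Z _ => ⟨0, ?_⟩⟩
    · rw [h0] at hlt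
      simp only [Finset.card_singleton]
      omega
    · intro a ha a' ha' hlt
      rw [Finset.mem_singleton] at ha ha'
      exact absurd hlt (by rw [ha, ha']; exact lt_irrefl _)
  · have hidx : ∀ (i : Fin (D + 1)) (j : Fin q), i.1 * q + j.1 < A.card := by
      intro i j
      have : (i.1 + 1) * q ≤ (D + 1) * q := Nat.mul_le_mul_right _ i.2
      have := j.2
      nlinarith
    let e := A.orderEmbOfFin rfl
    let I : Fin (D + 1) → Finset ℝ := fun i =>
      Finset.univ.image fun j : Fin q => e ⟨i.1 * q + j.1, hidx i j⟩
    have hI : ∀ i, (I i).card = q := by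
      intro i
      rw [Finset.card_image_of_injective, Finset.card_univ, Fintype.card_fin]
      intro j j' h
      have := congrArg Fin.val (e.injective h)
      simp only at this
      exact Fin.ext (by omega)
    have hsep : ∀ i i' : Fin (D + 1), i < i' → ∀ a ∈ I i, ∀ a' ∈ I i', a < a' := by
      intro i i' hii a ha a' ha'
      obtain ⟨j, -, rfl⟩ := Finset.mem_image.1 ha
      obtain ⟨j', -, rfl⟩ := Finset.mem_image.1 ha'
      apply e.strictMono
      rw [Fin.lt_def]
      have h1 : (i.1 + 1) * q ≤ i'.1 * q := Nat.mul_le_mul_right _ hii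
      have h2 := j.2
      simp only
      nlinarith
    refine ⟨I, fun i => ⟨?_, ?_⟩, ?_⟩
    · intro a ha
      obtain ⟨j, -, rfl⟩ := Finset.mem_image.1 ha
      exact A.orderEmbOfFin_mem rfl _
    · rw [hI]
      nlinarith
    · intro Z hZ
      by_contra hcon
      push Not at hcon
      choose a ha a' ha' hlt' z hz hmem using hcon
      -- If every block were hit, the hits would be `D + 1` distinct points of `Z`.
      have hmono : StrictMono z := by
        intro i i' hii
        exact (hmem i).2.trans_lt ((hsep i i' hii _ (ha' i) _ (ha i')).trans_le (hmem i').1)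
      have := Finset.card_le_card_of_injOn (s := Finset.univ) (t := Z) z (fun i _ => hz i)
        hmono.injective.injOn
      rw [Finset.card_univ, Fintype.card_fin] at this
      omega

/-- Uniformly piecewise monotone relations become monotone, in a common direction, after passing to
large subsets of the variable set and of the parameter set. -/
theorem Finset.exists_monotone_blocks {r : ℝ → ℝ → ℝ → Prop} (hrefl : ∀ b x, r b x x) {D : ℕ}
    (A B : Finset ℝ) (hA : A.Nonempty)
    (hr : ∀ b ∈ B, ∃ Z : Finset ℝ, Z.card ≤ D ∧
      ∀ x₀ x₁, x₀ ≤ x₁ → (∀ z ∈ Z, z ∉ Set.Icc x₀ x₁) →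
        (∀ x x', x₀ ≤ x → x ≤ x' → x' ≤ x₁ → r b x x') ∨
        (∀ x x', x₀ ≤ x → x ≤ x' → x' ≤ x₁ → r b x' x)) :
    ∃ A' ⊆ A, ∃ B' ⊆ B, A.card ≤ 2 * (D + 1) * A'.card ∧ B.card ≤ 2 * (D + 1) * B'.card ∧
      ((∀ b ∈ B', ∀ x ∈ A', ∀ x' ∈ A', x ≤ x' → r b x x') ∨
       (∀ b ∈ B', ∀ x ∈ A', ∀ x' ∈ A', x ≤ x' → r b x' x)) := by
  classical
  obtain ⟨I, hI, hfree⟩ := A.exists_blocks hA D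
  have hIne : ∀ i, (I i).Nonempty := by
    intro i
    rw [Finset.nonempty_iff_ne_empty]
    intro h0
    have := (hI i).2
    rw [h0, Finset.card_empty, mul_zero, Nat.le_zero, Finset.card_eq_zero] at this
    exact hA.ne_empty this
  -- Each parameter is labelled with a block free of its cuts and a direction. The most frequent of
  -- the `2 * (D + 1)` labels selects `A'` and `B'`.
  have key : ∀ b, ∃ k : Fin (D + 1) × Bool, b ∈ B →
      (k.2 = true → ∀ x ∈ I k.1, ∀ x' ∈ I k.1, x ≤ x' → r b x x') ∧
      (k.2 = false → ∀ x ∈ I k.1, ∀ x' ∈ I k.1, x ≤ x' → r b x' x) := by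
    intro b
    by_cases hb : b ∈ B
    swap
    · exact ⟨(0, true), fun h => absurd h hb⟩
    obtain ⟨Z, hZ, hmon⟩ := hr b hb
    obtain ⟨i, hi⟩ := hfree Z hZ
    have hmin := fun x hx => (I i).min'_le x hx
    have hmax := fun x hx => (I i).le_max' x hx
    have hle := hmin _ ((I i).max'_mem (hIne i))
    rcases hle.eq_or_lt with heq | hlt
    · refine ⟨(i, true), fun _ => ⟨fun _ x hx x' hx' _ => ?_, fun h => by simp at h⟩⟩
      obtain rfl : x = x' := by
        have h1 := hmin x hx
        have h2 := hmax x hx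
        have h3 := hmin x' hx'
        have h4 := hmax x' hx'
        linarith
      exact hrefl b x
    · rcases hmon _ _ hle (hi _ ((I i).min'_mem (hIne i)) _ ((I i).max'_mem (hIne i)) hlt) with h | h
      · exact ⟨(i, true), fun _ => ⟨fun _ x hx x' hx' hxx => h x x' (hmin x hx) hxx (hmax x' hx'),
          fun h => by simp at h⟩⟩
      · exact ⟨(i, false), fun _ => ⟨fun h => by simp at h,
          fun _ x hx x' hx' hxx => h x x' (hmin x hx) hxx (hmax x' hx')⟩⟩
  choose k hk using key
  obtain ⟨⟨i, d⟩, hcard⟩ := B.exists_card_le_mul_card_fiber k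
  refine ⟨I i, (hI i).1, B.filter (k · = (i, d)), Finset.filter_subset _ _, (hI i).2, ?_, ?_⟩
  · simpa [mul_comm, mul_left_comm, mul_assoc] using hcard
  · cases d
    · right
      intro b hb
      rw [Finset.mem_filter] at hb
      have := (hk b hb.1).2
      rw [hb.2] at this
      exact this rfl
    · left
      intro b hb
      rw [Finset.mem_filter] at hb
      have := (hk b hb.1).1
      rw [hb.2] at this
      exact this rfl

/-! ### Chains of a spread-monotone relation -/

/-- `U x y` is inherited when `x` decreases and `y` increases within `A`. -/
def SpreadMono {α : Type*} [LinearOrder α] (A : Finset α) (U : α → α → Prop) : Prop :=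
  ∀ x ∈ A, ∀ x' ∈ A, ∀ y ∈ A, ∀ y' ∈ A, x ≤ x' → x' < y → y ≤ y' → U x' y → U x y'

/-- There is an increasing chain of `k` steps in `A` from `x` to `y`, consecutive members of which
are related by `U`. -/
def Steps {α : Type*} [LinearOrder α] (U : α → α → Prop) (A : Finset α) : ℕ → α → α → Prop
  | 0, x, y => x = y ∧ x ∈ A
  | k + 1, x, y => x ∈ A ∧ ∃ z, x < z ∧ U x z ∧ Steps U A k z y

theorem SpreadMono.subset {α : Type*} [LinearOrder α] {A A' : Finset α} {U : α → α → Prop}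
    (h : SpreadMono A U) (hA : A' ⊆ A) : SpreadMono A' U :=
  fun x hx x' hx' y hy y' hy' => h x (hA hx) x' (hA hx') y (hA hy) y' (hA hy')

namespace Steps
variable {α : Type*} [LinearOrder α] {U : α → α → Prop} {A : Finset α} {x y z : α} {k l : ℕ}

theorem mem_left (h : Steps U A k x y) : x ∈ A := by
  cases k with
  | zero => exact h.2
  | succ k => exact h.1

theorem mem_right (h : Steps U A k x y) : y ∈ A := by
  induction k generalizing x with
  | zero => exact h.1 ▸ h.2
  | succ k ih =>
    obtain ⟨-, z, -, -, h⟩ := h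
    exact ih h

theorem le (h : Steps U A k x y) : x ≤ y := by
  induction k generalizing x with
  | zero => exact h.1.le
  | succ k ih =>
    obtain ⟨-, z, hz, -, h⟩ := h
    exact hz.le.trans (ih h)

theorem lt (h : Steps U A k x y) (hk : 0 < k) : x < y := by
  cases k with
  | zero => omega
  | succ k =>
    obtain ⟨-, z, hz, -, h⟩ := h
    exact hz.trans_le h.le

theorem trans (h : Steps U A k x y) (h' : Steps U A l y z) : Steps U A (k + l) x z := by
  induction k generalizing x with
  | zero =>
    obtain ⟨rfl, -⟩ := h
    rwa [Nat.zero_add]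
  | succ k ih =>
    obtain ⟨hx, w, hw, hU, h⟩ := h
    rw [Nat.succ_add]
    exact ⟨hx, w, hw, hU, ih h⟩

theorem split (h : Steps U A (k + l) x y) : ∃ z, Steps U A k x z ∧ Steps U A l z y := by
  induction k generalizing x with
  | zero =>
    rw [Nat.zero_add] at h
    exact ⟨x, ⟨rfl, h.mem_left⟩, h⟩
  | succ k ih =>
    rw [Nat.succ_add] at h
    obtain ⟨hx, w, hw, hU, h⟩ := h
    obtain ⟨z, h1, h2⟩ := ih h
    exact ⟨z, ⟨hx, w, hw, hU, h1⟩, h2⟩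

theorem subset {A' : Finset α} (h : Steps U A k x y) (hA : A ⊆ A') : Steps U A' k x y := by
  induction k generalizing x with
  | zero => exact ⟨h.1, hA h.2⟩
  | succ k ih =>
    obtain ⟨hx, w, hw, hU, h⟩ := h
    exact ⟨hA hx, w, hw, hU, ih h⟩

/-- Spread-monotonicity lets the last link be lengthened. At least one link is needed, hence `k +
1`. -/
theorem extend_right (hU : SpreadMono A U) (h : Steps U A (k + 1) x y) (hz : z ∈ A) (hyz : y ≤ z) :
    Steps U A (k + 1) x z := by
  induction k generalizing x with
  | zero =>
    obtain ⟨hx, w, hw, hxw, rfl, hwA⟩ := h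
    exact ⟨hx, z, hw.trans_le hyz, hU x hx x hx w hwA z hz le_rfl hw hyz hxw, rfl, hz⟩
  | succ k ih =>
    obtain ⟨hx, w, hw, hxw, h⟩ := h
    exact ⟨hx, w, hw, hxw, ih h⟩

theorem extend_left (hU : SpreadMono A U) (h : Steps U A (k + 1) x y) (hz : z ∈ A) (hzx : z ≤ x) :
    Steps U A (k + 1) z y := by
  obtain ⟨hx, w, hw, hxw, h⟩ := h
  exact ⟨hz, w, hzx.trans_lt hw,
    hU z hz x hx w h.mem_left w h.mem_left hzx hw le_rfl hxw, h⟩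

theorem succ_le_card_filter (h : Steps U A k x y) : k + 1 ≤ (A.filter (x ≤ ·)).card := by
  induction k generalizing x with
  | zero => exact Finset.card_pos.2 ⟨x, Finset.mem_filter.2 ⟨h.2, le_rfl⟩⟩
  | succ k ih =>
    obtain ⟨hx, w, hw, -, h⟩ := h
    refine Nat.succ_le_of_lt ((ih h).trans_lt (Finset.card_lt_card ⟨fun a ha => ?_, fun hs => ?_⟩))
    · rw [Finset.mem_filter] at ha ⊢
      exact ⟨ha.1, hw.le.trans ha.2⟩
    · have := hs (Finset.mem_filter.2 ⟨hx, le_rfl⟩)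
      exact absurd (Finset.mem_filter.1 this).2 (not_le.2 hw)

theorem lt_card (h : Steps U A k x y) : k < A.card :=
  h.succ_le_card_filter.trans (Finset.card_filter_le _ _)

/-- Any two chain points enclose a link, and spread-monotonicity widens that link to the whole pair.
-/
theorem exists_clique (hU : SpreadMono A U) (h : Steps U A k x y) :
    ∃ S ⊆ A, S.card = k + 1 ∧ (∀ a ∈ S, x ≤ a ∧ a ≤ y) ∧ ∀ a ∈ S, ∀ a' ∈ S, a < a' → U a a' := by
  induction k generalizing x with
  | zero =>
    obtain ⟨rfl, hx⟩ := h
    refine ⟨{x}, by simpa using hx, by simp, by simp, fun a ha a' ha' hlt => ?_⟩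
    rw [Finset.mem_singleton] at ha ha'
    rw [ha, ha'] at hlt
    exact absurd hlt (lt_irrefl _)
  | succ k ih =>
    obtain ⟨hx, w, hw, hxw, h⟩ := h
    obtain ⟨S, hSA, hcard, hbd, hS⟩ := ih h
    have hxS : x ∉ S := fun hm => absurd (hbd x hm).1 (not_le.2 hw)
    refine ⟨insert x S, Finset.insert_subset hx hSA, by rw [Finset.card_insert_of_notMem hxS, hcard],
      ?_, ?_⟩
    · intro a ha
      rcases Finset.mem_insert.1 ha with rfl | ha
      · exact ⟨le_rfl, hw.le.trans h.le⟩
      · exact ⟨hw.le.trans (hbd a ha).1, (hbd a ha).2⟩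
    · intro a ha a' ha' hlt
      rcases Finset.mem_insert.1 ha with rfl | haS
      · rcases Finset.mem_insert.1 ha' with rfl | ha'
        · exact absurd hlt (lt_irrefl _)
        · exact hU a hx a hx w h.mem_left a' (hSA ha') le_rfl hw (hbd a' ha').1 hxw
      · rcases Finset.mem_insert.1 ha' with rfl | ha'
        · exact absurd ((hw.trans_le (hbd a haS).1).trans hlt) (lt_irrefl _)
        · exact hS a haS a' ha' hlt

end Steps

/-- If long `U`-chains always leave the complement of `W`, then the relation `U ∧ ¬ W` has a large
independent set. -/
theorem exists_independent_of_steps {α : Type*} [LinearOrder α] {U W : α → α → Prop} {A : Finset α}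
    (hU : SpreadMono A U) (hW : SpreadMono A W) {M : ℕ} (hM : 0 < M)
    (h : ∀ x y, Steps U A M x y → W x y) :
    ∃ A' ⊆ A, A.card ≤ (M + 1) * A'.card ∧ ∀ x ∈ A', ∀ y ∈ A', x < y → ¬ (U x y ∧ ¬ W x y) := by
  classical
  let R : α → ℕ → Prop := fun a k => ∃ x y, y ≤ a ∧ Steps U A k x y
  -- `κ a` is the largest number of steps of a chain ending at or before `a`. The set kept is the
  -- largest class of `κ` modulo `M + 1`.
  let κ : α → ℕ := fun a => Nat.findGreatest (R a) A.card
  have hκle : ∀ a k, R a k → k ≤ κ a := by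
    rintro a k ⟨x, y, hy, hs⟩
    exact Nat.le_findGreatest hs.lt_card.le ⟨x, y, hy, hs⟩
  have hκ : ∀ a ∈ A, R a (κ a) := fun a ha =>
    Nat.findGreatest_spec (P := R a) (Nat.zero_le _) ⟨a, a, le_rfl, rfl, ha⟩
  obtain ⟨c, hc⟩ := A.exists_card_le_mul_card_fiber
    fun a => (⟨κ a % (M + 1), Nat.mod_lt _ (Nat.succ_pos _)⟩ : Fin (M + 1))
  rw [Fintype.card_fin] at hc
  refine ⟨_, Finset.filter_subset _ _, hc, ?_⟩
  rintro a ha a' ha' hlt ⟨hUa, hWa⟩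
  rw [Finset.mem_filter] at ha ha'
  have hmod : κ a % (M + 1) = κ a' % (M + 1) := by
    have := congrArg Fin.val (ha.2.trans ha'.2.symm)
    exact this
  have hgt : κ a < κ a' := by
    obtain ⟨x, y, hy, hs⟩ := hκ a ha.1
    have hUy : U y a' := hU y hs.mem_right a ha.1 a' ha'.1 a' ha'.1 hy hlt le_rfl hUa
    refine hκle a' (κ a + 1) ⟨x, a', le_rfl, ?_⟩
    exact hs.trans (l := 1) ⟨hs.mem_right, a', hy.trans_lt hlt, hUy, rfl, ha'.1⟩
  -- An edge `U a a'` raises `κ`, and within a residue class it does so by at least `M + 1`. The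
  -- longest chain up to `a'` therefore has `M` steps beginning beyond `a`. Moving their start back
  -- to `a` yields `W a a'`.
  have hge : κ a + (M + 1) ≤ κ a' := by
    by_contra hlt'
    have e1 := Nat.div_add_mod (κ a) (M + 1)
    have e2 := Nat.div_add_mod (κ a') (M + 1)
    have e3 : κ a / (M + 1) < κ a' / (M + 1) := by
      by_contra hle
      have := Nat.mul_le_mul_left (M + 1) (not_lt.1 hle)
      omega
    have := Nat.mul_le_mul_left (M + 1) (Nat.succ_le_of_lt e3)
    rw [Nat.mul_succ] at this
    omega
  obtain ⟨x, y, hy, hs⟩ := hκ a' ha'.1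
  obtain ⟨d, hd⟩ := Nat.exists_eq_add_of_le hge
  rw [hd, show κ a + (M + 1) + d = (κ a + 1) + (M + d) by omega] at hs
  obtain ⟨z, hs1, hs2⟩ := hs.split
  obtain ⟨w, hs3, hs4⟩ := hs2.split
  have haz : a < z := by
    by_contra hza
    have := hκle a (κ a + 1) ⟨x, z, not_lt.1 hza, hs1⟩
    omega
  obtain ⟨M, rfl⟩ := Nat.exists_eq_succ_of_ne_zero hM.ne'
  have hs5 := hs3.extend_left hU ha.1 haz.le
  have := h _ _ hs5
  exact hWa (hW a ha.1 a ha.1 w hs3.mem_right a' ha'.1 le_rfl (haz.trans_le hs3.le)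
    (hs4.le.trans hy) this)

/-! ### Nested levels and emptying a moving strip -/

/-- The sets of points from which long chains fit below the next threshold. -/
noncomputable def nestedLevels {α : Type*} [LinearOrder α] (U W : ℕ → α → α → Prop) (m : ℕ)
    (A : Finset α) : ℕ → Finset α
  | 0 => A
  | i + 1 => by
    classical exact (nestedLevels U W m A i).filter fun x =>
      ∃ y, Steps (U i) (nestedLevels U W m A i) (2 * m) x y ∧ ¬ W (i + 1) x y

section NestedLevels
variable {α : Type*} [LinearOrder α] {U W : ℕ → α → α → Prop} {m : ℕ} {A : Finset α}

theorem mem_nestedLevels_succ {i : ℕ} {x : α} : x ∈ nestedLevels U W m A (i + 1) ↔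
    x ∈ nestedLevels U W m A i ∧
      ∃ y, Steps (U i) (nestedLevels U W m A i) (2 * m) x y ∧ ¬ W (i + 1) x y := by
  simp [nestedLevels]

theorem nestedLevels_succ_subset (i : ℕ) :
    nestedLevels U W m A (i + 1) ⊆ nestedLevels U W m A i :=
  fun _ hx => (mem_nestedLevels_succ.1 hx).1

theorem nestedLevels_subset (i : ℕ) : nestedLevels U W m A i ⊆ A := by
  induction i with
  | zero => exact subset_rfl
  | succ i ih => exact (nestedLevels_succ_subset i).trans ih

/-- Chain doubling. As the strip of level `i + 1` has no clique of size `m + 1`, any `m` steps of `U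
(i + 1)` from `x` end at a point `z` beyond its `W`-threshold. The `2 * m` steps of `U i` from `x`
witnessing membership in the next level end before that threshold, so they can be stretched to end
at `z`. -/
theorem steps_nestedLevels_succ (hm : 0 < m) {i : ℕ} (hUi : SpreadMono A (U i))
    (hU : SpreadMono A (U (i + 1))) (hW : SpreadMono A (W (i + 1)))
    (hc : ∀ S ⊆ A, S.card = m + 1 →
      ¬ ∀ x ∈ S, ∀ y ∈ S, x < y → U (i + 1) x y ∧ ¬ W (i + 1) x y) {q : ℕ} {x y : α}
    (h : Steps (U (i + 1)) (nestedLevels U W m A (i + 1)) (m * q) x y) :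
    Steps (U i) (nestedLevels U W m A i) (2 * m * q) x y := by
  have hsub := nestedLevels_subset (U := U) (W := W) (m := m) (A := A) i
  have hsub' := nestedLevels_subset (U := U) (W := W) (m := m) (A := A) (i + 1)
  induction q generalizing x with
  | zero => exact ⟨h.1, nestedLevels_succ_subset i h.2⟩
  | succ q ih =>
    rw [Nat.mul_succ, Nat.add_comm (m * q)] at h
    obtain ⟨z, h1, h2⟩ := h.split
    rw [Nat.mul_succ, Nat.add_comm (2 * m * q)]
    refine Steps.trans ?_ (ih h2)
    obtain ⟨hx, y₀, hs, hy₀⟩ := mem_nestedLevels_succ.1 h1.mem_left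
    have hlt := h1.lt hm
    have hWz : W (i + 1) x z := by
      by_contra hWz
      obtain ⟨S, hSA, hcard, hbd, hS⟩ := (h1.subset hsub').exists_clique hU
      refine hc S hSA hcard fun a ha a' ha' haa => ⟨hS a ha a' ha' haa, fun hWa => hWz ?_⟩
      exact hW x (hsub hx) a (hSA ha) a' (hSA ha') z (hsub' h1.mem_right) (hbd a ha).1 haa
        (hbd a' ha').2 hWa
    have hy : y₀ ≤ z := by
      by_contra hlt'
      exact hy₀ (hW x (hsub hx) x (hsub hx) z (hsub' h1.mem_right) y₀ (hsub hs.mem_right)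
        le_rfl hlt (not_le.1 hlt').le hWz)
    obtain ⟨k, hk⟩ := Nat.exists_eq_succ_of_ne_zero (show 2 * m ≠ 0 by omega)
    rw [hk] at hs ⊢
    exact hs.extend_right (hUi.subset hsub) (nestedLevels_succ_subset i h1.mem_right) hy

/-- If every level lost less than a share `1 / (2 * r)` of `A`, level `r` would be nonempty.
Doubling down from one of its points would give `m * 2 ^ r` steps inside `A`, which has at most `2 ^
r` points. -/
theorem exists_large_drop (hA : A.Nonempty) {r : ℕ} (hr : 0 < r) (hm : 0 < m)
    (hcard : A.card ≤ 2 ^ r) (hU : ∀ i ≤ r, SpreadMono A (U i)) (hW : ∀ i ≤ r, SpreadMono A (W i))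
    (hc : ∀ i ≤ r, ∀ S ⊆ A, S.card = m + 1 →
      ¬ ∀ x ∈ S, ∀ y ∈ S, x < y → U i x y ∧ ¬ W i x y) :
    ∃ i < r, A.card ≤ 2 * r * (nestedLevels U W m A i \ nestedLevels U W m A (i + 1)).card := by
  classical
  by_contra hcon
  push Not at hcon
  have hsize : ∀ i ≤ r, (2 * r - i) * A.card ≤ 2 * r * (nestedLevels U W m A i).card := by
    intro i
    induction i with
    | zero => intro _; simp [nestedLevels]
    | succ i ih =>
      intro hi
      have h1 := ih (by omega)
      have h2 := hcon i (by omega)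
      have h3 := Finset.card_sdiff_add_card_eq_card
        (nestedLevels_succ_subset (U := U) (W := W) (m := m) (A := A) i)
      obtain ⟨d, hd⟩ := Nat.exists_eq_add_of_le (show i + 1 ≤ 2 * r by omega)
      rw [show 2 * r - i = d + 1 by omega] at h1
      rw [show 2 * r - (i + 1) = d by omega]
      nlinarith
  have hne : (nestedLevels U W m A r).Nonempty := by
    rw [← Finset.card_pos]
    have h1 := hsize r le_rfl
    have h2 := Finset.card_pos.2 hA
    have h3 : 0 < (2 * r - r) * A.card := Nat.mul_pos (by omega) h2
    exact Nat.pos_of_mul_pos_left (h3.trans_le h1)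
  obtain ⟨x, hx⟩ := hne
  have key : ∀ k < r, ∃ y, Steps (U (r - 1 - k)) (nestedLevels U W m A (r - 1 - k))
      (m * 2 ^ (k + 1)) x y := by
    intro k
    induction k with
    | zero =>
      intro _
      rw [show r = (r - 1 - 0) + 1 by omega] at hx
      obtain ⟨-, y, hy, -⟩ := mem_nestedLevels_succ.1 hx
      exact ⟨y, by rwa [Nat.zero_add, pow_one, mul_comm]⟩
    | succ k ih =>
      intro hk
      obtain ⟨y, hy⟩ := ih (by omega)
      rw [show r - 1 - k = (r - 1 - (k + 1)) + 1 by omega] at hy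
      refine ⟨y, ?_⟩
      have := steps_nestedLevels_succ hm (hU _ (by omega)) (hU _ (by omega)) (hW _ (by omega))
        (hc _ (by omega)) hy
      rwa [show 2 * m * 2 ^ (k + 1) = m * 2 ^ (k + 1 + 1) by ring] at this
  obtain ⟨y, hy⟩ := key (r - 1) (by omega)
  have h1 := hy.lt_card
  rw [Nat.sub_self, Nat.sub_add_cancel hr] at h1
  have h2 : 2 ^ r ≤ m * 2 ^ r := Nat.le_mul_of_pos_left _ hm
  simp only [nestedLevels] at h1
  omega

end NestedLevels

/-- Quantile blocks of a finite linearly ordered set. -/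
theorem Finset.exists_quantiles {β : Type*} [LinearOrder β] (B : Finset β) (hB : B.Nonempty)
    {r : ℕ} (hr : 0 < r) : ∃ b : ℕ → β, (∀ i ≤ r, b i ∈ B) ∧
      ∀ i < r, B.card ≤ r * (B.filter fun x => b i ≤ x ∧ x ≤ b (i + 1)).card := by
  classical
  have hpos := Finset.card_pos.2 hB
  set q := (B.card - 1) / r with hq
  have hle : r * q ≤ B.card - 1 := Nat.mul_div_le _ _
  have hlt : B.card - 1 < r * (q + 1) := by
    rw [mul_comm]; exact Nat.lt_mul_of_div_lt (Nat.lt_succ_self _) hr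
  let e := B.orderEmbOfFin rfl
  have hidx : ∀ i j, i < r → j ≤ q → i * q + j < B.card := by
    intro i j hi hj
    have : (i + 1) * q ≤ r * q := Nat.mul_le_mul_right _ hi
    nlinarith [Nat.sub_add_cancel hpos]
  have hidx' : ∀ i, i ≤ r → i * q < B.card := by
    intro i hi
    have : i * q ≤ r * q := Nat.mul_le_mul_right _ hi
    omega
  refine ⟨fun i => if h : i * q < B.card then e ⟨i * q, h⟩ else e ⟨0, hpos⟩, ?_, ?_⟩
  · intro i hi
    simp only [dif_pos (hidx' i hi)]
    exact B.orderEmbOfFin_mem rfl _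
  · intro i hi
    simp only [dif_pos (hidx' i hi.le), dif_pos (hidx' (i + 1) hi)]
    have hcard : q + 1 ≤ (B.filter fun x => e ⟨i * q, hidx' i hi.le⟩ ≤ x ∧
        x ≤ e ⟨(i + 1) * q, hidx' (i + 1) hi⟩).card := by
      have := Finset.card_le_card_of_injOn (s := (Finset.univ : Finset (Fin (q + 1))))
        (t := B.filter fun x => e ⟨i * q, hidx' i hi.le⟩ ≤ x ∧
          x ≤ e ⟨(i + 1) * q, hidx' (i + 1) hi⟩)
        (fun j => e ⟨i * q + j, hidx i j hi (Nat.lt_succ_iff.1 j.2)⟩) ?_ ?_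
      · rwa [Finset.card_univ, Fintype.card_fin] at this
      · intro j _
        simp only [Finset.coe_filter]
        refine ⟨B.orderEmbOfFin_mem rfl _, ?_, ?_⟩
        · refine e.monotone ?_
          rw [Fin.le_def]
          simp
        · refine e.monotone ?_
          rw [Fin.le_def]
          have := Nat.lt_succ_iff.1 j.2
          simp only
          nlinarith
      · intro j _ j' _ h
        have := congrArg Fin.val (e.injective h)
        simp only at this
        exact Fin.ext (by omega)
    have := Nat.mul_le_mul_left r hcard
    omega

/-- A strip `U ∧ ¬ W` whose thresholds move in the same direction with the parameter has no edges on
large subsets, unless it has a large clique for a single parameter. -/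
theorem exists_strip_free_of_levels {α β : Type*} [LinearOrder α] {U W : α → α → β → Prop}
    {A : Finset α} {B : Finset β} (hA : A.Nonempty) {r m : ℕ} (hr : 0 < r) (hm : 0 < m)
    (hcard : A.card ≤ 2 ^ r) (hU : ∀ b ∈ B, SpreadMono A fun x y => U x y b)
    (hW : ∀ b ∈ B, SpreadMono A fun x y => W x y b)
    (hc : ∀ b ∈ B, ∀ S ⊆ A, S.card = m + 1 →
      ¬ ∀ x ∈ S, ∀ y ∈ S, x < y → U x y b ∧ ¬ W x y b)
    (b : ℕ → β) (hb : ∀ i ≤ r, b i ∈ B) (C : ℕ → Finset β)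
    (hC : ∀ i < r, C i ⊆ B ∧ B.card ≤ r * (C i).card)
    (hmon : ∀ i < r, ∀ c ∈ C i, ∀ x ∈ A, ∀ y ∈ A,
      (U x y c → U x y (b i)) ∧ (W x y (b (i + 1)) → W x y c)) :
    ∃ A' ⊆ A, ∃ B' ⊆ B, A.card ≤ 2 * r * (2 * m + 1) * A'.card ∧ B.card ≤ r * B'.card ∧
      ∀ x ∈ A', ∀ y ∈ A', x < y → ∀ c ∈ B', ¬ (U x y c ∧ ¬ W x y c) := by
  classical
  obtain ⟨i, hi, hlarge⟩ := exists_large_drop (U := fun i x y => U x y (b i))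
    (W := fun i x y => W x y (b i)) (m := m) hA hr hm hcard (fun i hi => hU _ (hb i hi))
    (fun i hi => hW _ (hb i hi)) (fun i hi => hc _ (hb i hi))
  set L := nestedLevels (fun i x y => U x y (b i)) (fun i x y => W x y (b i)) m A with hL
  have hsub : L i \ L (i + 1) ⊆ A := Finset.sdiff_subset.trans (nestedLevels_subset i)
  obtain ⟨A', hA', hcardA', hfree⟩ := exists_independent_of_steps (A := L i \ L (i + 1))
    ((hU _ (hb i hi.le)).subset hsub) ((hW _ (hb (i + 1) hi)).subset hsub)
    (M := 2 * m) (by omega) (by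
      intro x y h
      by_contra hWxy
      have hx := Finset.mem_sdiff.1 h.mem_left
      exact hx.2 (mem_nestedLevels_succ.2 ⟨hx.1, y, h.subset Finset.sdiff_subset, hWxy⟩))
  refine ⟨A', hA'.trans hsub, C i, (hC i hi).1, ?_, (hC i hi).2, ?_⟩
  · calc A.card ≤ 2 * r * (L i \ L (i + 1)).card := hlarge
      _ ≤ 2 * r * ((2 * m + 1) * A'.card) := Nat.mul_le_mul_left _ hcardA'
      _ = _ := by ring
  · rintro x hx y hy hxy c hcc ⟨h1, h2⟩
    have := hmon i hi c hcc x (hsub (hA' hx)) y (hsub (hA' hy))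
    exact hfree x hx y hy hxy ⟨this.1 h1, fun h => h2 (this.2 h)⟩

/-- A strip between two thresholds that are monotone in the parameter has no edges on large subsets,
unless it has a large clique for a single parameter. -/
theorem exists_strip_free {α β : Type*} [LinearOrder α] [LinearOrder β] {U W : α → α → β → Prop}
    {A : Finset α} {B : Finset β} (hA : A.Nonempty) (hB : B.Nonempty) {r m : ℕ} (hr : 0 < r)
    (hm : 0 < m) (hcard : A.card ≤ 2 ^ r) (hU : ∀ b ∈ B, SpreadMono A fun x y => U x y b)
    (hW : ∀ b ∈ B, SpreadMono A fun x y => W x y b)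
    (hc : ∀ b ∈ B, ∀ S ⊆ A, S.card = m + 1 →
      ¬ ∀ x ∈ S, ∀ y ∈ S, x < y → U x y b ∧ ¬ W x y b)
    (hUm : (∀ b ∈ B, ∀ c ∈ B, b ≤ c → ∀ x ∈ A, ∀ y, U x y b → U x y c) ∨
      (∀ b ∈ B, ∀ c ∈ B, b ≤ c → ∀ x ∈ A, ∀ y, U x y c → U x y b))
    (hWm : (∀ b ∈ B, ∀ c ∈ B, b ≤ c → ∀ x ∈ A, ∀ y, W x y b → W x y c) ∨
      (∀ b ∈ B, ∀ c ∈ B, b ≤ c → ∀ x ∈ A, ∀ y, W x y c → W x y b)) :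
    ∃ A' ⊆ A, ∃ B' ⊆ B, A.card ≤ 2 * r * (2 * m + 1) * A'.card ∧ B.card ≤ r * B'.card ∧
      ∀ x ∈ A', ∀ y ∈ A', x < y → ∀ c ∈ B', ¬ (U x y c ∧ ¬ W x y c) := by
  classical
  -- When some `b₀` has a strip containing all the others, the whole of `B` is kept and only `b₀`
  -- matters.
  have single : ∀ b₀ ∈ B, (∀ b ∈ B, ∀ x ∈ A, ∀ y, (U x y b → U x y b₀) ∧ (W x y b₀ → W x y b)) →
      ∃ A' ⊆ A, ∃ B' ⊆ B, A.card ≤ 2 * r * (2 * m + 1) * A'.card ∧ B.card ≤ r * B'.card ∧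
      ∀ x ∈ A', ∀ y ∈ A', x < y → ∀ c ∈ B', ¬ (U x y c ∧ ¬ W x y c) := by
    intro b₀ hb₀ hmon
    obtain ⟨A', hA', hcardA', hfree⟩ := exists_independent_of_steps (hU b₀ hb₀) (hW b₀ hb₀) hm (by
      intro x y h
      by_contra hWxy
      obtain ⟨S, hSA, hScard, hbd, hS⟩ := h.exists_clique (hU b₀ hb₀)
      refine hc b₀ hb₀ S hSA hScard fun a ha a' ha' haa => ⟨hS a ha a' ha' haa, fun hWa => hWxy ?_⟩
      exact hW b₀ hb₀ x h.mem_left a (hSA ha) a' (hSA ha') y h.mem_right (hbd a ha).1 haa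
        (hbd a' ha').2 hWa)
    refine ⟨A', hA', B, subset_rfl, hcardA'.trans ?_, Nat.le_mul_of_pos_left _ hr, ?_⟩
    · refine Nat.mul_le_mul_right _ ?_
      nlinarith
    · rintro x hx y hy hxy c hcB ⟨h1, h2⟩
      have := hmon c hcB x (hA' hx) y
      exact hfree x hx y hy hxy ⟨this.1 h1, fun h => h2 (this.2 h)⟩
  obtain ⟨b, hb, hblock⟩ := B.exists_quantiles hB hr
  rcases hUm with hUm | hUm <;> rcases hWm with hWm | hWm
  · refine exists_strip_free_of_levels hA hr hm hcard hU hW hc (fun i => b (r - i))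
      (fun i hi => hb _ (Nat.sub_le _ _))
      (fun i => B.filter fun x => b (r - 1 - i) ≤ x ∧ x ≤ b (r - 1 - i + 1)) ?_ ?_
    · exact fun i hi => ⟨Finset.filter_subset _ _, hblock _ (by omega)⟩
    · intro i hi c hcC x hx y hy
      rw [Finset.mem_filter] at hcC
      rw [show r - 1 - i + 1 = r - i by omega] at hcC
      simp only [show r - (i + 1) = r - 1 - i by omega]
      exact ⟨hUm c hcC.1 _ (hb _ (Nat.sub_le _ _)) hcC.2.2 x hx y,
        hWm _ (hb _ (by omega)) c hcC.1 hcC.2.1 x hx y⟩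
  · refine single (B.max' hB) (B.max'_mem hB) fun c hcB x hx y => ⟨?_, ?_⟩
    · exact hUm c hcB _ (B.max'_mem hB) (B.le_max' c hcB) x hx y
    · exact hWm c hcB _ (B.max'_mem hB) (B.le_max' c hcB) x hx y
  · refine single (B.min' hB) (B.min'_mem hB) fun c hcB x hx y => ⟨?_, ?_⟩
    · exact hUm _ (B.min'_mem hB) c hcB (B.min'_le c hcB) x hx y
    · exact hWm _ (B.min'_mem hB) c hcB (B.min'_le c hcB) x hx y
  · refine exists_strip_free_of_levels hA hr hm hcard hU hW hc b hb
      (fun i => B.filter fun x => b i ≤ x ∧ x ≤ b (i + 1)) ?_ ?_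
    · exact fun i hi => ⟨Finset.filter_subset _ _, hblock i hi⟩
    · intro i hi c hcC x hx y hy
      rw [Finset.mem_filter] at hcC
      exact ⟨hUm _ (hb i hi.le) c hcC.1 hcC.2.1 x hx y,
        hWm c hcC.1 _ (hb (i + 1) hi) hcC.2.2 x hx y⟩

/-! ### Free pairs for ternary semialgebraic relations -/

/-- Within `A₀` and `B₀`, the property `Q` holds on subsets smaller by a factor of at most `K`. -/
def AttainableIn (A₀ B₀ : Finset ℝ) (K : ℕ) (Q : Finset ℝ → Finset ℝ → Prop) : Prop :=
  ∀ A ⊆ A₀, ∀ B ⊆ B₀, A.Nonempty → B.Nonempty →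
    ∃ A' ⊆ A, ∃ B' ⊆ B, A.card ≤ K * A'.card ∧ B.card ≤ K * B'.card ∧ Q A' B'

theorem Finset.Nonempty.of_card_le_mul {α : Type*} {A A' : Finset α} {K : ℕ} (hA : A.Nonempty)
    (h : A.card ≤ K * A'.card) : A'.Nonempty := by
  rw [← Finset.card_pos] at hA ⊢
  exact Nat.pos_of_mul_pos_left (hA.trans_le h)

namespace AttainableIn
variable {A₀ B₀ : Finset ℝ} {K : ℕ}

theorem mono {K' : ℕ} {Q : Finset ℝ → Finset ℝ → Prop} (h : AttainableIn A₀ B₀ K Q) (hK : K ≤ K') :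
    AttainableIn A₀ B₀ K' Q := by
  intro A hA B hB hAn hBn
  obtain ⟨A', hA', B', hB', h1, h2, h3⟩ := h A hA B hB hAn hBn
  exact ⟨A', hA', B', hB', h1.trans (Nat.mul_le_mul_right _ hK),
    h2.trans (Nat.mul_le_mul_right _ hK), h3⟩

theorem and {L : ℕ} {Q R : Finset ℝ → Finset ℝ → Prop} (hQ : AttainableIn A₀ B₀ K Q)
    (hR : AttainableIn A₀ B₀ L R)
    (hsub : ∀ A B A' B', A' ⊆ A → B' ⊆ B → Q A B → Q A' B') :
    AttainableIn A₀ B₀ (K * L) fun A B => Q A B ∧ R A B := by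
  intro A hA B hB hAn hBn
  obtain ⟨A₁, hA₁, B₁, hB₁, h1, h2, h3⟩ := hQ A hA B hB hAn hBn
  obtain ⟨A₂, hA₂, B₂, hB₂, h4, h5, h6⟩ := hR A₁ (hA₁.trans hA) B₁ (hB₁.trans hB)
    (hAn.of_card_le_mul h1) (hBn.of_card_le_mul h2)
  refine ⟨A₂, hA₂.trans hA₁, B₂, hB₂.trans hB₁, ?_, ?_, hsub _ _ _ _ hA₂ hB₂ h3, h6⟩
  · rw [mul_assoc]; exact h1.trans (Nat.mul_le_mul_left _ h4)
  · rw [mul_assoc]; exact h2.trans (Nat.mul_le_mul_left _ h5)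

theorem forall_lt {Q : ℕ → Finset ℝ → Finset ℝ → Prop} {J : ℕ}
    (hQ : ∀ j < J, AttainableIn A₀ B₀ K (Q j))
    (hsub : ∀ j A B A' B', A' ⊆ A → B' ⊆ B → Q j A B → Q j A' B') :
    AttainableIn A₀ B₀ (K ^ J) fun A B => ∀ j < J, Q j A B := by
  induction J with
  | zero => exact fun A _ B _ _ _ => ⟨A, subset_rfl, B, subset_rfl, by simp, by simp, by simp⟩
  | succ J ih =>
    intro A hA B hB hAn hBn
    rw [pow_succ]
    obtain ⟨A', hA', B', hB', h1, h2, h3, h4⟩ := (ih fun j hj => hQ j (by omega)).and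
      (hQ J (Nat.lt_succ_self J)) (fun A B A' B' hA hB h j hj => hsub j _ _ _ _ hA hB (h j hj))
      A hA B hB hAn hBn
    refine ⟨A', hA', B', hB', h1, h2, fun j hj => ?_⟩
    rcases Nat.lt_succ_iff_lt_or_eq.1 hj with h | rfl
    · exact h3 j h
    · exact h4

end AttainableIn

/-- On `A` and `B` the relation `W` is described by a threshold monotone in both variables. -/
def ThresholdMono (W : ℝ → ℝ → ℝ → Prop) (A B : Finset ℝ) : Prop :=
  (∀ b ∈ B, SpreadMono A fun x y => W x y b) ∧
  ((∀ b ∈ B, ∀ c ∈ B, b ≤ c → ∀ x ∈ A, ∀ y, W x y b → W x y c) ∨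
    (∀ b ∈ B, ∀ c ∈ B, b ≤ c → ∀ x ∈ A, ∀ y, W x y c → W x y b))

theorem ThresholdMono.subset {W : ℝ → ℝ → ℝ → Prop} {A B A' B' : Finset ℝ} (hA : A' ⊆ A)
    (hB : B' ⊆ B) (h : ThresholdMono W A B) : ThresholdMono W A' B' :=
  ⟨fun b hb => (h.1 b (hB hb)).subset hA,
    h.2.imp (fun h b hb c hc hbc x hx => h b (hB hb) c (hB hc) hbc x (hA hx))
      (fun h b hb c hc hbc x hx => h b (hB hb) c (hB hc) hbc x (hA hx))⟩

theorem Semialg.attainableIn_thresholdMono {W : (ℕ → ℝ) → ℝ → ℝ → ℝ → Prop}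
    (hW : Semialg fun w => W (fun i => w (i + 3)) (w 0) (w 1) (w 2))
    (hup : ∀ v x y y' b, y ≤ y' → W v x y b → W v x y' b) (hlt : ∀ v x y b, W v x y b → x < y) :
    ∃ K : ℕ, ∀ v A₀ B₀, AttainableIn A₀ B₀ K (ThresholdMono (W v)) := by
  obtain ⟨D₁, h₁⟩ := hW.exists_threshold_cuts_first hup
  obtain ⟨D₂, h₂⟩ := hW.exists_threshold_cuts_third hup
  refine ⟨(2 * (D₁ + 1)) * (2 * (D₂ + 1)), fun v A₀ B₀ => ?_⟩
  refine AttainableIn.and (Q := fun A B => ∀ b ∈ B, SpreadMono A fun x y => W v x y b)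
    (R := fun A B => (∀ b ∈ B, ∀ c ∈ B, b ≤ c → ∀ x ∈ A, ∀ y, W v x y b → W v x y c) ∨
    (∀ b ∈ B, ∀ c ∈ B, b ≤ c → ∀ x ∈ A, ∀ y, W v x y c → W v x y b)) ?_ ?_ ?_
  · intro A _ B _ hA hB
    obtain ⟨A', hA', B', hB', hc, hc', h⟩ := Finset.exists_monotone_blocks
      (r := fun b x x' => ∀ y, W v x y b → W v x' y b) (fun _ _ _ h => h) A B hA
      (fun b _ => h₁ v b)
    refine ⟨A', hA', B', hB', hc, hc', ?_⟩
    intro b hb x hx x' hx' y hy y' hy' hxx hxy hyy hWy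
    -- The opposite monotonicity in `x` would carry `W` from `x'` up to `y` and give `W v y y b`,
    -- against `hlt`. So in that case `W` is empty on the increasing pairs of `A'`.
    rcases h with h | h
    · exact absurd (hlt v y y b (h b hb x' hx' y hy hxy.le y hWy)) (lt_irrefl _)
    · exact hup v x y y' b hyy (h b hb x hx x' hx' hxx y hWy)
  · intro A _ B _ hA hB
    obtain ⟨B', hB', A', hA', hc, hc', h⟩ := Finset.exists_monotone_blocks
      (r := fun x b c => ∀ y, W v x y b → W v x y c) (fun _ _ _ h => h) B A hB
      (fun x _ => h₂ v x)
    refine ⟨A', hA', B', hB', hc', hc, ?_⟩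
    exact h.imp (fun h b hb c hc hbc x hx => h x hx b hb c hc hbc)
      (fun h b hb c hc hbc x hx => h x hx b hb c hc hbc)
  · exact fun A B A' B' hA hB h b hb => (h b (hB hb)).subset hA

theorem free_pair_constant {K₁ J r m : ℕ} (hr : 0 < r) (hm : 0 < m) :
    K₁ ^ (J + 2) * (2 * r * (2 * m + 1)) ^ (J + 1) ≤
      ((K₁ ^ (J + 2) + 6 + J) * r * m) ^ (K₁ ^ (J + 2) + 6 + J) := by
  set K := K₁ ^ (J + 2) + 6 + J with hK
  have hrm : 1 ≤ r * m := Nat.mul_pos hr hm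
  have h1 : K₁ ^ (J + 2) ≤ K * r * m := by
    rw [mul_assoc]
    exact (show K₁ ^ (J + 2) ≤ K by omega).trans (Nat.le_mul_of_pos_right _ hrm)
  have h2 : 2 * r * (2 * m + 1) ≤ K * r * m := by
    have : 6 * (r * m) ≤ K * (r * m) := Nat.mul_le_mul_right _ (by omega)
    nlinarith
  have h3 : 0 < K * r * m := by
    rw [mul_assoc]; exact Nat.mul_pos (by omega) hrm
  calc K₁ ^ (J + 2) * (2 * r * (2 * m + 1)) ^ (J + 1)
      ≤ (K * r * m) * (K * r * m) ^ (J + 1) := Nat.mul_le_mul h1 (Nat.pow_le_pow_left h2 _)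
    _ = (K * r * m) ^ (J + 2) := by rw [← pow_succ']
    _ ≤ (K * r * m) ^ K := Nat.pow_le_pow_right h3 (by omega)

/-- If no parameter `b ∈ B` gives a large clique on `A`, then a semialgebraic relation has no edges at
all on large subsets of `A` and `B`. -/
theorem Semialg.exists_free_pair {E : (ℕ → ℝ) → ℝ → ℝ → ℝ → Prop}
    (hE : Semialg fun w => E (fun i => w (i + 3)) (w 0) (w 1) (w 2)) :
    ∃ K : ℕ, ∀ (v : ℕ → ℝ) (A B : Finset ℝ) (r m : ℕ), A.Nonempty → B.Nonempty → 0 < r → 0 < m →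
      A.card ≤ 2 ^ r → (∀ b ∈ B, ∀ S ⊆ A, S.card = m + 1 →
        ¬ ∀ x ∈ S, ∀ y ∈ S, x < y → E v x y b) →
      ∃ A' ⊆ A, ∃ B' ⊆ B, A.card ≤ (K * r * m) ^ K * A'.card ∧
        B.card ≤ (K * r * m) ^ K * B'.card ∧
        ∀ x ∈ A', ∀ y ∈ A', x < y → ∀ b ∈ B', ¬ E v x y b := by
  obtain ⟨D, hD⟩ := Semialg.exists_cuts
    (P := fun y w => E (fun i => w (i + 2)) (w 0) y (w 1)) (hE.at_three 1 0 2 3)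
  have hJ : ∀ v x b y j, AltReach (fun y => E v x y b) x j y → j ≤ 2 * D := by
    intro v x b y j h
    obtain ⟨Z, hZ, hcut⟩ := hD (consSeq x (consSeq b v))
    have := h.le_card (Z := Z) hcut
    omega
  set J := 2 * D with hJdef
  let W : ℕ → (ℕ → ℝ) → ℝ → ℝ → ℝ → Prop := fun j v x y b => AltReach (fun y => E v x y b) x j y
  have hatt : ∀ j, ∃ K : ℕ, ∀ v A₀ B₀, AttainableIn A₀ B₀ K (ThresholdMono (W j v)) := fun j =>
    Semialg.attainableIn_thresholdMono (W := W j) (hE.altReach j)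
      (fun v x y y' b hy h => AltReach.mono h hy) (fun v x y b h => AltReach.lt h)
  choose Kj hKj using hatt
  set K₁ := ∑ j ∈ Finset.range (J + 2), Kj j with hK₁
  refine ⟨K₁ ^ (J + 2) + 6 + J, fun v A B r m hA hB hr hm hcard hclique => ?_⟩
  obtain ⟨A₁, hA₁, B₁, hB₁, hc₁, hc₁', hmono⟩ := AttainableIn.forall_lt
    (Q := fun j => ThresholdMono (W j v)) (J := J + 2) (K := K₁) (A₀ := A) (B₀ := B)
    (fun j hj => (hKj j v A B).mono (Finset.single_le_sum (f := Kj) (fun _ _ => Nat.zero_le _)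
      (Finset.mem_range.2 hj)))
    (fun j A B A' B' hA hB h => h.subset hA hB) A subset_rfl B subset_rfl hA hB
  -- For even `j`, the strip between `W j` and `W (j + 1)` lies inside `E`, so it inherits the
  -- absence of cliques. These finitely many strips cover `E` and are emptied one after another.
  obtain ⟨A₂, hA₂, B₂, hB₂, hc₂, hc₂', hfree⟩ := AttainableIn.forall_lt
    (Q := fun j A B => Even j → ∀ x ∈ A, ∀ y ∈ A, x < y → ∀ c ∈ B,
      ¬ (W j v x y c ∧ ¬ W (j + 1) v x y c))
    (J := J + 1) (K := 2 * r * (2 * m + 1)) (A₀ := A₁) (B₀ := B₁) (by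
      intro j hj A' hA' B' hB' hAn hBn
      by_cases hev : Even j
      swap
      · exact ⟨A', subset_rfl, B', subset_rfl, Nat.le_mul_of_pos_left _ (by positivity),
          Nat.le_mul_of_pos_left _ (by positivity), fun h => absurd h hev⟩
      have hU := (hmono j (by omega)).subset hA' hB'
      have hV := (hmono (j + 1) (by omega)).subset hA' hB'
      obtain ⟨A'', hA'', B'', hB'', h1, h2, h3⟩ := exists_strip_free (r := r) (m := m) hAn hBn hr hm
        ((Finset.card_le_card (hA'.trans hA₁)).trans hcard) hU.1 hV.1 (by
          intro b hb S hS hScard hall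
          refine hclique b (hB₁ (hB' hb)) S (hS.trans (hA'.trans hA₁)) hScard
            fun x hx y hy hxy => ?_
          rw [iff_exists_altReach (Q := fun y => E v x y b) hxy fun j h => hJ v x b y j h]
          exact ⟨j, by omega, hev, hall x hx y hy hxy⟩) hU.2 hV.2
      refine ⟨A'', hA'', B'', hB'', h1, h2.trans (Nat.mul_le_mul_right _ ?_), fun _ => h3⟩
      nlinarith)
    (fun j A B A' B' hA hB h hj x hx y hy hxy c hc => h hj x (hA hx) y (hA hy) hxy c (hB hc))
    A₁ subset_rfl B₁ subset_rfl (hA.of_card_le_mul hc₁) (hB.of_card_le_mul hc₁')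
  have hconst := free_pair_constant (K₁ := K₁) (J := J) hr hm
  refine ⟨A₂, hA₂.trans hA₁, B₂, hB₂.trans hB₁, ?_, ?_, ?_⟩
  · refine (hc₁.trans (Nat.mul_le_mul_left _ hc₂)).trans ?_
    rw [← mul_assoc]
    exact Nat.mul_le_mul_right _ hconst
  · refine (hc₁'.trans (Nat.mul_le_mul_left _ hc₂')).trans ?_
    rw [← mul_assoc]
    exact Nat.mul_le_mul_right _ hconst
  · intro x hx y hy hxy b hb hExy
    rw [iff_exists_altReach (Q := fun y => E v x y b) hxy fun j h => hJ v x b y j h] at hExy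
    obtain ⟨j, hj, hev, h⟩ := hExy
    exact hfree j (by omega) hev x hx y hy hxy b hb h

/-! ### Off-diagonal Ramsey theorem for ternary relations on finite sets of reals -/

/-- If no `b ∈ B` has a large clique in `A` for `E · · b`, then `E` has no edges with two vertices in
`A` and the last one in `B` on large subsets. -/
def LastFree (K : ℕ) (E : ℝ → ℝ → ℝ → Prop) : Prop :=
  ∀ (A B : Finset ℝ) (r m : ℕ), A.Nonempty → B.Nonempty → 0 < r → 0 < m → A.card ≤ 2 ^ r →
    (∀ b ∈ B, ∀ S ⊆ A, S.card = m + 1 → ¬ ∀ x ∈ S, ∀ y ∈ S, x < y → E x y b) →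
    ∃ A' ⊆ A, ∃ B' ⊆ B, A.card ≤ (K * r * m) ^ K * A'.card ∧ B.card ≤ (K * r * m) ^ K * B'.card ∧
      ∀ x ∈ A', ∀ y ∈ A', x < y → ∀ b ∈ B', ¬ E x y b

/-- The mirror image of `LastFree`. -/
def FirstFree (K : ℕ) (E : ℝ → ℝ → ℝ → Prop) : Prop :=
  ∀ (A B : Finset ℝ) (r m : ℕ), A.Nonempty → B.Nonempty → 0 < r → 0 < m → B.card ≤ 2 ^ r →
    (∀ a ∈ A, ∀ S ⊆ B, S.card = m + 1 → ¬ ∀ x ∈ S, ∀ y ∈ S, x < y → E a x y) →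
    ∃ A' ⊆ A, ∃ B' ⊆ B, A.card ≤ (K * r * m) ^ K * A'.card ∧ B.card ≤ (K * r * m) ^ K * B'.card ∧
      ∀ a ∈ A', ∀ x ∈ B', ∀ y ∈ B', x < y → ¬ E a x y

theorem LastFree.mono {K K' : ℕ} {E : ℝ → ℝ → ℝ → Prop} (h : LastFree K E) (hK : K ≤ K') :
    LastFree K' E := by
  intro A B r m hA hB hr hm hcard hc
  obtain ⟨A', hA', B', hB', h1, h2, h3⟩ := h A B r m hA hB hr hm hcard hc
  have hle : (K * r * m) ^ K ≤ (K' * r * m) ^ K' := by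
    rcases Nat.eq_zero_or_pos K' with rfl | hpos
    · rw [Nat.le_zero.1 hK]
    · calc (K * r * m) ^ K ≤ (K' * r * m) ^ K :=
            Nat.pow_le_pow_left (Nat.mul_le_mul_right _ (Nat.mul_le_mul_right _ hK)) _
        _ ≤ _ := Nat.pow_le_pow_right (by positivity) hK
  exact ⟨A', hA', B', hB', h1.trans (Nat.mul_le_mul_right _ hle),
    h2.trans (Nat.mul_le_mul_right _ hle), h3⟩

theorem LastFree.firstFree {K : ℕ} {E : ℝ → ℝ → ℝ → Prop}
    (h : LastFree K fun x y b => E (-b) (-y) (-x)) : FirstFree K E := by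
  classical
  have hneg : Function.Injective fun x : ℝ => -x := neg_injective
  have hcard : ∀ A : Finset ℝ, (A.image fun x => -x).card = A.card := fun A =>
    Finset.card_image_of_injective A hneg
  have hmem : ∀ (A : Finset ℝ) (x : ℝ), x ∈ A → -x ∈ A.image fun x => -x := fun A x hx =>
    Finset.mem_image_of_mem _ hx
  have hmem' : ∀ (A : Finset ℝ) (x : ℝ), x ∈ (A.image fun x => -x) → -x ∈ A := by
    intro A x hx
    obtain ⟨y, hy, rfl⟩ := Finset.mem_image.1 hx
    rwa [neg_neg]
  have hsub : ∀ A B : Finset ℝ, A ⊆ (B.image fun x => -x) → (A.image fun x => -x) ⊆ B := by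
    intro A B hAB x hx
    have := hmem' B _ (hAB (hmem' A x hx))
    rwa [neg_neg] at this
  intro A B r m hA hB hr hm hB2 hc
  obtain ⟨B', hB', A', hA', h1, h2, h3⟩ := h (B.image fun x => -x) (A.image fun x => -x) r m
    (hB.image _) (hA.image _) hr hm (by rwa [hcard]) (by
      intro a ha S hS hScard hall
      refine hc (-a) (hmem' A a ha) (S.image fun x => -x) (hsub S B hS) (by rwa [hcard]) ?_
      intro x hx y hy hxy
      simpa using hall (-y) (hmem' S y hy) (-x) (hmem' S x hx) (neg_lt_neg hxy))
  rw [hcard] at h1 h2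
  refine ⟨A'.image fun x => -x, hsub _ _ hA', B'.image fun x => -x, hsub _ _ hB', by rwa [hcard],
    by rwa [hcard], ?_⟩
  intro a ha x hx y hy hxy
  simpa using h3 (-y) (hmem' _ y hy) (-x) (hmem' _ x hx) (neg_lt_neg hxy) (-a) (hmem' _ a ha)

theorem Finset.exists_halves (A : Finset ℝ) (hA : 2 ≤ A.card) :
    ∃ A₁ ⊆ A, ∃ A₂ ⊆ A, A.card ≤ 3 * A₁.card ∧ A.card ≤ 3 * A₂.card ∧
      ∀ x ∈ A₁, ∀ y ∈ A₂, x < y := by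
  classical
  let e := A.orderEmbOfFin rfl
  set h := A.card / 2 with hh
  have h1 : ∀ j : Fin h, j.1 < A.card := fun j => by have := j.2; omega
  have h2 : ∀ j : Fin h, h + j.1 < A.card := fun j => by have := j.2; omega
  refine ⟨Finset.univ.image fun j : Fin h => e ⟨j.1, h1 j⟩, ?_,
    Finset.univ.image fun j : Fin h => e ⟨h + j.1, h2 j⟩, ?_, ?_, ?_, ?_⟩
  · intro x hx
    obtain ⟨j, -, rfl⟩ := Finset.mem_image.1 hx
    exact A.orderEmbOfFin_mem rfl _
  · intro x hx
    obtain ⟨j, -, rfl⟩ := Finset.mem_image.1 hx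
    exact A.orderEmbOfFin_mem rfl _
  · rw [Finset.card_image_of_injective, Finset.card_univ, Fintype.card_fin]
    · omega
    · intro j j' hjj
      have := congrArg Fin.val (e.injective hjj)
      exact Fin.ext this
  · rw [Finset.card_image_of_injective, Finset.card_univ, Fintype.card_fin]
    · omega
    · intro j j' hjj
      have := congrArg Fin.val (e.injective hjj)
      simp only at this
      exact Fin.ext (by omega)
  · intro x hx y hy
    obtain ⟨j, -, rfl⟩ := Finset.mem_image.1 hx
    obtain ⟨j', -, rfl⟩ := Finset.mem_image.1 hy
    apply e.strictMono
    rw [Fin.lt_def]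
    have := j.2
    simp only
    omega

/-- All increasing triples of `S` are in `E`. -/
def TripleClique (E : ℝ → ℝ → ℝ → Prop) (S : Finset ℝ) : Prop :=
  ∀ x ∈ S, ∀ y ∈ S, ∀ z ∈ S, x < y → y < z → E x y z

/-- No increasing triple of `S` is in `E`. -/
def TripleIndependent (E : ℝ → ℝ → ℝ → Prop) (S : Finset ℝ) : Prop :=
  ∀ x ∈ S, ∀ y ∈ S, ∀ z ∈ S, x < y → y < z → ¬ E x y z

/-- A set is halved, and `LastFree` then `FirstFree` remove all triples meeting both halves.
Independent sets found recursively in the halves therefore unite. A round costs a factor `3` for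
halving and `(K * r * m) ^ K` for each of the two removals. -/
theorem exists_pow_tripleIndependent {E : ℝ → ℝ → ℝ → Prop} {K r m : ℕ} (hlast : LastFree K E)
    (hfirst : FirstFree K E) (hr : 0 < r) (hm : 0 < m) {A : Finset ℝ} (hcard : A.card ≤ 2 ^ r)
    (hcl : ∀ b ∈ A, ∀ S ⊆ A, (∀ x ∈ S, x < b) → S.card = m + 1 →
      ¬ ∀ x ∈ S, ∀ y ∈ S, x < y → E x y b)
    (hcf : ∀ a ∈ A, ∀ S ⊆ A, (∀ x ∈ S, a < x) → S.card = m + 1 →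
      ¬ ∀ x ∈ S, ∀ y ∈ S, x < y → E a x y) (j : ℕ) :
    ∀ A' ⊆ A, (3 * ((K * r * m) ^ K * (K * r * m) ^ K)) ^ j ≤ A'.card →
      ∃ S ⊆ A', S.card = 2 ^ j ∧ TripleIndependent E S := by
  classical
  set l := (K * r * m) ^ K with hl
  have hlpos : 0 < l := by
    rcases Nat.eq_zero_or_pos K with rfl | hpos
    · simp [hl]
    · positivity
  induction j with
  | zero =>
    intro A' _ hA'
    rw [pow_zero] at hA'
    obtain ⟨a, ha⟩ := Finset.card_pos.1 hA'
    refine ⟨{a}, by simpa using ha, by simp, ?_⟩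
    intro x hx y hy z hz hxy
    rw [Finset.mem_singleton] at hx hy
    rw [hx, hy] at hxy
    exact absurd hxy (lt_irrefl _)
  | succ j ih =>
    intro A' hA'A hA'
    have hll : 0 < l * l := Nat.mul_pos hlpos hlpos
    have hpow : 0 < (3 * (l * l)) ^ j := by positivity
    have h3 : 3 ≤ (3 * (l * l)) ^ (j + 1) := by
      rw [pow_succ]
      nlinarith
    obtain ⟨A₁, hA₁, A₂, hA₂, hc₁, hc₂, hlt⟩ := A'.exists_halves (by omega)
    have hn₁ : A₁.Nonempty := Finset.card_pos.1 (by omega)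
    have hn₂ : A₂.Nonempty := Finset.card_pos.1 (by omega)
    obtain ⟨A₃, hA₃, A₄, hA₄, hc₃, hc₄, hfree⟩ := hlast A₁ A₂ r m hn₁ hn₂ hr hm
      ((Finset.card_le_card (hA₁.trans hA'A)).trans hcard)
      (fun b hb S hS hSc => hcl b (hA'A (hA₂ hb)) S (hS.trans (hA₁.trans hA'A))
        (fun x hx => hlt x (hS hx) b hb) hSc)
    obtain ⟨A₅, hA₅, A₆, hA₆, hc₅, hc₆, hfree'⟩ := hfirst A₃ A₄ r m (hn₁.of_card_le_mul hc₃)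
      (hn₂.of_card_le_mul hc₄) hr hm
      ((Finset.card_le_card (hA₄.trans (hA₂.trans hA'A))).trans hcard)
      (fun a ha S hS hSc => hcf a (hA'A (hA₁ (hA₃ ha))) S (hS.trans (hA₄.trans (hA₂.trans hA'A)))
        (fun x hx => hlt a (hA₃ ha) x (hA₄ (hS hx))) hSc)
    have hsize : ∀ {B C D : Finset ℝ}, A'.card ≤ 3 * B.card → B.card ≤ l * C.card →
        C.card ≤ l * D.card → (3 * (l * l)) ^ j ≤ D.card := by
      intro B C D h1 h2 h3
      have h4 : (3 * (l * l)) * (3 * (l * l)) ^ j ≤ (3 * (l * l)) * D.card := by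
        rw [← pow_succ']
        calc _ ≤ A'.card := hA'
          _ ≤ 3 * B.card := h1
          _ ≤ 3 * (l * C.card) := Nat.mul_le_mul_left _ h2
          _ ≤ 3 * (l * (l * D.card)) := Nat.mul_le_mul_left _ (Nat.mul_le_mul_left _ h3)
          _ = _ := by ring
      exact Nat.le_of_mul_le_mul_left h4 (by positivity)
    obtain ⟨S, hS, hScard, hSi⟩ := ih A₅ (hA₅.trans (hA₃.trans (hA₁.trans hA'A))) (hsize hc₁ hc₃ hc₅)
    obtain ⟨T, hT, hTcard, hTi⟩ := ih A₆ (hA₆.trans (hA₄.trans (hA₂.trans hA'A))) (hsize hc₂ hc₄ hc₆)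
    have hST : ∀ x ∈ S, ∀ y ∈ T, x < y := fun x hx y hy =>
      hlt x (hA₃ (hA₅ (hS hx))) y (hA₄ (hA₆ (hT hy)))
    refine ⟨S ∪ T, Finset.union_subset (hS.trans (hA₅.trans (hA₃.trans hA₁)))
      (hT.trans (hA₆.trans (hA₄.trans hA₂))), ?_, ?_⟩
    · rw [Finset.card_union_of_disjoint, hScard, hTcard]
      · ring
      · rw [Finset.disjoint_left]
        exact fun x hx hx' => lt_irrefl _ (hST x hx x hx')
    · intro x hx y hy z hz hxy hyz
      rcases Finset.mem_union.1 hx with hx | hx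
      · rcases Finset.mem_union.1 hy with hy | hy
        · rcases Finset.mem_union.1 hz with hz | hz
          · exact hSi x hx y hy z hz hxy hyz
          · exact hfree x (hA₅ (hS hx)) y (hA₅ (hS hy)) hxy z (hA₆ (hT hz))
        · rcases Finset.mem_union.1 hz with hz | hz
          · exact absurd hyz (hST z hz y hy).not_gt
          · exact hfree' x (hS hx) y (hT hy) z (hT hz) hyz
      · rcases Finset.mem_union.1 hy with hy | hy
        · exact absurd hxy (hST y hy x hx).not_gt
        · rcases Finset.mem_union.1 hz with hz | hz
          · exact absurd hyz (hST z hz y hy).not_gt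
          · exact hTi x hx y hy z hz hxy hyz

theorem exists_linear_le_two_pow (a b : ℕ) : ∃ δ : ℕ, a + b * δ ≤ 2 ^ δ := by
  refine ⟨3 * (a + b), ?_⟩
  have h : a + b + 1 ≤ 2 ^ (a + b) := Nat.lt_two_pow_self
  calc a + b * (3 * (a + b)) ≤ (a + b + 1) ^ 3 := by
        nlinarith [Nat.zero_le (a * b), Nat.zero_le (a * a), Nat.zero_le (b * b),
          Nat.zero_le ((a + b) ^ 3)]
    _ ≤ (2 ^ (a + b)) ^ 3 := Nat.pow_le_pow_left h 3
    _ = 2 ^ (3 * (a + b)) := by rw [← pow_mul, mul_comm]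

/-- With `r = 2 ^ δ * L ^ 2 * Q` and `m = 2 ^ Q` one round costs `2 ^ O(L + Q)`, so `L` rounds cost
an exponent `O(L * (L + Q))`, which is at most `r` once `2 ^ δ` absorbs the constant. -/
theorem recursion_exponent_bound {K δ L Q : ℕ} (hδ : 2 + 2 * K * (K + δ + 4) ≤ 2 ^ δ) (hL : 0 < L)
    (hQ : 0 < Q) : (3 * ((K * (2 ^ δ * L ^ 2 * Q) * 2 ^ Q) ^ K *
      (K * (2 ^ δ * L ^ 2 * Q) * 2 ^ Q) ^ K)) ^ L ≤ 2 ^ (2 ^ δ * L ^ 2 * Q) := by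
  have h1 : K * (2 ^ δ * L ^ 2 * Q) * 2 ^ Q ≤ 2 ^ (K + δ + 2 * L + 2 * Q) := by
    have hk : K ≤ 2 ^ K := Nat.lt_two_pow_self.le
    have hl : L ≤ 2 ^ L := Nat.lt_two_pow_self.le
    have hq : Q ≤ 2 ^ Q := Nat.lt_two_pow_self.le
    calc K * (2 ^ δ * L ^ 2 * Q) * 2 ^ Q ≤ 2 ^ K * (2 ^ δ * (2 ^ L) ^ 2 * 2 ^ Q) * 2 ^ Q := by gcongr
      _ = 2 ^ (K + δ + 2 * L + 2 * Q) := by ring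
  have h2 : 3 * ((K * (2 ^ δ * L ^ 2 * Q) * 2 ^ Q) ^ K * (K * (2 ^ δ * L ^ 2 * Q) * 2 ^ Q) ^ K) ≤
      2 ^ (2 + 2 * K * (K + δ + 2 * L + 2 * Q)) := by
    calc _ ≤ 2 ^ 2 * ((2 ^ (K + δ + 2 * L + 2 * Q)) ^ K * (2 ^ (K + δ + 2 * L + 2 * Q)) ^ K) := by
          gcongr
          norm_num
      _ = _ := by rw [← pow_mul, ← pow_add, ← pow_add]; congr 1; ring
  calc _ ≤ (2 ^ (2 + 2 * K * (K + δ + 2 * L + 2 * Q))) ^ L := Nat.pow_le_pow_left h2 L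
    _ = 2 ^ ((2 + 2 * K * (K + δ + 2 * L + 2 * Q)) * L) := by rw [← pow_mul]
    _ ≤ 2 ^ (2 ^ δ * L ^ 2 * Q) := by
      refine Nat.pow_le_pow_right (by norm_num) ?_
      have h3 : 2 + 2 * K * (K + δ + 2 * L + 2 * Q) ≤ (2 + 2 * K * (K + δ + 4)) * (L * Q) := by
        obtain ⟨a, rfl⟩ := Nat.exists_eq_succ_of_ne_zero hL.ne'
        obtain ⟨b, rfl⟩ := Nat.exists_eq_succ_of_ne_zero hQ.ne'
        have : K + δ + 2 * (a + 1) + 2 * (b + 1) ≤ (K + δ + 4) * ((a + 1) * (b + 1)) := by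
          nlinarith [Nat.zero_le (a * b), Nat.zero_le (K * (a * b)), Nat.zero_le (δ * (a * b)),
            Nat.zero_le (K * a), Nat.zero_le (K * b), Nat.zero_le (δ * a), Nat.zero_le (δ * b)]
        calc _ ≤ 2 * ((a + 1) * (b + 1)) + 2 * K * ((K + δ + 4) * ((a + 1) * (b + 1))) := by
              refine Nat.add_le_add ?_ (Nat.mul_le_mul_left _ this)
              nlinarith [Nat.zero_le (a * b)]
          _ = _ := by simp only [Nat.succ_eq_add_one]; ring
      calc _ ≤ ((2 + 2 * K * (K + δ + 4)) * (L * Q)) * L := Nat.mul_le_mul_right _ h3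
        _ ≤ (2 ^ δ * (L * Q)) * L := Nat.mul_le_mul_right _ (Nat.mul_le_mul_right _ hδ)
        _ = _ := by ring

/-- The quasi-polynomial off-diagonal Ramsey theorem for finite sets of reals. -/
theorem exists_clique_or_independent {E : ℝ → ℝ → ℝ → Prop} {K δ : ℕ}
    (hδ : 2 + 2 * K * (K + δ + 4) ≤ 2 ^ δ) (hlast : LastFree K E) (hfirst : FirstFree K E) {L : ℕ}
    (hL : 0 < L) (s : ℕ) : ∀ A : Finset ℝ, 2 ^ ((2 ^ δ * L ^ 2) ^ s) ≤ A.card →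
      (∃ S ⊆ A, S.card = s ∧ TripleClique E S) ∨
      (∃ S ⊆ A, S.card = 2 ^ L ∧ TripleIndependent E S) := by
  classical
  induction s with
  | zero => exact fun A _ => Or.inl ⟨∅, by simp, rfl, by simp [TripleClique]⟩
  | succ s ih =>
    intro A hA
    by_contra hcon
    push Not at hcon
    obtain ⟨hclique, hind⟩ := hcon
    set Q := (2 ^ δ * L ^ 2) ^ s with hQ
    have hQpos : 0 < Q := by positivity
    rw [pow_succ', ← hQ] at hA
    obtain ⟨A₀, hA₀, hcard⟩ := Finset.exists_subset_card_eq hA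
    -- Since independent sets of size `2 ^ L` are excluded, the induction hypothesis gives an
    -- `s`-clique in each set of this size. A vertex joined to all its pairs would complete an `(s +
    -- 1)`-clique.
    have hsub : ∀ S ⊆ A₀, S.card = 2 ^ Q + 1 → ∃ T ⊆ S, T.card = s ∧ TripleClique E T := by
      intro S hS hSc
      rcases ih S (by omega) with h | ⟨T, hT, hTc, hTi⟩
      · exact h
      · exact absurd hTi (hind T (hT.trans (hS.trans hA₀)) hTc)
    obtain ⟨S, hS, hSc, hSi⟩ := exists_pow_tripleIndependent hlast hfirst
      (r := 2 ^ δ * L ^ 2 * Q) (m := 2 ^ Q) (by positivity) (by positivity) hcard.le (by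
        intro b hb S hS hlt hSc hall
        obtain ⟨T, hT, hTc, hTcl⟩ := hsub S hS hSc
        have hbT : b ∉ T := fun h => lt_irrefl _ (hlt b (hT h))
        refine hclique (insert b T)
          (Finset.insert_subset (hA₀ hb) (hT.trans (hS.trans hA₀)))
          (by rw [Finset.card_insert_of_notMem hbT, hTc]) ?_
        have hb' : ∀ x ∈ insert b T, x ≤ b := fun x hx =>
          (Finset.mem_insert.1 hx).elim (fun h => h.le) fun h => (hlt x (hT h)).le
        intro x hx y hy z hz hxy hyz
        have hy' := (Finset.mem_insert.1 hy).resolve_left fun h =>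
          absurd (h ▸ hyz) (hb' z hz).not_gt
        have hx' := (Finset.mem_insert.1 hx).resolve_left fun h =>
          absurd (h ▸ hxy) (hb' y hy).not_gt
        rcases Finset.mem_insert.1 hz with rfl | hz
        · exact hall x (hT hx') y (hT hy') hxy
        · exact hTcl x hx' y hy' z hz hxy hyz) (by
        intro a ha S hS hlt hSc hall
        obtain ⟨T, hT, hTc, hTcl⟩ := hsub S hS hSc
        have haT : a ∉ T := fun h => lt_irrefl _ (hlt a (hT h))
        refine hclique (insert a T)
          (Finset.insert_subset (hA₀ ha) (hT.trans (hS.trans hA₀)))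
          (by rw [Finset.card_insert_of_notMem haT, hTc]) ?_
        have ha' : ∀ x ∈ insert a T, a ≤ x := fun x hx =>
          (Finset.mem_insert.1 hx).elim (fun h => h.ge) fun h => (hlt x (hT h)).le
        intro x hx y hy z hz hxy hyz
        have hy' := (Finset.mem_insert.1 hy).resolve_left fun h =>
          absurd (h ▸ hxy) (ha' x hx).not_gt
        have hz' := (Finset.mem_insert.1 hz).resolve_left fun h =>
          absurd (h ▸ hyz) (ha' y hy).not_gt
        rcases Finset.mem_insert.1 hx with rfl | hx
        · exact hall y (hT hy') z (hT hz') hyz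
        · exact hTcl x hx y hy' z hz' hxy hyz) L A₀ subset_rfl (by
        rw [hcard]
        exact recursion_exponent_bound hδ hL hQpos)
    exact hind S (hS.trans hA₀) hSc hSi

/-! ### From sets of reals to sequences of reals -/

/-- If three transitive relations cover all increasing pairs of a large set, one of them has a long
chain. -/
theorem Finset.exists_chain_of_cover {α : Type*} [LinearOrder α] {R : Fin 3 → α → α → Prop}
    (htrans : ∀ k x y z, R k x y → R k y z → R k x z) {S : Finset α}
    (hcover : ∀ x ∈ S, ∀ y ∈ S, x < y → ∃ k, R k x y) {n : ℕ} (hn : n ^ 3 < S.card) :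
    ∃ k, ∃ T ⊆ S, n < T.card ∧ ∀ x ∈ T, ∀ y ∈ T, x < y → R k x y := by
  classical
  by_contra hcon
  push Not at hcon
  let F : Fin 3 → α → Finset (Finset α) := fun k x => S.powerset.filter fun T =>
    x ∈ T ∧ (∀ a ∈ T, a ≤ x) ∧ ∀ a ∈ T, ∀ b ∈ T, a < b → R k a b
  -- `h k x` is the size of the largest `R k`-chain ending at `x`. The triple of heights is
  -- injective on `S`, by the cover, with values in `{1, ..., n} ^ 3`.
  let h : Fin 3 → α → ℕ := fun k x => (F k x).sup Finset.card
  have hle : ∀ k x, h k x ≤ n := by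
    intro k x
    refine Finset.sup_le fun T hT => ?_
    by_contra hlt
    obtain ⟨hTS, -, -, hT⟩ := Finset.mem_filter.1 hT
    obtain ⟨a, ha, b, hb, hab, hR⟩ := hcon k T (Finset.mem_powerset.1 hTS) (not_le.1 hlt)
    exact hR (hT a ha b hb hab)
  have hsingle : ∀ k, ∀ x ∈ S, {x} ∈ F k x := by
    intro k x hx
    refine Finset.mem_filter.2 ⟨by simpa using hx, by simp, by simp, ?_⟩
    intro a ha b hb hab
    rw [Finset.mem_singleton] at ha hb
    rw [ha, hb] at hab
    exact absurd hab (lt_irrefl _)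
  have hpos : ∀ k, ∀ x ∈ S, 1 ≤ h k x := fun k x hx =>
    (by simp : 1 ≤ ({x} : Finset α).card).trans (Finset.le_sup (f := Finset.card) (hsingle k x hx))
  have hstep : ∀ k, ∀ x ∈ S, ∀ y ∈ S, x < y → R k x y → h k x < h k y := by
    intro k x hx y hy hxy hR
    obtain ⟨T, hT, hTc⟩ := Finset.exists_mem_eq_sup (F k x) ⟨_, hsingle k x hx⟩ Finset.card
    obtain ⟨hTS, hxT, hTx, hTR⟩ := Finset.mem_filter.1 hT
    have hyT : y ∉ T := fun hm => absurd (hTx y hm) (not_le.2 hxy)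
    have hins : insert y T ∈ F k y := by
      refine Finset.mem_filter.2 ⟨Finset.mem_powerset.2
        (Finset.insert_subset hy (Finset.mem_powerset.1 hTS)), Finset.mem_insert_self _ _, ?_, ?_⟩
      · intro a ha
        exact (Finset.mem_insert.1 ha).elim (fun h => h.le) fun h => (hTx a h).trans hxy.le
      · intro a ha b hb hab
        rcases Finset.mem_insert.1 hb with rfl | hbT
        · rcases Finset.mem_insert.1 ha with rfl | haT
          · exact absurd hab (lt_irrefl _)
          · rcases (hTx a haT).eq_or_lt with rfl | hax
            · exact hR
            · exact htrans k a x b (hTR a haT x hxT hax) hR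
        · rcases Finset.mem_insert.1 ha with rfl | haT
          · exact absurd hab ((hTx b hbT).trans_lt hxy).not_gt
          · exact hTR a haT b hbT hab
    have := Finset.le_sup (f := Finset.card) hins
    rw [Finset.card_insert_of_notMem hyT, ← hTc] at this
    exact this
  have hcard := Finset.card_le_card_of_injOn (s := S)
    (t := Fintype.piFinset fun _ : Fin 3 => Finset.Icc 1 n) (fun x k => h k x)
    (fun x hx => Fintype.mem_piFinset.2 fun k => Finset.mem_Icc.2 ⟨hpos k x hx, hle k x⟩) (by
      intro x hx y hy hxy
      by_contra hne
      rcases lt_or_gt_of_ne hne with hlt | hlt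
      · obtain ⟨k, hk⟩ := hcover x hx y hy hlt
        exact (hstep k x hx y hy hlt hk).ne (congrFun hxy k)
      · obtain ⟨k, hk⟩ := hcover y hy x hx hlt
        exact (hstep k y hy x hx hlt hk).ne (congrFun hxy k).symm)
  simp only [Fintype.card_piFinset, Nat.card_Icc, Finset.prod_const, Finset.card_univ,
    Fintype.card_fin, Nat.add_sub_cancel] at hcard
  omega

/-- The off-diagonal Ramsey theorem for strictly increasing sequences of reals. -/
theorem exists_clique_or_independent_of_strictMono {E : ℝ → ℝ → ℝ → Prop} {K δ : ℕ}
    (hδ : 2 + 2 * K * (K + δ + 4) ≤ 2 ^ δ) (hlast : LastFree K E) (hfirst : FirstFree K E) {L : ℕ}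
    (hL : 0 < L) (s : ℕ) {α : Type*} [LinearOrder α] {S : Finset α} {x : α → ℝ}
    (hx : ∀ i ∈ S, ∀ j ∈ S, i < j → x i < x j) (hS : 2 ^ ((2 ^ δ * L ^ 2) ^ s) ≤ S.card) :
    (∃ T ⊆ S, T.card = s ∧ ∀ i ∈ T, ∀ j ∈ T, ∀ k ∈ T, i < j → j < k → E (x i) (x j) (x k)) ∨
    (∃ T ⊆ S, T.card = 2 ^ L ∧
      ∀ i ∈ T, ∀ j ∈ T, ∀ k ∈ T, i < j → j < k → ¬ E (x i) (x j) (x k)) := by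
  classical
  have hinj : Set.InjOn x S := by
    intro i hi j hj hij
    by_contra hne
    rcases lt_or_gt_of_ne hne with h | h
    · exact (hx i hi j hj h).ne hij
    · exact (hx j hj i hi h).ne hij.symm
  have hpull : ∀ T' ⊆ S.image x, ∃ T ⊆ S, T.card = T'.card ∧ ∀ i ∈ T, x i ∈ T' := by
    intro T' hT'
    refine ⟨S.filter (x · ∈ T'), Finset.filter_subset _ _, ?_, fun i hi => (Finset.mem_filter.1 hi).2⟩
    rw [← Finset.card_image_of_injOn (f := x) (hinj.mono fun i hi => (Finset.mem_filter.1 hi).1)]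
    congr 1
    ext y
    rw [Finset.mem_image]
    constructor
    · rintro ⟨i, hi, rfl⟩
      exact (Finset.mem_filter.1 hi).2
    · intro hy
      obtain ⟨i, hi, rfl⟩ := Finset.mem_image.1 (hT' hy)
      exact ⟨i, Finset.mem_filter.2 ⟨hi, hy⟩, rfl⟩
  rcases exists_clique_or_independent hδ hlast hfirst hL s (S.image x)
    (by rwa [Finset.card_image_of_injOn hinj]) with ⟨T', hT', hc, h⟩ | ⟨T', hT', hc, h⟩
  · obtain ⟨T, hT, hTc, hTx⟩ := hpull T' hT'
    exact Or.inl ⟨T, hT, hTc.trans hc, fun i hi j hj k hk hij hjk =>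
      h _ (hTx i hi) _ (hTx j hj) _ (hTx k hk) (hx i (hT hi) j (hT hj) hij)
        (hx j (hT hj) k (hT hk) hjk)⟩
  · obtain ⟨T, hT, hTc, hTx⟩ := hpull T' hT'
    exact Or.inr ⟨T, hT, hTc.trans hc, fun i hi j hj k hk hij hjk =>
      h _ (hTx i hi) _ (hTx j hj) _ (hTx k hk) (hx i (hT hi) j (hT hj) hij)
        (hx j (hT hj) k (hT hk) hjk)⟩

/-- The quasi-polynomial off-diagonal Ramsey theorem for ternary semialgebraic relations on
sequences of reals. -/
theorem Semialg.exists_ternary_ramsey {E : (ℕ → ℝ) → ℝ → ℝ → ℝ → Prop}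
    (hE : Semialg fun w => E (fun i => w (i + 3)) (w 0) (w 1) (w 2)) :
    ∃ δ₀ : ℕ, ∀ δ, δ₀ ≤ δ → ∀ (v : ℕ → ℝ) (L s : ℕ), 0 < L → ∀ {α : Type} [LinearOrder α]
      (S : Finset α) (x : α → ℝ), (2 ^ ((2 ^ δ * L ^ 2) ^ s)) ^ 3 < S.card →
      (∃ T ⊆ S, T.card = s ∧ ∀ i ∈ T, ∀ j ∈ T, ∀ k ∈ T, i < j → j < k → E v (x i) (x j) (x k)) ∨
      (∃ T ⊆ S, T.card = 2 ^ L ∧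
        ∀ i ∈ T, ∀ j ∈ T, ∀ k ∈ T, i < j → j < k → ¬ E v (x i) (x j) (x k)) := by
  classical
  have hsub : ∀ σ : Fin 3 → MvPolynomial ℕ ℝ, Semialg fun w => E (fun i => w (i + 3))
      (MvPolynomial.eval w (σ 0)) (MvPolynomial.eval w (σ 1)) (MvPolynomial.eval w (σ 2)) := by
    intro σ
    have := hE.subst fun | 0 => σ 0 | 1 => σ 1 | 2 => σ 2 | i + 3 => MvPolynomial.X (i + 3)
    simpa using this
  have e₂ : Semialg fun w => E (fun i => w (i + 3)) (-w 2) (-w 1) (-w 0) := by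
    simpa using hsub ![-MvPolynomial.X 2, -MvPolynomial.X 1, -MvPolynomial.X 0]
  have e₃ : Semialg fun w => E (fun i => w (i + 3)) (-w 0) (-w 1) (-w 2) := by
    simpa using hsub ![-MvPolynomial.X 0, -MvPolynomial.X 1, -MvPolynomial.X 2]
  have e₄ : Semialg fun w => E (fun i => w (i + 3)) (w 2) (w 1) (w 0) := by
    simpa using hsub ![MvPolynomial.X 2, MvPolynomial.X 1, MvPolynomial.X 0]
  -- Four instances are needed: decreasing sequences are negated to become increasing, and the
  -- mirrored statement for first vertices reverses the arguments as well. For both at once the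
  -- signs cancel.
  obtain ⟨K₁, h₁⟩ := hE.exists_free_pair
  obtain ⟨K₂, h₂⟩ := Semialg.exists_free_pair (E := fun v x y b => E v (-b) (-y) (-x)) e₂
  obtain ⟨K₃, h₃⟩ := Semialg.exists_free_pair (E := fun v x y b => E v (-x) (-y) (-b)) e₃
  obtain ⟨K₄, h₄⟩ := Semialg.exists_free_pair (E := fun v x y b => E v b y x) e₄
  set K := K₁ + K₂ + K₃ + K₄ with hK
  obtain ⟨δ, hδ⟩ := exists_linear_le_two_pow (2 + 2 * K * (K + 4)) (2 * K)
  refine ⟨δ, fun δ' hδδ v L s hL α _ S x hS => ?_⟩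
  have hδ' : 2 + 2 * K * (K + δ' + 4) ≤ 2 ^ δ' := by
    induction δ', hδδ using Nat.le_induction with
    | base => nlinarith
    | succ n hn ih =>
      have hn' := ih (lt_of_le_of_lt (by gcongr <;> omega) hS)
      have : K ≤ K * (K + n + 4) := Nat.le_mul_of_pos_right _ (by omega)
      rw [pow_succ]
      nlinarith
  have m₁ : LastFree K (E v) := LastFree.mono (K := K₁) (h₁ v) (by omega)
  have m₂ : FirstFree K (E v) := LastFree.firstFree (LastFree.mono (K := K₂) (h₂ v) (by omega))
  have m₃ : LastFree K fun x y z => E v (-x) (-y) (-z) :=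
    LastFree.mono (K := K₃) (h₃ v) (by omega)
  have m₄ : FirstFree K fun x y z => E v (-x) (-y) (-z) := by
    refine LastFree.firstFree ?_
    simpa using LastFree.mono (K := K₄) (K' := K) (h₄ v) (by omega)
  -- Points of a sequence may repeat and need not be sorted, so a long increasing, decreasing or
  -- constant subsequence is extracted first; this accounts for the cube.
  obtain ⟨k, T, hTS, hTc, hT⟩ := S.exists_chain_of_cover
    (R := ![fun i j => x i < x j, fun i j => x j < x i, fun i j => x i = x j]) (by
      intro k a b c
      fin_cases k
      · exact fun h h' => lt_trans h h'
      · exact fun h h' => lt_trans h' h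
      · exact fun h h' => Eq.trans h h') (by
      intro a _ b _ _
      rcases lt_trichotomy (x a) (x b) with h | h | h
      · exact ⟨0, h⟩
      · exact ⟨2, h⟩
      · exact ⟨1, h⟩) hS
  fin_cases k
  · rcases exists_clique_or_independent_of_strictMono hδ' m₁ m₂ hL s hT hTc.le with
      ⟨U, hU, h⟩ | ⟨U, hU, h⟩
    · exact Or.inl ⟨U, hU.trans hTS, h⟩
    · exact Or.inr ⟨U, hU.trans hTS, h⟩
  · rcases exists_clique_or_independent_of_strictMono hδ' m₃ m₄ hL s (x := fun i => - x i)
      (fun i hi j hj hij => neg_lt_neg (hT i hi j hj hij)) hTc.le with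
      ⟨U, hU, hUc, h⟩ | ⟨U, hU, hUc, h⟩
    · exact Or.inl ⟨U, hU.trans hTS, hUc, by simpa using h⟩
    · exact Or.inr ⟨U, hU.trans hTS, hUc, by simpa using h⟩
  · have hconst : ∀ i ∈ T, ∀ j ∈ T, x i = x j := by
      intro i hi j hj
      rcases lt_trichotomy i j with h | h | h
      · exact hT i hi j hj h
      · rw [h]
      · exact (hT j hj i hi h).symm
    rcases Nat.eq_zero_or_pos s with rfl | hs
    · exact Or.inl ⟨∅, by simp, rfl, by simp⟩
    have h2 : 2 ≤ 2 ^ δ' := by omega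
    have hs' : s ≤ 2 ^ ((2 ^ δ' * L ^ 2) ^ s) := by
      have h3 : 2 ≤ 2 ^ δ' * L ^ 2 := h2.trans (Nat.le_mul_of_pos_right _ (by positivity))
      calc s ≤ 2 ^ s := Nat.lt_two_pow_self.le
        _ ≤ (2 ^ δ' * L ^ 2) ^ s := Nat.pow_le_pow_left h3 s
        _ ≤ _ := Nat.lt_two_pow_self.le
    have hL' : 2 ^ L ≤ 2 ^ ((2 ^ δ' * L ^ 2) ^ s) := by
      refine Nat.pow_le_pow_right (by norm_num) ?_
      calc L ≤ 2 ^ δ' * L ^ 2 := by nlinarith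
        _ ≤ _ := Nat.le_self_pow hs.ne' _
    obtain ⟨i₀, hi₀⟩ := Finset.card_pos.1 ((Nat.zero_le _).trans_lt hTc)
    by_cases hE₀ : E v (x i₀) (x i₀) (x i₀)
    · obtain ⟨U, hU, hUc⟩ := Finset.exists_subset_card_eq (hs'.trans hTc.le)
      refine Or.inl ⟨U, hU.trans hTS, hUc, fun i hi j hj k hk _ _ => ?_⟩
      rwa [hconst i (hU hi) i₀ hi₀, hconst j (hU hj) i₀ hi₀, hconst k (hU hk) i₀ hi₀]
    · obtain ⟨U, hU, hUc⟩ := Finset.exists_subset_card_eq (hL'.trans hTc.le)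
      refine Or.inr ⟨U, hU.trans hTS, hUc, fun i hi j hj k hk _ _ => ?_⟩
      rwa [hconst i (hU hi) i₀ hi₀, hconst j (hU hj) i₀ hi₀, hconst k (hU hk) i₀ hi₀]

/-! ### Reduction from arity four to arity three -/

/-- The Erdős–Rado greedy selection for a 4-ary relation. -/
theorem Finset.exists_greedy_end_homogeneous {α : Type*} [LinearOrder α] (G : α → α → α → α → Prop)
    (V : Finset α) (M : ℕ) (hV : (2 ^ (M ^ 2 + 1)) ^ M ≤ V.card) (k : ℕ) (hk : k ≤ M) :
    ∃ S ⊆ V, ∃ V' ⊆ V, S.card = k ∧ (2 ^ (M ^ 2 + 1)) ^ (M - k) ≤ V'.card ∧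
      (∀ a ∈ S, ∀ w ∈ V', a < w) ∧
      ∀ a ∈ S, ∀ b ∈ S, ∀ c ∈ S, a < b → b < c → ∀ d ∈ S ∪ V', c < d → ∀ w ∈ V',
        (G a b c d ↔ G a b c w) := by
  classical
  induction k with
  | zero => exact ⟨∅, by simp, V, subset_rfl, rfl, by simpa using hV, by simp, by simp⟩
  | succ k ih =>
    obtain ⟨S, hS, V', hV', hSc, hV'c, hlt, hG⟩ := ih (by omega)
    rw [show M - k = (M - (k + 1)) + 1 by omega, pow_succ] at hV'c
    have hD : 0 < (2 ^ (M ^ 2 + 1)) ^ (M - (k + 1)) := by positivity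
    have h2 : 2 ≤ 2 ^ (M ^ 2 + 1) := by
      calc 2 = 2 ^ 1 := rfl
        _ ≤ _ := Nat.pow_le_pow_right (by norm_num) (by omega)
    have hV'2 : 2 ≤ V'.card := by nlinarith
    have hne : V'.Nonempty := Finset.card_pos.1 (by omega)
    set s := V'.min' hne with hs
    have hsV : s ∈ V' := V'.min'_mem hne
    -- A candidate `d` is coloured by the pairs of `S` that form an edge with `s` and `d`. There are
    -- `2 ^ (k * k)` colours; the spare factor `2` in `2 ^ (M ^ 2 + 1)` pays for removing `s`.
    let f : α → Finset (S × S) := fun d => Finset.univ.filter fun p => G p.1 p.2 s d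
    obtain ⟨p, hp⟩ := (V'.erase s).exists_card_le_mul_card_fiber f
    set V'' := (V'.erase s).filter (f · = p) with hV''
    have hV''V' : V'' ⊆ V' := (Finset.filter_subset _ _).trans (Finset.erase_subset _ _)
    have hslt : ∀ w ∈ V'', s < w := by
      intro w hw
      have hw' := Finset.mem_erase.1 (Finset.mem_filter.1 hw).1
      exact (V'.min'_le w hw'.2).lt_of_ne (Ne.symm hw'.1)
    have hfib : ∀ d ∈ V'', ∀ w ∈ V'', ∀ a ∈ S, ∀ b ∈ S, G a b s d ↔ G a b s w := by
      intro d hd w hw a ha b hb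
      have h := (Finset.mem_filter.1 hd).2.trans (Finset.mem_filter.1 hw).2.symm
      have := Finset.ext_iff.1 h (⟨a, ha⟩, ⟨b, hb⟩)
      simpa [f] using this
    refine ⟨insert s S, Finset.insert_subset (hV' hsV) hS, V'', hV''V'.trans hV', ?_, ?_, ?_, ?_⟩
    · rw [Finset.card_insert_of_notMem fun h => lt_irrefl _ (hlt s h s hsV), hSc]
    · simp only [Fintype.card_finset, Fintype.card_prod, Fintype.card_coe, hSc,
        Finset.card_erase_of_mem hsV] at hp
      have h3 : 2 ^ (k * k) * 2 ≤ 2 ^ (M ^ 2 + 1) := by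
        rw [← pow_succ]
        refine Nat.pow_le_pow_right (by norm_num) ?_
        have : k * k ≤ M * M := Nat.mul_le_mul (by omega) (by omega)
        nlinarith
      have h4 : V'.card ≤ 2 ^ (M ^ 2 + 1) * V''.card := by
        calc V'.card ≤ 2 * (V'.card - 1) := by omega
          _ ≤ 2 * (2 ^ (k * k) * V''.card) := Nat.mul_le_mul_left _ hp
          _ = (2 ^ (k * k) * 2) * V''.card := by ring
          _ ≤ _ := Nat.mul_le_mul_right _ h3
      have h5 := hV'c.trans h4
      rw [mul_comm] at h5
      exact Nat.le_of_mul_le_mul_left h5 (by positivity)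
    · intro a ha w hw
      rcases Finset.mem_insert.1 ha with rfl | ha
      · exact hslt w hw
      · exact hlt a ha w (hV''V' hw)
    · have hle : ∀ a ∈ insert s S, a ≤ s := fun a ha =>
        (Finset.mem_insert.1 ha).elim (fun h => h.le) fun h => (hlt a h s hsV).le
      intro a ha b hb c hc hab hbc d hd hcd w hw
      have hb' := (Finset.mem_insert.1 hb).resolve_left fun h =>
        absurd (h ▸ hbc) (hle c hc).not_gt
      have ha' := (Finset.mem_insert.1 ha).resolve_left fun h =>
        absurd (h ▸ hab) (hle b hb).not_gt
      rcases Finset.mem_insert.1 hc with rfl | hc'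
      · have hd' : d ∈ V'' := by
          rcases Finset.mem_union.1 hd with h | h
          · exact absurd hcd (hle d h).not_gt
          · exact h
        exact hfib d hd' w hw a ha' b hb'
      · refine hG a ha' b hb' c hc' hab hbc d ?_ hcd w (hV''V' hw)
        rcases Finset.mem_union.1 hd with h | h
        · rcases Finset.mem_insert.1 h with rfl | h
          · exact Finset.mem_union_right _ hsV
          · exact Finset.mem_union_left _ h
        · exact Finset.mem_union_right _ (hV''V' h)

/-- A large set contains a subset of size `M` on which a 4-ary relation does not depend on its last
argument, which may be replaced by a fixed element. -/
theorem Finset.exists_end_homogeneous {α : Type*} [LinearOrder α] (G : α → α → α → α → Prop)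
    (V : Finset α) (M : ℕ) (hV : (2 ^ (M ^ 2 + 1)) ^ M ≤ V.card) :
    ∃ S ⊆ V, S.card = M ∧ ∃ w, ∀ a ∈ S, ∀ b ∈ S, ∀ c ∈ S, ∀ d ∈ S, a < b → b < c → c < d →
      (G a b c d ↔ G a b c w) := by
  obtain ⟨S, hS, V', -, hSc, hV'c, -, hG⟩ := V.exists_greedy_end_homogeneous G M hV M le_rfl
  rw [Nat.sub_self, pow_zero] at hV'c
  obtain ⟨w, hw⟩ := Finset.card_pos.1 hV'c
  exact ⟨S, hS, hSc, w, fun a ha b hb c hc d hd hab hbc hcd =>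
    hG a ha b hb c hc hab hbc d (Finset.mem_union_left _ hd) hcd w hw⟩

/-- A family of polynomials in four variables and finitely many coefficients, which specializes to
all families of `t` polynomials of degree at most `t`. -/
theorem exists_universal_polynomials (t : ℕ) : ∃ U : Fin t → MvPolynomial ℕ ℝ,
    ∀ f : Fin t → MvPolynomial (Fin 4 × Fin 1) ℝ, (∀ l, (f l).totalDegree ≤ t) →
      ∃ v : ℕ → ℝ, ∀ (u : Fin 4 × Fin 1 → ℝ) (l : Fin t),
        MvPolynomial.eval (consSeq (u (0, 0)) (consSeq (u (1, 0)) (consSeq (u (2, 0))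
          (consSeq (u (3, 0)) v)))) (U l) = MvPolynomial.eval u (f l) := by
  classical
  let Mon : Finset (Fin 4 × Fin 1 →₀ ℕ) := (Finsupp.finite_of_degree_le t).toFinset
  -- Variables `0` to `3` are the four points. The coefficient of monomial `d` in polynomial `l` is
  -- itself the variable `enc (l, d) + 4`.
  obtain ⟨enc, henc⟩ := Countable.exists_injective_nat (Fin t × (Fin 4 × Fin 1 →₀ ℕ))
  refine ⟨fun l => ∑ d ∈ Mon, MvPolynomial.X (enc (l, d) + 4) *
    ∏ i : Fin 4 × Fin 1, MvPolynomial.X i.1.val ^ d i, fun f hf => ?_⟩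
  refine ⟨Function.extend enc (fun q => (f q.1).coeff q.2) 0, fun u l => ?_⟩
  rw [map_sum, MvPolynomial.eval_eq' u (f l)]
  have hsub : (f l).support ⊆ Mon := by
    intro d hd
    rw [Set.Finite.mem_toFinset]
    exact (MvPolynomial.le_totalDegree hd).trans (hf l)
  rw [Finset.sum_subset hsub fun d _ hd => by
    rw [MvPolynomial.notMem_support_iff.1 hd, zero_mul]]
  refine Finset.sum_congr rfl fun d _ => ?_
  rw [map_mul, MvPolynomial.eval_X, map_prod]
  congr 1
  · change Function.extend enc (fun q => (f q.1).coeff q.2) 0 (enc (l, d)) = _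
    rw [henc.extend_apply]
  · refine Finset.prod_congr rfl ?_
    rintro ⟨i, j⟩ -
    rw [map_pow, MvPolynomial.eval_X, Subsingleton.elim j 0]
    fin_cases i <;> rfl

/-- After end-homogenization the fixed last point joins the coefficients, so one ternary family for
each `Φ` covers all relations of complexity `t`. There are finitely many `Φ`, so one `δ` serves them
all. -/
theorem semialgebraicRamseyProperty_of_ternary (t : ℕ) : ∃ δ : ℕ, ∀ s L n : ℕ, 0 < L → n ≤ 2 ^ L →
    ∀ M, M = (2 ^ ((2 ^ δ * L ^ 2) ^ s)) ^ 3 + 1 →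
      SemialgebraicRamseyProperty 1 t 4 s n ((2 ^ (M ^ 2 + 1)) ^ M) := by
  classical
  obtain ⟨U, hU⟩ := exists_universal_polynomials t
  let E : ((Fin t → Prop) → Prop) → (ℕ → ℝ) → ℝ → ℝ → ℝ → Prop := fun Φ v x y z =>
    Φ fun l => 0 ≤ MvPolynomial.eval (consSeq x (consSeq y (consSeq z v))) (U l)
  have hE : ∀ Φ, Semialg fun w => E Φ (fun i => w (i + 3)) (w 0) (w 1) (w 2) := by
    intro Φ
    have hΦ : Semialg fun w => Φ fun l => 0 ≤ MvPolynomial.eval w (U l) := by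
      refine ⟨Finset.univ.image U, fun v w h => ?_⟩
      have : (fun l => 0 ≤ MvPolynomial.eval v (U l)) = fun l => 0 ≤ MvPolynomial.eval w (U l) := by
        funext l
        have := h (U l) (Finset.mem_image_of_mem _ (Finset.mem_univ l))
        rw [← sign_nonneg_iff, this, sign_nonneg_iff]
      simp only [this]
    refine hΦ.congr fun w => ?_
    have : consSeq (w 0) (consSeq (w 1) (consSeq (w 2) fun i => w (i + 3))) = w := by
      funext i
      match i with
      | 0 => rfl
      | 1 => rfl
      | 2 => rfl
      | i + 3 => rfl
    simp only [E, this]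
  choose δΦ hδΦ using fun Φ => (hE Φ).exists_ternary_ramsey
  obtain ⟨δ, hδ⟩ := Finite.exists_le δΦ
  refine ⟨δ, fun s L n hL hn M hM p F hF => ?_⟩
  obtain ⟨f, Φ, hdeg, hiff⟩ := hF
  obtain ⟨v, hv⟩ := hU f hdeg
  obtain ⟨S, -, hSc, w, hSw⟩ := (Finset.univ : Finset (Fin ((2 ^ (M ^ 2 + 1)) ^ M))).exists_end_homogeneous
    (fun a b c d => E Φ (consSeq (p d 0) v) (p a 0) (p b 0) (p c 0)) M (by
      rw [Finset.card_univ, Fintype.card_fin])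
  have hmem : ∀ e : Fin 4 ↪o Fin ((2 ^ (M ^ 2 + 1)) ^ M), (∀ a, e a ∈ S) →
      (e ∈ F ↔ E Φ (consSeq (p w 0) v) (p (e 0) 0) (p (e 1) 0) (p (e 2) 0)) := by
    intro e he
    rw [hiff, ← hSw _ (he 0) _ (he 1) _ (he 2) _ (he 3) (e.strictMono (by decide))
      (e.strictMono (by decide)) (e.strictMono (by decide))]
    have : (fun l => 0 ≤ MvPolynomial.eval (fun x : Fin 4 × Fin 1 => p (e x.1) x.2) (f l)) =
        fun l => 0 ≤ MvPolynomial.eval (consSeq (p (e 0) 0) (consSeq (p (e 1) 0)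
          (consSeq (p (e 2) 0) (consSeq (p (e 3) 0) v)))) (U l) := by
      funext l
      rw [← hv (fun x => p (e x.1) x.2) l]
    simp only [E, this]
  rcases hδΦ Φ δ (hδ Φ) (consSeq (p w 0) v) L s hL S (fun i => p i 0) (by omega) with
    ⟨T, hT, hTc, h⟩ | ⟨T, hT, hTc, h⟩
  · refine Or.inl ⟨T, hTc, fun e he => (hmem e fun a => hT (he a)).2 ?_⟩
    exact h _ (he 0) _ (he 1) _ (he 2) (e.strictMono (by decide)) (e.strictMono (by decide))
  · obtain ⟨T', hT', hTc'⟩ := Finset.exists_subset_card_eq (hn.trans hTc.ge)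
    refine Or.inr ⟨T', hTc', fun e he hm => ?_⟩
    refine h _ (hT' (he 0)) _ (hT' (he 1)) _ (hT' (he 2)) (e.strictMono (by decide))
      (e.strictMono (by decide)) ((hmem e fun a => hT (hT' (he a))).1 hm)

/-! ### Final numerical estimates -/

theorem tower_bound {X M : ℕ} (hX : 0 < X) (hM : M = (2 ^ X) ^ 3 + 1) :
    (2 ^ (M ^ 2 + 1)) ^ M ≤ 2 ^ (2 ^ (16 * X)) := by
  have h1 : 2 ≤ 2 ^ X := by
    calc 2 = 2 ^ 1 := rfl
      _ ≤ _ := Nat.pow_le_pow_right (by norm_num) hX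
  have h2 : M ≤ (2 ^ X) ^ 4 := by
    have : 1 ≤ (2 ^ X) ^ 3 := Nat.one_le_pow _ _ (by positivity)
    rw [hM, pow_succ (2 ^ X) 3]
    nlinarith
  have h3 : 2 ≤ M := by
    have : 1 ≤ (2 ^ X) ^ 3 := Nat.one_le_pow _ _ (by positivity)
    omega
  rw [← pow_mul]
  refine Nat.pow_le_pow_right (by norm_num) ?_
  calc (M ^ 2 + 1) * M ≤ M ^ 4 := by nlinarith [Nat.zero_le (M ^ 3), pow_pos (show 0 < M by omega) 3]
    _ ≤ ((2 ^ X) ^ 4) ^ 4 := Nat.pow_le_pow_left h2 4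
    _ = 2 ^ (16 * X) := by rw [← pow_mul, ← pow_mul]; congr 1; ring

theorem clog_le_three_mul_log {n : ℕ} (hn : 4 ≤ n) : (Nat.clog 2 n : ℝ) ≤ 3 * Real.log n := by
  have h1 := Nat.pow_pred_clog_lt_self (b := 2) (by norm_num) (x := n) (by omega)
  have hpos : 0 < Nat.clog 2 n := Nat.clog_pos (by norm_num) (by omega)
  have h2 : ((2 : ℝ) ^ (Nat.clog 2 n).pred) ≤ n := by exact_mod_cast h1.le
  have h3 := Real.log_le_log (by positivity) h2
  rw [Real.log_pow] at h3
  have h4 : ((Nat.clog 2 n).pred : ℝ) = Nat.clog 2 n - 1 := by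
    rw [Nat.pred_eq_sub_one, Nat.cast_sub hpos, Nat.cast_one]
  have h5 : 2 * Real.log 2 ≤ Real.log n := by
    have : Real.log 4 ≤ Real.log n := Real.log_le_log (by norm_num) (by exact_mod_cast hn)
    rwa [show (4 : ℝ) = 2 ^ 2 by norm_num, Real.log_pow, Nat.cast_two] at this
  have h6 := Real.log_two_gt_d9
  rw [h4] at h3
  have h7 : (1 : ℝ) ≤ Nat.clog 2 n := by exact_mod_cast hpos
  nlinarith

theorem corollary1p7 (s t : ℕ) :
    ∃ c : ℝ, 0 < c ∧ ∀ n : ℕ, 4 ≤ n →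
      (∃ N : ℕ, SemialgebraicRamseyProperty 1 t 4 s n N) ∧
      (semialgebraicRamsey 1 t 4 s n : ℝ) ≤ (2 : ℝ) ^ ((2 : ℝ) ^ (Real.log (n : ℝ) ^ c)) := by
  obtain ⟨δ, hδ⟩ := semialgebraicRamseyProperty_of_ternary t
  -- As `log n ≥ log 4 > 1.3`, a power `(log n) ^ k` absorbs the constant; the `9` is the square of
  -- the `3` in `clog_le_three_mul_log`. The extra `1` in the exponent keeps `c` positive.
  obtain ⟨k, hk⟩ := pow_unbounded_of_one_lt (16 * (2 ^ δ * 9) ^ s : ℝ) (show (1 : ℝ) < 1.3 by norm_num)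
  refine ⟨((2 * s + k + 1 : ℕ) : ℝ), by positivity, fun n hn => ?_⟩
  set L := Nat.clog 2 n with hL
  have hLpos : 0 < L := Nat.clog_pos (by norm_num) (by omega)
  set X := (2 ^ δ * L ^ 2) ^ s with hX
  have hXpos : 0 < X := by positivity
  have hprop := hδ s L n hLpos (Nat.le_pow_clog (by norm_num) n) _ rfl
  refine ⟨⟨_, hprop⟩, ?_⟩
  have hle : semialgebraicRamsey 1 t 4 s n ≤ 2 ^ (2 ^ (16 * X)) :=
    (Nat.sInf_le hprop).trans (tower_bound hXpos rfl)
  have hlog : (1.3 : ℝ) ≤ Real.log n := by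
    have : Real.log 4 ≤ Real.log n := Real.log_le_log (by norm_num) (by exact_mod_cast hn)
    rw [show (4 : ℝ) = 2 ^ 2 by norm_num, Real.log_pow, Nat.cast_two] at this
    have := Real.log_two_gt_d9
    linarith
  have hexp : ((16 * X : ℕ) : ℝ) ≤ Real.log n ^ ((2 * s + k + 1 : ℕ) : ℝ) := by
    rw [Real.rpow_natCast]
    have hl : (L : ℝ) ≤ 3 * Real.log n := clog_le_three_mul_log hn
    calc ((16 * X : ℕ) : ℝ) = 16 * (2 ^ δ * (L : ℝ) ^ 2) ^ s := by rw [hX]; push_cast; ring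
      _ ≤ 16 * (2 ^ δ * (3 * Real.log n) ^ 2) ^ s := by gcongr
      _ = (16 * (2 ^ δ * 9) ^ s) * Real.log n ^ (2 * s) := by
        rw [show (2 : ℝ) ^ δ * (3 * Real.log n) ^ 2 = (2 ^ δ * 9) * Real.log n ^ 2 by ring, mul_pow,
          ← pow_mul]
        ring
      _ ≤ Real.log n ^ k * Real.log n ^ (2 * s) := by
        have : (1.3 : ℝ) ^ k ≤ Real.log n ^ k := by gcongr
        have h0 : 0 ≤ Real.log n ^ (2 * s) := by positivity
        exact mul_le_mul_of_nonneg_right (hk.le.trans this) h0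
      _ = Real.log n ^ (2 * s + k) := by rw [← pow_add, add_comm]
      _ ≤ Real.log n ^ (2 * s + k + 1) := pow_le_pow_right₀ (by linarith) (Nat.le_succ _)
  calc (semialgebraicRamsey 1 t 4 s n : ℝ) ≤ ((2 ^ (2 ^ (16 * X)) : ℕ) : ℝ) := by exact_mod_cast hle
    _ = (2 : ℝ) ^ ((2 : ℝ) ^ ((16 * X : ℕ) : ℝ)) := by
      have e : (2 : ℝ) ^ ((16 * X : ℕ) : ℝ) = ((2 ^ (16 * X) : ℕ) : ℝ) := by
        rw [Real.rpow_natCast, Nat.cast_pow, Nat.cast_ofNat]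
      rw [e, Real.rpow_natCast, Nat.cast_pow, Nat.cast_ofNat]
    _ ≤ _ := by
      refine Real.rpow_le_rpow_of_exponent_le (by norm_num) ?_
      exact Real.rpow_le_rpow_of_exponent_le (by norm_num) hexp
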